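/- **Setting.** Let $0<a,b<1$ with $a+b\le 1$, put $\lambda=1-b$, and assume $a<1+\lambda-\lambda^3-\lambda^4$. Let $P$ be the closed convex quadrilateral with vertices $A=(0,1)$, $B=(a,1)$, $C=(1,b)$, $D=(0,0)$ (clockwise), and let $S$ be the union of the rays $\overrightarrow{AB},\overrightarrow{BC},\overrightarrow{CD},\overrightarrow{DA}$. For $p\notin P\cup S$ let $v$ be the unique vertex such that $P$ lies on the left of the ray from $p$ through $v$, and put $T(p)=v+\lambda(v-p)$. Let $X$ be the set of $p\notin P$ such that no iterate $T^n p$, $n\ge 0$, lies in $S$. Put $$l=\lambda^{-1}+(1-a)\lambda^{-2},\quad h=l-a\lambda^{-3},\quad y=\lambda(1+\lambda)(1+a\lambda^2-\lambda^3),\quad c=1-h/l,$$ and, for $\varepsilon>0$, $R_1=[-l+\varepsilon,0]\times[1,1+\varepsilon^2]$ and $R_2=[-l+\varepsilon,0]\times[1-\varepsilon^2,1]$. The map $g$ describes the first return of $T$ to $R_2$, projected vertically to the segment from $E=(-l,1)$ to $A$, which is parametrized by $x\in[0,1]\mapsto(-(1-x)l,1)$: $g(x)=z$ if, for all small $\varepsilon$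 and every $\delta\in(0,\varepsilon^2]$, the first return of $(-(1-x)l,1-\delta)$ to $R_2$ is defined and has first coordinate $-(1-z)l$. At a parameter $x\in(0,1]$ where this first return is undefined, $g(x)$ is the limit of $g$ from the left. A *periodic orbit* of $T$ is a periodic sequence $(w_i)_{i\ge0}$ in which each $w_{i+1}$ is the image of $w_i$ under a branch $p\mapsto v+\lambda(v-p)$ of $T$ whose domain has $w_i$ in its closure (so $w_{i+1}=Tw_i$ if $w_i\notin P\cup S$), and for which the choices at singular points are made from one side: there are $p_k\in X$ with $T^i p_k\to w_i$ as $k\to\infty$, for every $i$. **Theorem.** 1. $g$ is well defined: the first-return value exists and is unique for every $x\in(0,1)$, $x\ne c$. The map $g$ sends $(0,1]$ into $(0,1]$ and $$g(x)=\begin{cases}\lambda^4(x-1+h/l)+1,&0<x<1-h/l,\\ \lambda^6(x-1)+(1-y/l),&1-h/l<x\le1.\end{cases}$$ It is injective on $(0,1]$, and it is a contraction (Lipschitz with a constant less than $1$) on each of $(0,c]$ and $(c,1]$. 2. The rotation number $\rho(g)$ is well defined modulo $1$: the circle map $g$ has a strictly increasing lift $F:\mathbb R\to\mathbb R$ with $F(x+1)=F(x)+1$;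 for every such lift the limit $\lim_n (F^n(x)-x)/n$ exists and does not depend on $x$; and for two such lifts these limits differ by an integer. 3. If $\rho(g)$ is rational, then for all sufficiently small $\varepsilon>0$ at most two periodic orbits of $T$ meet $R_1\cup R_2$, and every point $p\in X\cap(R_1\cup R_2)$ is asymptotic to one of them: there is such an orbit $(w_n)$, suitably indexed, with $|T^n p-w_n|\to0$. 4. If $\rho(g)$ is irrational, then there is a unique Cantor set $K$ such that for all sufficiently small $\varepsilon>0$ every point $p\in X\cap(R_1\cup R_2)$ is asymptotic to $K$, in the sense that its $\omega$-limit set under $T$ is $K$ and $\operatorname{dist}(T^n p,K)\to0$. -/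

import Mathlib

open Set Filter Topology

namespace ContractedBilliard

/-- The planar cross product; `0 < cross u v` means that `v` points to the left of `u`. -/
def cross (u v : ℝ × ℝ) : ℝ := u.1 * v.2 - u.2 * v.1

/-- The closed polygon with vertices `V 0, V 1, V 2, V 3`. -/
def polygon (V : Fin 4 → ℝ × ℝ) : Set (ℝ × ℝ) := convexHull ℝ (range V)

/-- The union `S` of the singular rays from `V i` through `V (i + 1)` (indices modulo 4), for
vertices listed clockwise. -/
def singularSet (V : Fin 4 → ℝ × ℝ) : Set (ℝ × ℝ) :=
  ⋃ i : Fin 4, {p | ∃ t : ℝ, 0 ≤ t ∧ p = V i + t • (V (i + 1) - V i)}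

/-- The set of points `p` such that the polygon lies on the left of the ray from `p`
through `V i`. For a convex polygon these four sets are disjoint and their union is the
complement of the polygon and of the singular rays. -/
def tangentRegion (V : Fin 4 → ℝ × ℝ) (i : Fin 4) : Set (ℝ × ℝ) :=
  {p | ∀ j, j ≠ i → 0 < cross (V i - p) (V j - p)}

/-- The point `q` on the ray from `p` through `v`, beyond `v`, with `|pv| : |vq| = 1 : lam`. -/
def reflect (lam : ℝ) (v p : ℝ × ℝ) : ℝ × ℝ := v + lam • (v - p)

open Classical in
/-- Outer billiards with contraction. On the polygon and on the singular rays, where the map is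
undefined, the value is the point itself; no statement depends on it. -/
noncomputable def billiard (V : Fin 4 → ℝ × ℝ) (lam : ℝ) (p : ℝ × ℝ) : ℝ × ℝ :=
  if h : ∃ i, p ∈ tangentRegion V i then reflect lam (V h.choose) p else p

/-- The set `X` of points outside the polygon all of whose forward iterates are defined. -/
def regularSet (V : Fin 4 → ℝ × ℝ) (lam : ℝ) : Set (ℝ × ℝ) :=
  {p | p ∉ polygon V ∧ ∀ n : ℕ, (billiard V lam)^[n] p ∉ singularSet V}

/-- `q` is the image of `p` under the first-return map of the billiard to `R`; all the iterates
up to the return are required to be defined. -/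
def IsFirstReturn (V : Fin 4 → ℝ × ℝ) (lam : ℝ) (R : Set (ℝ × ℝ)) (p q : ℝ × ℝ) : Prop :=
  p ∈ R ∧ q ∈ R ∧ ∃ n : ℕ, 0 < n ∧
    (∀ i < n, (billiard V lam)^[i] p ∉ polygon V ∪ singularSet V) ∧
    (billiard V lam)^[n] p = q ∧
    ∀ i, 0 < i → i < n → (billiard V lam)^[i] p ∉ R

/-- A natural choice `q` for the image of `p`: the value of the branch of the map that reflects
in `V i`, where `p` lies in the closure of the domain of this branch. If `p` lies neither on the
polygon nor on a singular ray, this is the image of `p`. -/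
def IsNaturalImage (V : Fin 4 → ℝ × ℝ) (lam : ℝ) (p q : ℝ × ℝ) : Prop :=
  ∃ i, p ∈ closure (tangentRegion V i) ∧ q = reflect lam (V i) p

/-- A (possibly degenerate) periodic orbit, written as a periodic sequence. At a singular point
the next point is one of the natural choices, and the choices along the orbit are made from
one side: the sequence is the termwise limit of true orbits. -/
structure IsPeriodicOrbit (V : Fin 4 → ℝ × ℝ) (lam : ℝ) (w : ℕ → ℝ × ℝ) : Prop where
  periodic : ∃ n : ℕ, 0 < n ∧ ∀ i, w (i + n) = w i
  natural : ∀ i, IsNaturalImage V lam (w i) (w (i + 1))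
  oneSided : ∃ p : ℕ → ℝ × ℝ, (∀ k, p k ∈ regularSet V lam) ∧
    ∀ i, Tendsto (fun k => (billiard V lam)^[i] (p k)) atTop (𝓝 (w i))

/-- The `ω`-limit set of `p` under the billiard. -/
def omegaSet (V : Fin 4 → ℝ × ℝ) (lam : ℝ) (p : ℝ × ℝ) : Set (ℝ × ℝ) :=
  omegaLimit atTop (fun (n : ℕ) (x : ℝ × ℝ) => (billiard V lam)^[n] x) {p}

/-- A Cantor set: a subspace homeomorphic to the standard Cantor set. -/
def IsCantor (K : Set (ℝ × ℝ)) : Prop := Nonempty (K ≃ₜ cantorSet)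

/-- The quadrilateral `(a, b)`, with vertices `A, B, C, D` in clockwise order. -/
def quad (a b : ℝ) : Fin 4 → ℝ × ℝ := ![(0, 1), (a, 1), (1, b), (0, 0)]

/-- `l = |EA|`, where `E = (-l, 1)`. -/
noncomputable def lenL (a lam : ℝ) : ℝ := lam⁻¹ + (1 - a) * lam⁻¹ ^ 2

/-- `h = |IA|`. -/
noncomputable def lenH (a lam : ℝ) : ℝ := lenL a lam - a * lam⁻¹ ^ 3

noncomputable def lenY (a lam : ℝ) : ℝ := lam * (1 + lam) * (1 + a * lam ^ 2 - lam ^ 3)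

/-- The upper rectangle. -/
noncomputable def rectOne (a lam ε : ℝ) : Set (ℝ × ℝ) :=
  Icc (-lenL a lam + ε) 0 ×ˢ Icc 1 (1 + ε ^ 2)

/-- The lower rectangle. -/
noncomputable def rectTwo (a lam ε : ℝ) : Set (ℝ × ℝ) :=
  Icc (-lenL a lam + ε) 0 ×ˢ Icc (1 - ε ^ 2) 1

/-- `z` is the value at `x` of the one-dimensional map induced by the first-return map to the
lower rectangle. The segment from `E` to `A` is parametrized by `x ∈ [0, 1]`, the parameter `x`
being the point with abscissa `-(1 - x) * l`. For all small `ε`, the first return of every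
point of the lower rectangle vertically below the point with parameter `x` projects
vertically to the point with parameter `z`. -/
def IsReturnValue (a b x z : ℝ) : Prop :=
  ∀ᶠ ε in 𝓝[>] (0 : ℝ), ∀ δ ∈ Ioc (0 : ℝ) (ε ^ 2), ∃ q : ℝ × ℝ,
    IsFirstReturn (quad a b) (1 - b) (rectTwo a (1 - b) ε)
      (-((1 - x) * lenL a (1 - b)), 1 - δ) q ∧
    q.1 = -((1 - z) * lenL a (1 - b))

open Classical in
/-- The induced map where the vertical first return is defined (and `0` elsewhere). -/
noncomputable def returnMapAux (a b x : ℝ) : ℝ :=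
  if h : ∃ z, IsReturnValue a b x z then h.choose else 0

open Classical in
/-- The one-dimensional first-return map `g`. At a parameter where the first return is not
defined (the vertical line meets a singular ray or the polygon), the value is the one that
makes the map continuous from the left. -/
noncomputable def returnMap (a b x : ℝ) : ℝ :=
  if ∃ z, IsReturnValue a b x z then returnMapAux a b x
  else limUnder (𝓝[<] x) (returnMapAux a b)

/-- `F` is a strictly increasing lift of degree one of the circle map induced by
`g : (0, 1] → (0, 1]`. -/
structure IsLift (g F : ℝ → ℝ) : Prop where
  strictMono : StrictMono F
  degree_one : ∀ x, F (x + 1) = F x + 1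
  lifts : ∀ x ∈ Ioc (0 : ℝ) 1, ∃ m : ℤ, F x = g x + m

/-- `ρ` represents the rotation number of `g`, as a number modulo `1`: `g` has a strictly
increasing lift of degree one, and for each such lift `F` the limit of `(F^n(x) - x) / n`
exists, does not depend on `x`, and equals `ρ` modulo `1`. -/
def HasRotationNumber (g : ℝ → ℝ) (ρ : ℝ) : Prop :=
  (∃ F, IsLift g F) ∧
  ∀ F, IsLift g F → ∃ m : ℤ, ∀ x : ℝ,
    Tendsto (fun n : ℕ => (F^[n] x - x) / n) atTop (𝓝 (ρ + m))

end ContractedBilliard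

namespace ContractedBilliard

/-! ### The branches of the billiard -/

/-! Because `lam = 1 - b`, the line `y = 1` is invariant under reflection in D followed by
reflection in C, and A and B lie on it. Hence a point of a thin strip just below EA has only two
ways to come back. It is reflected in D, C, B, A if it starts to the left of the point I at distance
`h` from A (a short return), and in D, C, B, D, C, A if it starts to the right (a long one). The
return is affine with linear part `lam ^ 4` or `lam ^ 6`. The abscissa moves by `inducedMap`,
whatever the height, and the depth below the line shrinks by at least `lam ^ 4` (`strip_return`). No
intermediate point can be in R₂, so this is the first return and `g` is `inducedMap`
(`returnMap_eq`).

The bound on `a` keeps long returns to the right of E and makes the image of the second branch lie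
below that of the first (`inducedMap_high_lt_low`). Thus `g` preserves cyclic order and has a
strictly increasing, discontinuous lift, whose translation number is the rotation number. The
integer part of the lift grows by one exactly at long returns (`ceil_increment`), so the itinerary
of a billiard orbit is read off the ceilings of a lifted orbit.

For rotation number `p / q` a periodic point of `g` need not exist, and the argument is
combinatorial. The sum of `q` consecutive ceilings, corrected by `n * p`, is a monotone bounded
integer sequence along an orbit, hence eventually constant. So every itinerary is eventually
periodic (`exists_ceil_iterate_add`), and any two agree after shifts (`exists_ceil_increments_eq`).
Since all branches contract, equal itineraries force orbits together and a periodic one forces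
convergence to a periodic orbit (`exists_periodicOrbit`). Conversely a possibly degenerate periodic
orbit attracts a nearby regular point (`IsPeriodicOrbit.exists_attracted`), so in fact at most one
periodic orbit meets the rectangles.

For irrational rotation number the lift is semiconjugate to a translation by a monotone map, and
each orbit visits infinitely often every interval whose ends this map separates. Therefore the
cluster points of the returns do not depend on the orbit (`returnLimit_subset`) and have no isolated
point (`returnLimit_perfect`). Their abscissas have measure zero, being covered by their own images
contracted by `lam ^ 4` (`volume_fst_returnLimit`). The limit set is a finite union of affine copies
of these sets, so it is compact, perfect and totally disconnected, and Brouwer's theorem applies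
(`isCantor_of_compact`). -/

theorem cross_antisymm (u v : ℝ × ℝ) : cross u v = -cross v u := by
  simp only [cross]; ring

theorem tangentRegion_unique {V : Fin 4 → ℝ × ℝ} {p : ℝ × ℝ} {i j : Fin 4}
    (hi : p ∈ tangentRegion V i) (hj : p ∈ tangentRegion V j) : i = j := by
  by_contra hij
  have h1 := hi j (Ne.symm hij)
  have h2 := hj i hij
  rw [cross_antisymm] at h2
  linarith

theorem billiard_of_mem {V : Fin 4 → ℝ × ℝ} {p : ℝ × ℝ} {i : Fin 4} (lam : ℝ)
    (hi : p ∈ tangentRegion V i) : billiard V lam p = reflect lam (V i) p := by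
  have h : ∃ i, p ∈ tangentRegion V i := ⟨i, hi⟩
  rw [billiard, dif_pos h, tangentRegion_unique h.choose_spec hi]

/-- The standing hypotheses on the parameters. -/
structure Params (a b lam : ℝ) : Prop where
  a_pos : 0 < a
  a_lt_one : a < 1
  b_pos : 0 < b
  b_lt_one : b < 1
  add_le : a + b ≤ 1
  lam_eq : lam = 1 - b
  range : a < 1 + lam - lam ^ 3 - lam ^ 4

namespace Params

variable {a b lam : ℝ}

theorem b_eq (h : Params a b lam) : b = 1 - lam := by linarith [h.lam_eq]

theorem lam_pos (h : Params a b lam) : 0 < lam := by linarith [h.lam_eq, h.b_lt_one]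

theorem lam_lt_one (h : Params a b lam) : lam < 1 := by linarith [h.lam_eq, h.b_pos]

theorem a_le_lam (h : Params a b lam) : a ≤ lam := by linarith [h.lam_eq, h.add_le]

end Params

section Regions

variable {a b lam : ℝ} {p : ℝ × ℝ}

/-- The singular rays cut the exterior into four wedges, one per vertex. Two linear inequalities
describe each wedge, and convexity of the quadrilateral supplies the remaining cross product. -/
theorem mem_tangentRegion_zero (h : Params a b lam) (h1 : 0 < p.1) (h2 : 1 < p.2) :
    p ∈ tangentRegion (quad a b) 0 := by
  have := h.a_pos
  have := h.a_lt_one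
  have := h.b_lt_one
  intro j hj
  fin_cases j
  · exact absurd rfl hj
  · simp [quad, cross]; nlinarith
  · simp [quad, cross]; nlinarith
  · simp [quad, cross]; nlinarith

/-- The linear form in `h2` vanishes on the line BC and is positive on the side away from the
quadrilateral. -/
theorem mem_tangentRegion_one (h : Params a b lam) (h1 : p.2 < 1)
    (h2 : 0 < (1 - b) * (p.1 - a) + (1 - a) * (p.2 - 1)) :
    p ∈ tangentRegion (quad a b) 1 := by
  have := h.a_pos
  have := h.a_lt_one
  have := h.b_pos
  have := h.b_lt_one
  intro j hj
  fin_cases j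
  · simp [quad, cross]; nlinarith
  · exact absurd rfl hj
  · simp [quad, cross]; nlinarith
  · simp [quad, cross]
    have h3 : 0 < (1 - b) * (p.1 - a * p.2) := by
      have h4 : 0 < (1 - a) * (1 - p.2) := mul_pos (by linarith) (by linarith)
      have h5 : 0 < (1 - b) * (a * (1 - p.2)) :=
        mul_pos (by linarith) (mul_pos (by linarith) (by linarith))
      linarith
    have := pos_of_mul_pos_right h3 (by linarith)
    linarith

theorem mem_tangentRegion_two (h : Params a b lam) (h1 : p.2 < b * p.1)
    (h2 : (1 - b) * (p.1 - a) + (1 - a) * (p.2 - 1) < 0) :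
    p ∈ tangentRegion (quad a b) 2 := by
  have := h.a_pos
  have := h.a_lt_one
  have := h.b_pos
  have := h.b_lt_one
  intro j hj
  fin_cases j
  · simp [quad, cross]
    have h4 : 0 < 1 - a * b := by nlinarith
    have h5 : 0 < (a * (1 - b)) * (b * p.1 - p.2) :=
      mul_pos (mul_pos (by linarith) (by linarith)) (by linarith)
    have h3 : 0 < (1 - a * b) * (1 - (1 - b) * p.1 - p.2) := by linarith
    have := pos_of_mul_pos_right h3 h4.le
    linarith
  · simp [quad, cross]; nlinarith
  · exact absurd rfl hj
  · simp [quad, cross]; nlinarith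

theorem mem_tangentRegion_three (h : Params a b lam) (h1 : p.1 < 0) (h2 : b * p.1 < p.2) :
    p ∈ tangentRegion (quad a b) 3 := by
  have := h.a_pos
  have := h.a_lt_one
  have := h.b_pos
  have := h.b_lt_one
  intro j hj
  fin_cases j
  · simp [quad, cross]; nlinarith
  · simp [quad, cross]; nlinarith [mul_pos h.a_pos h.b_pos, mul_lt_mul_of_pos_left h2 h.a_pos,
      mul_lt_mul_of_pos_left h.a_lt_one h.b_pos]
  · simp [quad, cross]; nlinarith
  · exact absurd rfl hj

theorem polygon_quad_subset (h : Params a b lam) (hp : p ∈ polygon (quad a b)) :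
    0 ≤ p.1 ∧ p.2 ≤ 1 ∧ b * p.1 ≤ p.2 ∧ (1 - b) * (p.1 - a) + (1 - a) * (p.2 - 1) ≤ 0 := by
  have := h.a_pos
  have := h.a_lt_one
  have := h.b_pos
  have := h.b_lt_one
  have key : polygon (quad a b) ⊆ {p : ℝ × ℝ | 0 ≤ p.1 ∧ p.2 ≤ 1 ∧ b * p.1 ≤ p.2 ∧
      (1 - b) * (p.1 - a) + (1 - a) * (p.2 - 1) ≤ 0} := by
    refine convexHull_min ?_ ?_
    · rintro _ ⟨i, rfl⟩
      fin_cases i <;> simp only [mem_ofPred_eq] <;> simp [quad] <;> (try constructor) <;> nlinarith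
    · rintro x ⟨hx1, hx2, hx3, hx4⟩ y ⟨hy1, hy2, hy3, hy4⟩ s t hs ht hst
      obtain rfl : t = 1 - s := by linarith
      have m := fun {u v : ℝ} (hu : 0 ≤ u) (hv : 0 ≤ v) =>
        add_nonneg (mul_nonneg hs hu) (mul_nonneg ht hv)
      have m1 := m hx1 hy1
      have m2 := m (sub_nonneg.2 hx2) (sub_nonneg.2 hy2)
      have m3 := m (sub_nonneg.2 hx3) (sub_nonneg.2 hy3)
      have m4 := m (neg_nonneg.2 hx4) (neg_nonneg.2 hy4)
      simp only [mem_ofPred_eq, Prod.fst_add, Prod.snd_add, Prod.smul_fst, Prod.smul_snd,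
        smul_eq_mul]
      refine ⟨m1, ?_, ?_, ?_⟩ <;> linarith
  exact key hp

theorem mem_singularSet_quad (hp : p ∈ singularSet (quad a b)) : ∃ t : ℝ, 0 ≤ t ∧
    ((p.1 = t * a ∧ p.2 = 1) ∨ (p.1 = a + t * (1 - a) ∧ p.2 = 1 + t * (b - 1)) ∨
      (p.1 = 1 - t ∧ p.2 = b - t * b) ∨ (p.1 = 0 ∧ p.2 = t)) := by
  obtain ⟨i, t, ht, hp⟩ := mem_iUnion.1 hp
  refine ⟨t, ht, ?_⟩
  fin_cases i
  · left; rw [hp]; simp [quad]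
  · right; left; rw [hp]; simp [quad]
  · right; right; left; rw [hp]; simp [quad]; constructor <;> ring
  · right; right; right; rw [hp]; simp [quad]

theorem not_mem_of_regionZero (h : Params a b lam) (h1 : 0 < p.1) (h2 : 1 < p.2) :
    p ∉ polygon (quad a b) ∪ singularSet (quad a b) := by
  have := h.b_pos
  have := h.b_lt_one
  rintro (hp | hp)
  · have := (polygon_quad_subset h hp).2.1
    linarith
  · obtain ⟨t, ht, h3 | h3 | h3 | h3⟩ := mem_singularSet_quad hp
    · linarith
    · nlinarith
    · nlinarith
    · linarith

theorem not_mem_of_regionOne (h : Params a b lam) (h1 : p.2 < 1)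
    (h2 : 0 < (1 - b) * (p.1 - a) + (1 - a) * (p.2 - 1)) :
    p ∉ polygon (quad a b) ∪ singularSet (quad a b) := by
  have := h.a_pos
  have := h.a_lt_one
  have := h.b_pos
  have := h.b_lt_one
  rintro (hp | hp)
  · have := (polygon_quad_subset h hp).2.2.2
    linarith
  · obtain ⟨t, ht, ⟨h3, h4⟩ | ⟨h3, h4⟩ | ⟨h3, h4⟩ | ⟨h3, h4⟩⟩ := mem_singularSet_quad hp
    · linarith
    · rw [h3, h4] at h2; linarith
    · rw [h3, h4] at h2
      nlinarith [mul_nonneg ht (sub_nonneg.2 this.le),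
        mul_nonneg (mul_nonneg ht h.b_pos.le) (sub_nonneg.2 h.a_lt_one.le)]
    · rw [h3, h4] at h2; nlinarith

theorem not_mem_of_regionTwo (h : Params a b lam) (h1 : p.2 < b * p.1)
    (h2 : (1 - b) * (p.1 - a) + (1 - a) * (p.2 - 1) < 0) :
    p ∉ polygon (quad a b) ∪ singularSet (quad a b) := by
  have := h.a_pos
  have := h.a_lt_one
  have := h.b_pos
  have := h.b_lt_one
  rintro (hp | hp)
  · have := (polygon_quad_subset h hp).2.2.1
    linarith
  · obtain ⟨t, ht, ⟨h3, h4⟩ | ⟨h3, h4⟩ | ⟨h3, h4⟩ | ⟨h3, h4⟩⟩ := mem_singularSet_quad hp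
    · rw [h3, h4] at h1 h2
      have h5 : 0 ≤ t * a := by positivity
      have h6 : t * a < a := by
        by_contra hcon
        nlinarith
      nlinarith
    · rw [h3, h4] at h2; linarith
    · rw [h3, h4] at h1; linarith
    · rw [h3, h4] at h1; linarith

theorem not_mem_of_regionThree (h : Params a b lam) (h1 : p.1 < 0) (h2 : b * p.1 < p.2) :
    p ∉ polygon (quad a b) ∪ singularSet (quad a b) := by
  have := h.a_pos
  have := h.a_lt_one
  rintro (hp | hp)
  · have := (polygon_quad_subset h hp).1
    linarith
  · obtain ⟨t, ht, ⟨h3, h4⟩ | ⟨h3, h4⟩ | ⟨h3, h4⟩ | ⟨h3, h4⟩⟩ := mem_singularSet_quad hp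
    · nlinarith
    · nlinarith
    · rw [h3, h4] at h2; linarith
    · linarith

/-- The domain of the branch of the billiard that reflects in the `i`-th vertex, off the polygon
and the singular rays. -/
def branchDomain (a b : ℝ) (i : Fin 4) : Set (ℝ × ℝ) :=
  tangentRegion (quad a b) i \ (polygon (quad a b) ∪ singularSet (quad a b))

theorem branchDomain_zero (h : Params a b lam) (h1 : 0 < p.1) (h2 : 1 < p.2) :
    p ∈ branchDomain a b 0 :=
  ⟨mem_tangentRegion_zero h h1 h2, not_mem_of_regionZero h h1 h2⟩

theorem branchDomain_one (h : Params a b lam) (h1 : p.2 < 1)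
    (h2 : 0 < (1 - b) * (p.1 - a) + (1 - a) * (p.2 - 1)) : p ∈ branchDomain a b 1 :=
  ⟨mem_tangentRegion_one h h1 h2, not_mem_of_regionOne h h1 h2⟩

theorem branchDomain_two (h : Params a b lam) (h1 : p.2 < b * p.1)
    (h2 : (1 - b) * (p.1 - a) + (1 - a) * (p.2 - 1) < 0) : p ∈ branchDomain a b 2 :=
  ⟨mem_tangentRegion_two h h1 h2, not_mem_of_regionTwo h h1 h2⟩

theorem branchDomain_three (h : Params a b lam) (h1 : p.1 < 0) (h2 : b * p.1 < p.2) :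
    p ∈ branchDomain a b 3 :=
  ⟨mem_tangentRegion_three h h1 h2, not_mem_of_regionThree h h1 h2⟩

/-! ### Following a strip point through one return -/

theorem lam_sq_mul_lenL (h : Params a b lam) : lam ^ 2 * lenL a lam = lam + 1 - a := by
  have := h.lam_pos.ne'
  rw [lenL]; field_simp; ring

/-- Geometrically, reflection in D and C carries E to B, which fixes `l`, and reflection in D, C and
B carries I to A, which fixes `h`. -/
theorem lam_cube_mul_lenH (h : Params a b lam) :
    lam ^ 3 * lenH a lam = (1 + lam) * (lam - a) := by
  have := h.lam_pos.ne'
  rw [lenH, lenL]; field_simp; ring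

/-- A thin strip below the segment `EA` on which the first return is computed. -/
def strip (a lam : ℝ) : Set (ℝ × ℝ) :=
  {p | p.1 < 0 ∧ 0 < p.2 ∧ p.2 < 1 ∧
    lam ^ 2 * -p.1 + (1 - a) * lam * (1 - p.2) < lam + 1 - a ∧
    (1 - a) * lam * (1 - p.2) < 1 + lam - a - lam ^ 3 - lam ^ 4}

theorem reflect_quad_zero (x y : ℝ) :
    reflect lam (quad a b 0) (x, y) = (-lam * x, 1 - lam * (y - 1)) := by
  ext <;> simp [reflect, quad]
  ring

theorem reflect_quad_one (x y : ℝ) :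
    reflect lam (quad a b 1) (x, y) = ((1 + lam) * a - lam * x, 1 - lam * (y - 1)) := by
  ext <;> simp [reflect, quad] <;> ring

theorem reflect_quad_two (h : Params a b lam) (x y : ℝ) :
    reflect lam (quad a b 2) (x, y) = (1 + lam - lam * x, 1 - lam ^ 2 - lam * y) := by
  ext <;> simp [reflect, quad, h.b_eq] <;> ring

theorem reflect_quad_three (x y : ℝ) :
    reflect lam (quad a b 3) (x, y) = (-lam * x, -lam * y) := by
  ext <;> simp [reflect, quad]

theorem billiard_of_branchDomain {i : Fin 4} (hp : p ∈ branchDomain a b i) :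
    billiard (quad a b) lam p = reflect lam (quad a b i) p :=
  billiard_of_mem lam hp.1

/-- Reflection in C exchanges the two sides of the line BC. So the fourth inequality of `strip`
serves twice: it puts the first image on the near side of BC and the second image on the far side.
-/
theorem strip_start (h : Params a b lam) {x y : ℝ} (hp : (x, y) ∈ strip a lam) :
    (x, y) ∈ branchDomain a b 3 ∧
    billiard (quad a b) lam (x, y) = (-lam * x, -lam * y) ∧
    (-lam * x, -lam * y) ∈ branchDomain a b 2 ∧
    billiard (quad a b) lam (-lam * x, -lam * y)
      = (1 + lam + lam ^ 2 * x, 1 - lam ^ 2 * (1 - y)) ∧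
    (1 + lam + lam ^ 2 * x, 1 - lam ^ 2 * (1 - y)) ∈ branchDomain a b 1 ∧
    billiard (quad a b) lam (1 + lam + lam ^ 2 * x, 1 - lam ^ 2 * (1 - y))
      = ((1 + lam) * (a - lam) - lam ^ 3 * x, 1 + lam ^ 3 * (1 - y)) := by
  obtain ⟨h1, h2, h3, h4, h5⟩ := hp
  simp only at h1 h2 h3 h4 h5
  have l0 := h.lam_pos
  have e := h.b_eq
  have b0 := h.b_pos
  have r1 : (x, y) ∈ branchDomain a b 3 := branchDomain_three h h1 (by simp only; nlinarith)
  have r2 : (-lam * x, -lam * y) ∈ branchDomain a b 2 := by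
    refine branchDomain_two h ?_ ?_
    · simp only
      nlinarith [mul_pos l0 h2, mul_pos b0 (mul_pos l0 (neg_pos.2 h1))]
    · simp only [e]
      linarith
  have r3 : (1 + lam + lam ^ 2 * x, 1 - lam ^ 2 * (1 - y)) ∈ branchDomain a b 1 := by
    refine branchDomain_one h ?_ ?_
    · simp only
      nlinarith [mul_pos (pow_pos l0 2) (sub_pos.2 h3)]
    · simp only [e]
      nlinarith [mul_pos l0 (sub_pos.2 h4)]
  refine ⟨r1, ?_, r2, ?_, r3, ?_⟩
  · rw [billiard_of_branchDomain r1, reflect_quad_three]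
  · rw [billiard_of_branchDomain r2, reflect_quad_two h]
    ext <;> simp only <;> ring
  · rw [billiard_of_branchDomain r3, reflect_quad_one]
    ext <;> simp only <;> ring

/-- Starting to the left of I, the third image is above AB and to the right of the line DA, so A is
the next vertex and the point drops back below the line `y = 1`. -/
theorem strip_short (h : Params a b lam) {x y : ℝ} (hp : (x, y) ∈ strip a lam)
    (hx : lenH a lam < -x) :
    ((1 + lam) * (a - lam) - lam ^ 3 * x, 1 + lam ^ 3 * (1 - y)) ∈ branchDomain a b 0 ∧
    billiard (quad a b) lam ((1 + lam) * (a - lam) - lam ^ 3 * x, 1 + lam ^ 3 * (1 - y))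
      = (lam ^ 4 * (x + lenH a lam), 1 - lam ^ 4 * (1 - y)) ∧
    (lam ^ 4 * (x + lenH a lam), 1 - lam ^ 4 * (1 - y)) ∈ strip a lam := by
  obtain ⟨h1, h2, h3, h4, h5⟩ := hp
  simp only at h1 h2 h3 h4 h5
  have l0 := h.lam_pos
  have l1 := h.lam_lt_one
  have eh := lam_cube_mul_lenH h
  have hh : lam ^ 3 * lenH a lam < lam ^ 3 * -x := mul_lt_mul_of_pos_left hx (pow_pos l0 3)
  have r1 : ((1 + lam) * (a - lam) - lam ^ 3 * x, 1 + lam ^ 3 * (1 - y)) ∈ branchDomain a b 0 := by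
    refine branchDomain_zero h ?_ ?_
    · simp only; linarith
    · simp only
      linarith [mul_pos (pow_pos l0 3) (sub_pos.2 h3)]
  refine ⟨r1, ?_, ?_⟩
  · rw [billiard_of_branchDomain r1, reflect_quad_zero]
    ext
    · simp only; linear_combination (-lam) * eh
    · simp only; ring
  · have p4 : lam ^ 4 < 1 := pow_lt_one₀ l0.le l1 (by norm_num)
    have p4' : 0 < lam ^ 4 := by positivity
    have n1 : 0 ≤ (1 - a) * lam * (1 - y) :=
      mul_nonneg (mul_nonneg (by linarith [h.a_lt_one]) l0.le) (by linarith)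
    have n2 : 0 ≤ lam ^ 4 * lam ^ 2 * lenH a lam := by
      have : 0 ≤ lam ^ 3 * lenH a lam := by
        rw [eh]; exact mul_nonneg (by linarith) (by linarith [h.a_le_lam])
      nlinarith [mul_nonneg (pow_nonneg l0.le 3) this]
    refine ⟨?_, ?_, ?_, ?_, ?_⟩
    · simp only; nlinarith
    · simp only; nlinarith
    · simp only; nlinarith
    · simp only
      have : lam ^ 4 * (lam ^ 2 * -x + (1 - a) * lam * (1 - y)) ≤
        1 * (lam ^ 2 * -x + (1 - a) * lam * (1 - y)) :=
          mul_le_mul_of_nonneg_right p4.le (by nlinarith [mul_pos (pow_pos l0 2) (neg_pos.2 h1)])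
      linarith
    · simp only
      have : lam ^ 4 * ((1 - a) * lam * (1 - y)) ≤ 1 * ((1 - a) * lam * (1 - y)) :=
        mul_le_mul_of_nonneg_right p4.le n1
      linarith

theorem upper_start (h : Params a b lam) {x y : ℝ} (hx : x < 0) (hx' : -x < lenL a lam)
    (hy : 1 < y) :
    (x, y) ∈ branchDomain a b 3 ∧
    billiard (quad a b) lam (x, y) = (-lam * x, -lam * y) ∧
    (-lam * x, -lam * y) ∈ branchDomain a b 2 ∧
    billiard (quad a b) lam (-lam * x, -lam * y)
      = (1 + lam + lam ^ 2 * x, 1 - lam ^ 2 * (1 - y)) ∧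
    (1 + lam + lam ^ 2 * x, 1 - lam ^ 2 * (1 - y)) ∈ branchDomain a b 0 ∧
    billiard (quad a b) lam (1 + lam + lam ^ 2 * x, 1 - lam ^ 2 * (1 - y))
      = (-(lam * (1 + lam)) - lam ^ 3 * x, 1 - lam ^ 3 * (y - 1)) := by
  have l0 := h.lam_pos
  have e := h.b_eq
  have b0 := h.b_pos
  have hl : lam ^ 2 * -x < lam + 1 - a := by
    rw [← lam_sq_mul_lenL h]; exact mul_lt_mul_of_pos_left hx' (pow_pos l0 2)
  have r1 : (x, y) ∈ branchDomain a b 3 := branchDomain_three h hx (by simp only; nlinarith)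
  have r2 : (-lam * x, -lam * y) ∈ branchDomain a b 2 := by
    refine branchDomain_two h ?_ ?_
    · simp only
      nlinarith [mul_pos l0 (zero_lt_one.trans hy), mul_pos b0 (mul_pos l0 (neg_pos.2 hx))]
    · simp only [e]
      have : 0 < (1 - a) * lam * (y - 1) :=
        mul_pos (mul_pos (by linarith [h.a_lt_one]) l0) (by linarith)
      linarith
  have r3 : (1 + lam + lam ^ 2 * x, 1 - lam ^ 2 * (1 - y)) ∈ branchDomain a b 0 := by
    refine branchDomain_zero h ?_ ?_
    · simp only; linarith [h.a_pos]
    · simp only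
      linarith [mul_pos (pow_pos l0 2) (sub_pos.2 hy)]
  refine ⟨r1, ?_, r2, ?_, r3, ?_⟩
  · rw [billiard_of_branchDomain r1, reflect_quad_three]
  · rw [billiard_of_branchDomain r2, reflect_quad_two h]
    ext <;> simp only <;> ring
  · rw [billiard_of_branchDomain r3, reflect_quad_zero]
    ext <;> simp only <;> ring

/-- The first coordinate of the image of a point above the segment `EA` after three steps. -/
theorem upper_end_mem_strip (h : Params a b lam) {x y : ℝ} (hx : x < 0) (hx' : -x < lenL a lam)
    (hy : 1 < y) (hy1 : y < 2)
    (hy2 : (1 - a) * lam * (y - 1) < 1 + lam - a - lam ^ 3 - lam ^ 4) :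
    (-(lam * (1 + lam)) - lam ^ 3 * x, 1 - lam ^ 3 * (y - 1)) ∈ strip a lam := by
  have l0 := h.lam_pos
  have l1 := h.lam_lt_one
  have hl : lam ^ 2 * -x < lam + 1 - a := by
    rw [← lam_sq_mul_lenL h]; exact mul_lt_mul_of_pos_left hx' (pow_pos l0 2)
  have p3 : lam ^ 3 < 1 := pow_lt_one₀ l0.le l1 (by norm_num)
  have p3' : 0 < lam ^ 3 := by positivity
  have n1 : 0 ≤ (1 - a) * lam * (y - 1) :=
    mul_nonneg (mul_nonneg (by linarith [h.a_lt_one]) l0.le) (by linarith)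
  have n2 : lam ^ 3 * ((1 - a) * lam * (y - 1)) ≤ 1 * ((1 - a) * lam * (y - 1)) :=
    mul_le_mul_of_nonneg_right p3.le n1
  refine ⟨?_, ?_, ?_, ?_, ?_⟩
  · simp only
    nlinarith [mul_pos l0 h.a_pos, mul_lt_mul_of_pos_left hl l0]
  · simp only; nlinarith
  · simp only; nlinarith
  · simp only
    nlinarith [mul_pos (pow_pos l0 5) (neg_pos.2 hx)]
  · simp only; linarith

/-- Starting to the right of I, the third image is above the segment EA, whence D, C, A bring it
back below. The fifth inequality of `strip` is what makes the end point satisfy the fourth one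
again. -/
theorem strip_long (h : Params a b lam) {x y : ℝ} (hp : (x, y) ∈ strip a lam)
    (hx : -x < lenH a lam) :
    (1 + lam) * (a - lam) - lam ^ 3 * x < 0 ∧
    -((1 + lam) * (a - lam) - lam ^ 3 * x) < lenL a lam ∧ 1 < 1 + lam ^ 3 * (1 - y) ∧
    (-(lam * (1 + lam)) - lam ^ 3 * ((1 + lam) * (a - lam) - lam ^ 3 * x),
      1 - lam ^ 3 * (1 + lam ^ 3 * (1 - y) - 1)) = (lam ^ 6 * x - lenY a lam,
      1 - lam ^ 6 * (1 - y)) ∧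
    (lam ^ 6 * x - lenY a lam, 1 - lam ^ 6 * (1 - y)) ∈ strip a lam := by
  obtain ⟨h1, h2, h3, h4, h5⟩ := hp
  simp only at h1 h2 h3 h4 h5
  have l0 := h.lam_pos
  have l1 := h.lam_lt_one
  have a0 := h.a_pos
  have eh := lam_cube_mul_lenH h
  have el := lam_sq_mul_lenL h
  have hh : lam ^ 3 * -x < lam ^ 3 * lenH a lam := mul_lt_mul_of_pos_left hx (pow_pos l0 3)
  have p3 : lam ^ 3 < 1 := pow_lt_one₀ l0.le l1 (by norm_num)
  have p2 : lam ^ 2 < 1 := pow_lt_one₀ l0.le l1 (by norm_num)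
  have p3' : 0 < lam ^ 3 := by positivity
  have c1 : (1 + lam) * (a - lam) - lam ^ 3 * x < 0 := by linarith
  have c2 : -((1 + lam) * (a - lam) - lam ^ 3 * x) < lenL a lam := by
    have : lam ^ 2 * -((1 + lam) * (a - lam) - lam ^ 3 * x) < lam ^ 2 * lenL a lam := by
      have e1 : -((1 + lam) * (a - lam) - lam ^ 3 * x) ≤ (1 + lam) * (lam - a) := by nlinarith
      have e2 := mul_le_mul_of_nonneg_left e1 (pow_nonneg l0.le 2)
      rw [el]
      have e3 : (1 + lam) * (lam - a) < lam * (1 + lam) := by nlinarith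
      have e4 := mul_lt_mul_of_pos_left e3 (pow_pos l0 2)
      linarith [h.range]
    exact lt_of_mul_lt_mul_left this (pow_nonneg l0.le 2)
  have c3 : 1 < 1 + lam ^ 3 * (1 - y) := by nlinarith
  have c4 : (-(lam * (1 + lam)) - lam ^ 3 * ((1 + lam) * (a - lam) - lam ^ 3 * x),
      1 - lam ^ 3 * (1 + lam ^ 3 * (1 - y) - 1)) = (lam ^ 6 * x - lenY a lam,
      1 - lam ^ 6 * (1 - y)) := by
    ext <;> simp only [lenY] <;> ring
  refine ⟨c1, c2, c3, c4, ?_⟩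
  rw [← c4]
  have n1 : 0 ≤ (1 - a) * lam * (1 - y) :=
    mul_nonneg (mul_nonneg (by linarith [h.a_lt_one]) l0.le) (by linarith)
  have n2 : lam ^ 3 * ((1 - a) * lam * (1 - y)) ≤ 1 * ((1 - a) * lam * (1 - y)) :=
    mul_le_mul_of_nonneg_right p3.le n1
  exact upper_end_mem_strip h c1 c2 c3 (by nlinarith) (by linarith)

end Regions

/-! ### The first return to the strip -/

theorem iterate_succ_eq {α : Type*} {f : α → α} {n : ℕ} {x y z : α} (h : f^[n] x = y)
    (h' : f y = z) : f^[n + 1] x = z := by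
  rw [Function.iterate_succ_apply', h, h']

section Block

variable {a b lam : ℝ} {p : ℝ × ℝ}

theorem lenL_pos (h : Params a b lam) : 0 < lenL a lam := by
  have h1 := lam_sq_mul_lenL h
  have h2 : 0 < lam ^ 2 * lenL a lam := by rw [h1]; linarith [h.lam_pos, h.a_lt_one]
  exact pos_of_mul_pos_right h2 (pow_nonneg h.lam_pos.le 2)

theorem lenH_nonneg (h : Params a b lam) : 0 ≤ lenH a lam := by
  have h1 := lam_cube_mul_lenH h
  have h2 : 0 ≤ lam ^ 3 * lenH a lam := by
    rw [h1]; exact mul_nonneg (by linarith [h.lam_pos]) (by linarith [h.a_le_lam])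
  exact nonneg_of_mul_nonneg_right h2 (pow_pos h.lam_pos 3)

/-- The parameter at which the induced map is discontinuous. -/
noncomputable def cut (a lam : ℝ) : ℝ := 1 - lenH a lam / lenL a lam

/-- Equality occurs when `a = lam`, that is `h = 0`; the second branch of the induced map then has
empty domain in `(0, 1]`. -/
theorem cut_le_one (h : Params a b lam) : cut a lam ≤ 1 := by
  have := div_nonneg (lenH_nonneg h) (lenL_pos h).le
  rw [cut]; linarith

theorem cut_pos (h : Params a b lam) : 0 < cut a lam := by
  rw [cut, sub_pos, div_lt_one (lenL_pos h), lenH]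
  have := mul_pos h.a_pos (pow_pos (inv_pos.2 h.lam_pos) 3)
  linarith

/-- The explicit one-dimensional map. -/
noncomputable def inducedMap (a lam x : ℝ) : ℝ :=
  if x ≤ cut a lam then lam ^ 4 * (x - 1 + lenH a lam / lenL a lam) + 1
  else lam ^ 6 * (x - 1) + (1 - lenY a lam / lenL a lam)

/-- The parameter in `[0, 1]` of the vertical projection of a point to the segment `EA`. -/
noncomputable def param (a lam : ℝ) (p : ℝ × ℝ) : ℝ := 1 + p.1 / lenL a lam

theorem param_lt_cut_iff (h : Params a b lam) : param a lam p < cut a lam ↔ lenH a lam < -p.1 := by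
  have hl := lenL_pos h
  rw [param, cut, ← sub_pos, ← sub_pos (a := -p.1)]
  have e : 1 - lenH a lam / lenL a lam - (1 + p.1 / lenL a lam)
    = (-p.1 - lenH a lam) / lenL a lam := by ring
  rw [e, div_pos_iff_of_pos_right hl]

theorem cut_lt_param_iff (h : Params a b lam) : cut a lam < param a lam p ↔ -p.1 < lenH a lam := by
  have hl := lenL_pos h
  rw [param, cut, ← sub_pos, ← sub_pos (b := -p.1)]
  have e : (1 + p.1 / lenL a lam) - (1 - lenH a lam / lenL a lam)
    = (lenH a lam - -p.1) / lenL a lam := by ring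
  rw [e, div_pos_iff_of_pos_right hl]

theorem param_mem_Ioo (h : Params a b lam) (hp : p ∈ strip a lam) : param a lam p ∈ Ioo 0 1 := by
  obtain ⟨h1, h2, h3, h4, h5⟩ := hp
  have hl := lenL_pos h
  have n1 : 0 ≤ (1 - a) * lam * (1 - p.2) :=
    mul_nonneg (mul_nonneg (by linarith [h.a_lt_one]) h.lam_pos.le) (by linarith)
  have h6 : lam ^ 2 * -p.1 < lam ^ 2 * lenL a lam := by rw [lam_sq_mul_lenL h]; linarith
  have h7 := lt_of_mul_lt_mul_left h6 (pow_nonneg h.lam_pos.le 2)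
  constructor
  · rw [param, ← neg_lt_iff_pos_add', lt_div_iff₀ hl]; linarith
  · rw [param]; linarith [div_neg_of_neg_of_pos h1 hl]

/-- The indices of the vertices used during the first return, for short and long returns. -/
def returnWord : Bool → ℕ → Fin 4
  | _, 0 => 3
  | _, 1 => 2
  | _, 2 => 1
  | true, _ => 0
  | false, 3 => 3
  | false, 4 => 2
  | false, _ => 0

/-- The return time. -/
def returnTime (s : Bool) : ℕ := if s then 4 else 6

/-- The set containing the lower rectangles that no intermediate iterate meets. -/
def lowerBox : Set (ℝ × ℝ) := {p | p.1 ≤ 0 ∧ 0 < p.2 ∧ p.2 ≤ 1}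

open Classical in
-- The whole dynamics of one return: a fixed word of branches, no intermediate visit to `lowerBox`,
-- an abscissa that evolves independently of the height, and a contracted depth.
theorem strip_return (h : Params a b lam) (hp : p ∈ strip a lam) (hc : param a lam p ≠ cut a lam)
    {s : Bool} (hs : s = decide (param a lam p < cut a lam)) :
    (∀ j < returnTime s, (billiard (quad a b) lam)^[j] p ∈ branchDomain a b (returnWord s j)) ∧
    (∀ j < returnTime s, 0 < j → (billiard (quad a b) lam)^[j] p ∉ lowerBox) ∧
    (billiard (quad a b) lam)^[returnTime s] p ∈ strip a lam ∧
    param a lam ((billiard (quad a b) lam)^[returnTime s] p) = inducedMap a lam (param a lam p) ∧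
    1 - ((billiard (quad a b) lam)^[returnTime s] p).2 ≤ lam ^ 4 * (1 - p.2) := by
  obtain ⟨x, y⟩ := p
  have l0 := h.lam_pos
  have hl := (lenL_pos h).ne'
  obtain ⟨a1, a2, a3, a4, a5, a6⟩ := strip_start h hp
  have hp' := hp
  obtain ⟨h1, h2, h3, h4, h5⟩ := hp'
  simp only at h1 h2 h3 h4 h5
  have i1 : (billiard (quad a b) lam)^[1] (x, y) = _ := a2
  have i2 := iterate_succ_eq i1 a4
  have i3 := iterate_succ_eq i2 a6
  have b1 : (-lam * x, -lam * y) ∉ lowerBox := fun hb => by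
    have := hb.2.1
    simp only at this
    nlinarith
  have b2 : (1 + lam + lam ^ 2 * x, 1 - lam ^ 2 * (1 - y)) ∉ lowerBox := fun hb => by
    have := hb.1
    simp only at this
    nlinarith [mul_nonneg (mul_nonneg (sub_nonneg.2 h.a_lt_one.le) l0.le) (sub_nonneg.2 h3.le),
      h.a_pos]
  have b3 : ((1 + lam) * (a - lam) - lam ^ 3 * x, 1 + lam ^ 3 * (1 - y)) ∉ lowerBox := fun hb => by
    have := hb.2.2
    simp only at this
    nlinarith [pow_pos l0 3]
  rcases lt_or_gt_of_ne hc with hlt | hgt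
  · have hx := (param_lt_cut_iff h).1 hlt
    obtain ⟨c1, c2, c3⟩ := strip_short h hp hx
    obtain rfl : s = true := by rw [hs]; simpa using hlt
    have i4 := iterate_succ_eq i3 c2
    simp only [returnTime, if_true]
    rw [i4]
    refine ⟨?_, ?_, c3, ?_, ?_⟩
    · intro j hj
      interval_cases j
      · exact a1
      · rw [i1]; exact a3
      · rw [i2]; exact a5
      · rw [i3]; exact c1
    · intro j hj hj0
      interval_cases j
      · rw [i1]; exact b1
      · rw [i2]; exact b2
      · rw [i3]; exact b3
    · rw [inducedMap, if_pos hlt.le, param, param]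
      field_simp
      ring
    · simp
  · have hx := (cut_lt_param_iff h).1 hgt
    obtain ⟨c1, c2, c3, c4, c5⟩ := strip_long h hp hx
    obtain ⟨d1, d2, d3, d4, d5, d6⟩ := upper_start h c1 c2 c3
    rw [c4] at d6
    obtain rfl : s = false := by rw [hs]; simpa using hgt.le
    have i4 := iterate_succ_eq i3 d2
    have i5 := iterate_succ_eq i4 d4
    have i6 := iterate_succ_eq i5 d6
    simp only [returnTime, Bool.false_eq_true, if_false]
    rw [i6]
    refine ⟨?_, ?_, c5, ?_, ?_⟩
    · intro j hj
      interval_cases j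
      · exact a1
      · rw [i1]; exact a3
      · rw [i2]; exact a5
      · rw [i3]; exact d1
      · rw [i4]; exact d3
      · rw [i5]; exact d5
    · intro j hj hj0
      interval_cases j
      · rw [i1]; exact b1
      · rw [i2]; exact b2
      · rw [i3]; exact b3
      · rw [i4]
        intro hb
        have := hb.2.1
        simp only at this
        nlinarith
      · rw [i5]
        intro hb
        have := hb.2.2
        simp only at this
        nlinarith [pow_pos l0 2]
    · rw [inducedMap, if_neg (not_le.2 hgt), param, param]
      field_simp
      ring
    · have : lam ^ 6 ≤ lam ^ 4 := pow_le_pow_of_le_one l0.le h.lam_lt_one.le (by norm_num)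
      simp only
      nlinarith

/-- Below I the third image has abscissa zero and lies above A, so it is on the ray DA. -/
theorem iterate_three_mem_singularSet (h : Params a b lam) (hp : p ∈ strip a lam)
    (hc : param a lam p = cut a lam) :
    (billiard (quad a b) lam)^[3] p ∈ singularSet (quad a b) ∧
    ∀ j < 4, 0 < j → (billiard (quad a b) lam)^[j] p ∉ lowerBox := by
  obtain ⟨x, y⟩ := p
  have l0 := h.lam_pos
  obtain ⟨a1, a2, a3, a4, a5, a6⟩ := strip_start h hp
  obtain ⟨h1, h2, h3, h4, h5⟩ := hp
  simp only at h1 h2 h3 h4 h5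
  have hx : lenH a lam = -x := by
    have e1 := mt (param_lt_cut_iff (p := (x, y)) h).2 hc.not_lt
    have e2 := mt (cut_lt_param_iff (p := (x, y)) h).2 hc.symm.not_lt
    exact le_antisymm (not_lt.1 e2) (not_lt.1 e1)
  have e3 : (1 + lam) * (a - lam) - lam ^ 3 * x = 0 := by
    have := lam_cube_mul_lenH h
    rw [hx] at this
    linarith
  have i1 : (billiard (quad a b) lam)^[1] (x, y) = _ := a2
  have i2 := iterate_succ_eq i1 a4
  have i3 := iterate_succ_eq i2 a6
  have b1 : (-lam * x, -lam * y) ∉ lowerBox := fun hb => by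
    have := hb.2.1
    simp only at this
    nlinarith
  have b2 : (1 + lam + lam ^ 2 * x, 1 - lam ^ 2 * (1 - y)) ∉ lowerBox := fun hb => by
    have := hb.1
    simp only at this
    nlinarith [mul_nonneg (mul_nonneg (sub_nonneg.2 h.a_lt_one.le) l0.le) (sub_nonneg.2 h3.le),
      h.a_pos]
  have b3 : ((1 + lam) * (a - lam) - lam ^ 3 * x, 1 + lam ^ 3 * (1 - y)) ∉ lowerBox := fun hb => by
    have := hb.2.2
    simp only at this
    nlinarith [pow_pos l0 3]
  constructor
  · rw [i3, e3]
    refine mem_iUnion.2 ⟨3, 1 + lam ^ 3 * (1 - y), ?_, ?_⟩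
    · nlinarith [pow_pos l0 3]
    · ext <;> simp [quad]
  · intro j hj hj0
    interval_cases j
    · rw [i1]; exact b1
    · rw [i2]; exact b2
    · rw [i3]; exact b3

end Block

/-! ### The induced map -/

section Induced

variable {a b lam : ℝ}

/-- This rewrites the second branch through its right limit at the cut, `1 - lam * (1 + lam) / l`.
-/
theorem lenY_add (h : Params a b lam) :
    lenY a lam + lam ^ 6 * lenH a lam = lam * (1 + lam) := by
  have := lam_cube_mul_lenH h
  rw [lenY]; linear_combination lam ^ 3 * this

theorem mul_lenL_mul_cut (h : Params a b lam) : lam ^ 4 * (lenL a lam * cut a lam) = lam * a := by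
  have h1 : lenL a lam * cut a lam = lenL a lam - lenH a lam := by
    have := (lenL_pos h).ne'
    rw [cut]; field_simp
  have := h.lam_pos.ne'
  rw [h1, lenH]; field_simp; ring

theorem inducedMap_of_le {x : ℝ} (hx : x ≤ cut a lam) :
    inducedMap a lam x = 1 - lam ^ 4 * (cut a lam - x) := by
  rw [inducedMap, if_pos hx, cut]; ring

theorem inducedMap_of_lt (h : Params a b lam) {x : ℝ} (hx : cut a lam < x) :
    inducedMap a lam x = 1 - lam * (1 + lam) / lenL a lam + lam ^ 6 * (x - cut a lam) := by
  have := (lenL_pos h).ne'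
  rw [inducedMap, if_neg (not_le.2 hx), cut, ← lenY_add h]
  field_simp; ring

/-- Here the bound on `a` enters as the positivity of the right limit at the cut: long returns stay
to the right of E. -/
theorem mul_one_add_lt_lenL (h : Params a b lam) : lam * (1 + lam) < lenL a lam := by
  have h1 := lam_sq_mul_lenL h
  have : lam ^ 2 * (lam * (1 + lam)) < lam ^ 2 * lenL a lam := by linarith [h.range]
  exact lt_of_mul_lt_mul_left this (pow_nonneg h.lam_pos.le 2)

/-- Multiplied by `l`, the infimum of the first branch is `l - lam * a` and the maximum of the
second is `l - y`. The bound on `a` separates them. -/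
theorem lam_mul_lt_lenY (h : Params a b lam) : lam * a < lenY a lam := by
  have l0 := h.lam_pos
  have e : lenY a lam - lam * a
    = lam * ((1 + lam - lam ^ 3 - lam ^ 4 - a) + (a * lam ^ 2 + a * lam ^ 3)) := by
    rw [lenY]; ring
  have h1 : 0 < a * lam ^ 2 + a * lam ^ 3 := by
    have := h.a_pos
    positivity
  have := mul_pos l0 (add_pos (sub_pos.2 h.range) h1)
  linarith

/-- The images of the two branches are separated. -/
theorem inducedMap_high_lt_low (h : Params a b lam) {x y : ℝ} (hx0 : 0 < x) (hx : x ≤ cut a lam)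
    (hy : cut a lam < y) (hy1 : y ≤ 1) : inducedMap a lam y < inducedMap a lam x := by
  have l0 := h.lam_pos
  have hl := lenL_pos h
  have h1 : inducedMap a lam y ≤ 1 - lenY a lam / lenL a lam := by
    rw [inducedMap, if_neg (not_le.2 hy)]
    nlinarith [pow_pos l0 6]
  have h2 : 1 - lam ^ 4 * cut a lam < inducedMap a lam x := by
    rw [inducedMap_of_le hx]
    nlinarith [pow_pos l0 4]
  have h3 : lam ^ 4 * cut a lam < lenY a lam / lenL a lam := by
    rw [lt_div_iff₀ hl]
    have := mul_lenL_mul_cut h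
    linarith [lam_mul_lt_lenY h]
  linarith

theorem inducedMap_mem (h : Params a b lam) {x : ℝ} (hx : x ∈ Ioc (0 : ℝ) 1) :
    inducedMap a lam x ∈ Ioc (0 : ℝ) 1 := by
  have l0 := h.lam_pos
  have hl := lenL_pos h
  have hc := cut_le_one h
  rcases le_or_gt x (cut a lam) with hxc | hxc
  · rw [inducedMap_of_le hxc]
    have : lam ^ 4 < 1 := pow_lt_one₀ l0.le h.lam_lt_one (by norm_num)
    have h4 := pow_pos l0 4
    constructor <;> nlinarith [hx.1]
  · refine ⟨?_, ?_⟩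
    · rw [inducedMap_of_lt h hxc]
      have : lam * (1 + lam) / lenL a lam < 1 := (div_lt_one hl).2 (mul_one_add_lt_lenL h)
      nlinarith [pow_pos l0 6]
    · exact ((inducedMap_high_lt_low h (cut_pos h) le_rfl hxc hx.2).trans_le
        (by rw [inducedMap_of_le le_rfl]; simp)).le

theorem inducedMap_injOn (h : Params a b lam) : InjOn (inducedMap a lam) (Ioc 0 1) := by
  have l0 := h.lam_pos
  intro x hx y hy hxy
  rcases le_or_gt x (cut a lam) with hxc | hxc <;> rcases le_or_gt y (cut a lam) with hyc | hyc
  · rw [inducedMap_of_le hxc, inducedMap_of_le hyc] at hxy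
    have := mul_left_cancel₀ (pow_pos l0 4).ne' (sub_right_injective hxy)
    linarith
  · exact absurd hxy (inducedMap_high_lt_low h hx.1 hxc hyc hy.2).ne'
  · exact absurd hxy (inducedMap_high_lt_low h hy.1 hyc hxc hx.2).ne
  · rw [inducedMap_of_lt h hxc, inducedMap_of_lt h hyc] at hxy
    have := mul_left_cancel₀ (pow_pos l0 6).ne' (add_left_cancel hxy)
    linarith

theorem inducedMap_lipschitz (h : Params a b lam) : ∃ k : NNReal, k < 1 ∧
    LipschitzOnWith k (inducedMap a lam) (Ioc 0 (cut a lam)) ∧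
    LipschitzOnWith k (inducedMap a lam) (Ioc (cut a lam) 1) := by
  have l0 := h.lam_pos
  have p4 : lam ^ 4 < 1 := pow_lt_one₀ l0.le h.lam_lt_one (by norm_num)
  refine ⟨⟨lam ^ 4, by positivity⟩, by exact_mod_cast p4, ?_, ?_⟩
  · refine LipschitzOnWith.of_dist_le_mul fun x hx y hy => ?_
    rw [inducedMap_of_le hx.2, inducedMap_of_le hy.2, Real.dist_eq, Real.dist_eq]
    have e : 1 - lam ^ 4 * (cut a lam - x) - (1 - lam ^ 4 * (cut a lam - y))
      = lam ^ 4 * (x - y) := by ring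
    rw [e, abs_mul, abs_of_pos (pow_pos l0 4)]
    exact le_rfl
  · refine LipschitzOnWith.of_dist_le_mul fun x hx y hy => ?_
    rw [inducedMap_of_lt h hx.1, inducedMap_of_lt h hy.1, Real.dist_eq, Real.dist_eq,
      add_sub_add_left_eq_sub, ← mul_sub, sub_sub_sub_cancel_right, abs_mul,
      abs_of_pos (pow_pos l0 6)]
    exact mul_le_mul_of_nonneg_right
      (pow_le_pow_of_le_one l0.le h.lam_lt_one.le (by norm_num)) (abs_nonneg _)

theorem inducedMap_tendsto_left (h : Params a b lam) (x : ℝ) :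
    Tendsto (inducedMap a lam) (𝓝[<] x) (𝓝 (inducedMap a lam x)) := by
  rcases le_or_gt x (cut a lam) with hxc | hxc
  · have hc : Continuous fun y => 1 - lam ^ 4 * (cut a lam - y) := by fun_prop
    rw [inducedMap_of_le hxc]
    refine (hc.continuousWithinAt (s := Iio x)).tendsto.congr' ?_
    filter_upwards [self_mem_nhdsWithin] with y hy
    exact (inducedMap_of_le ((le_of_lt hy).trans hxc)).symm
  · have hc : Continuous fun y =>
        1 - lam * (1 + lam) / lenL a lam + lam ^ 6 * (y - cut a lam) := by fun_prop
    rw [inducedMap_of_lt h hxc]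
    refine (hc.continuousWithinAt (s := Iio x)).tendsto.congr' ?_
    filter_upwards [mem_nhdsWithin_of_mem_nhds (Ioi_mem_nhds hxc)] with y hy
    exact (inducedMap_of_lt h hy).symm

end Induced

/-! ### The first return to the lower rectangles -/

section ReturnValue

variable {a b lam : ℝ}

theorem IsFirstReturn.unique {V : Fin 4 → ℝ × ℝ} {R : Set (ℝ × ℝ)} {p q q' : ℝ × ℝ}
    (hq : IsFirstReturn V lam R p q) (hq' : IsFirstReturn V lam R p q') : q = q' := by
  obtain ⟨-, hR, n, hn, -, e, hm⟩ := hq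
  obtain ⟨-, hR', n', hn', -, e', hm'⟩ := hq'
  rcases lt_trichotomy n n' with hlt | rfl | hlt
  · exact absurd (e ▸ hR) (hm' n hn hlt)
  · exact e.symm.trans e'
  · exact absurd (e' ▸ hR') (hm n' hn' hlt)

theorem eventually_lt_const {c : ℝ} (hc : 0 < c) : ∀ᶠ ε in 𝓝[>] (0 : ℝ), ε < c :=
  mem_nhdsWithin_of_mem_nhds (Iio_mem_nhds hc)

theorem eventually_pos : ∀ᶠ ε in 𝓝[>] (0 : ℝ), 0 < ε := self_mem_nhdsWithin

theorem IsReturnValue.unique (h : Params a b lam) {x z z' : ℝ} (hz : IsReturnValue a b x z)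
    (hz' : IsReturnValue a b x z') : z = z' := by
  have hl := lenL_pos h
  rw [h.lam_eq] at hl
  obtain ⟨ε, ⟨h1, h2⟩, h0⟩ := ((hz.and hz').and eventually_pos).exists
  obtain ⟨q, hq, e⟩ := h1 (ε ^ 2) ⟨by positivity, le_rfl⟩
  obtain ⟨q', hq', e'⟩ := h2 (ε ^ 2) ⟨by positivity, le_rfl⟩
  obtain rfl := hq.unique hq'
  rw [e] at e'
  have := mul_right_cancel₀ hl.ne' (neg_injective e')
  linarith

theorem rectTwo_subset_lowerBox {ε : ℝ} (h0 : 0 < ε) (h1 : ε < 1) :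
    rectTwo a lam ε ⊆ lowerBox := by
  rintro p ⟨hp1, hp2⟩
  exact ⟨hp1.2, by nlinarith [hp2.1], hp2.2⟩

/-- Points slightly below a point of the open segment `EA` lie in the strip. -/
theorem eventually_mem_strip (h : Params a b lam) {x : ℝ} (hx : x ∈ Ioo (0 : ℝ) 1) :
    ∀ᶠ ε in 𝓝[>] (0 : ℝ), ∀ δ ∈ Ioc (0 : ℝ) (ε ^ 2),
      (-((1 - x) * lenL a lam), 1 - δ) ∈ strip a lam := by
  have l0 := h.lam_pos
  have hl := lenL_pos h
  have c1 : 0 < (1 - a) * lam := mul_pos (by linarith [h.a_lt_one]) l0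
  have c2 : 0 < lam ^ 2 * (x * lenL a lam) := mul_pos (pow_pos l0 2) (mul_pos hx.1 hl)
  filter_upwards [eventually_pos, eventually_lt_const zero_lt_one,
    eventually_lt_const (div_pos c2 c1),
    eventually_lt_const (div_pos (sub_pos.2 h.range) c1)] with ε h0 h1 h2 h3 δ hδ
  rw [lt_div_iff₀ c1] at h2 h3
  have h4 : δ ≤ ε := hδ.2.trans (by nlinarith)
  have h5 : δ * ((1 - a) * lam) ≤ ε * ((1 - a) * lam) := mul_le_mul_of_nonneg_right h4 c1.le
  have := lam_sq_mul_lenL h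
  refine ⟨?_, ?_, ?_, ?_, ?_⟩
  · simp only; nlinarith [hx.2]
  · simp only; linarith
  · simp only; linarith [hδ.1]
  · simp only; linarith
  · simp only; linarith

theorem param_mk (h : Params a b lam) (x y : ℝ) :
    param a lam (-((1 - x) * lenL a lam), y) = x := by
  have := (lenL_pos h).ne'
  rw [param]; field_simp; ring

theorem fst_eq_of_param (h : Params a b lam) (p : ℝ × ℝ) :
    p.1 = -((1 - param a lam p) * lenL a lam) := by
  have := (lenL_pos h).ne'
  rw [param]; field_simp; ring

/-- For small `ε` the return to the strip lands in R₂, since its parameter is positive and its depth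
has shrunk. It is the first one because R₂ is contained in `lowerBox`. -/
theorem isReturnValue_inducedMap (h : Params a b lam) {x : ℝ} (hx : x ∈ Ioo (0 : ℝ) 1)
    (hxc : x ≠ cut a lam) : IsReturnValue a b x (inducedMap a lam x) := by
  have l0 := h.lam_pos
  have hl := lenL_pos h
  have hg := inducedMap_mem h (Ioo_subset_Ioc_self hx)
  have p4 : lam ^ 4 < 1 := pow_lt_one₀ l0.le h.lam_lt_one (by norm_num)
  rw [IsReturnValue, ← h.lam_eq]
  filter_upwards [eventually_mem_strip h hx, eventually_pos, eventually_lt_const zero_lt_one,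
    eventually_lt_const (mul_pos hx.1 hl), eventually_lt_const (mul_pos hg.1 hl)]
    with ε hS h0 h1 h2 h3 δ hδ
  have hS := hS δ hδ
  set p : ℝ × ℝ := (-((1 - x) * lenL a lam), 1 - δ) with hp
  have hpx : param a lam p = x := param_mk h x _
  obtain ⟨A1, A2, A3, A4, A5⟩ := strip_return h hS (hpx.symm ▸ hxc) rfl
  have hg' : inducedMap a lam (param a lam p) = inducedMap a lam x := by rw [hpx]
  have hq1 := fst_eq_of_param h ((billiard (quad a b) lam)^[returnTime
    (decide (param a lam p < cut a lam))] p)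
  rw [A4, hg'] at hq1
  have hp2 : 1 - p.2 = δ := by simp [hp]
  rw [hp2] at A5
  have hδ2 : lam ^ 4 * δ ≤ ε ^ 2 := by nlinarith [hδ.1, hδ.2]
  refine ⟨_, ⟨?_, ?_, _, ?_, ?_, rfl, ?_⟩, hq1⟩
  · refine ⟨⟨?_, ?_⟩, ?_, ?_⟩
    · simp only [hp]; linarith
    · exact hS.1.le
    · simp only [hp]; linarith [hδ.2]
    · exact hS.2.2.1.le
  · refine ⟨⟨?_, A3.1.le⟩, ?_, A3.2.2.1.le⟩
    · rw [hq1]; linarith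
    · linarith
  · rw [returnTime]; split_ifs <;> norm_num
  · exact fun i hi => (A1 i hi).2
  · exact fun i hi0 hi hR => A2 i hi hi0 (rectTwo_subset_lowerBox h0 h1 hR)

theorem left_edge_subset_polygon {y : ℝ} (h0 : 0 ≤ y) (h1 : y ≤ 1) :
    ((0, y) : ℝ × ℝ) ∈ polygon (quad a b) := by
  have hA : ((0, 1) : ℝ × ℝ) ∈ polygon (quad a b) := subset_convexHull ℝ _ ⟨0, rfl⟩
  have hD : ((0, 0) : ℝ × ℝ) ∈ polygon (quad a b) := subset_convexHull ℝ _ ⟨3, rfl⟩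
  have := convex_convexHull ℝ (range (quad a b)) hA hD h0 (sub_nonneg.2 h1) (by ring)
  simpa [polygon] using this

/-- At the cut the third image is singular, and no earlier image is back in R₂. At parameter `1` the
starting point is on the edge DA. -/
theorem not_isReturnValue (h : Params a b lam) {x : ℝ} (hx : x ∈ Ioc (0 : ℝ) 1)
    (hxc : x = cut a lam ∨ x = 1) : ¬∃ z, IsReturnValue a b x z := by
  rintro ⟨z, hz⟩
  rw [IsReturnValue, ← h.lam_eq] at hz
  rcases eq_or_lt_of_le hx.2 with rfl | hx1
  · obtain ⟨ε, ⟨h1, h0⟩, h3⟩ := ((hz.and eventually_pos).and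
      (eventually_lt_const zero_lt_one)).exists
    obtain ⟨q, ⟨-, -, n, hn, hm, -⟩, -⟩ := h1 (ε ^ 2) ⟨by positivity, le_rfl⟩
    refine hm 0 hn (Or.inl ?_)
    simp only [sub_self, zero_mul, neg_zero, Function.iterate_zero, id]
    exact left_edge_subset_polygon (by nlinarith) (by nlinarith)
  · have hxc := hxc.resolve_right hx1.ne
    obtain ⟨ε, ⟨⟨h1, h0⟩, h3⟩, hS⟩ := (((hz.and eventually_pos).and
      (eventually_lt_const zero_lt_one)).and (eventually_mem_strip h ⟨hx.1, hx1⟩)).exists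
    have hS := hS (ε ^ 2) ⟨by positivity, le_rfl⟩
    obtain ⟨q, ⟨-, hq, n, hn, hm, e, -⟩, -⟩ := h1 (ε ^ 2) ⟨by positivity, le_rfl⟩
    obtain ⟨B1, B2⟩ := iterate_three_mem_singularSet h hS ((param_mk h x _).trans hxc)
    rcases lt_or_ge n 4 with hn4 | hn4
    · exact B2 n hn4 hn (rectTwo_subset_lowerBox h0 h3 (e ▸ hq))
    · exact hm 3 (by omega) (Or.inr B1)

theorem returnMapAux_eq (h : Params a b lam) {x : ℝ} (hx : x ∈ Ioo (0 : ℝ) 1)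
    (hxc : x ≠ cut a lam) : returnMapAux a b x = inducedMap a lam x := by
  have hz : ∃ z, IsReturnValue a b x z := ⟨_, isReturnValue_inducedMap h hx hxc⟩
  rw [returnMapAux, dif_pos hz]
  exact hz.choose_spec.unique h (isReturnValue_inducedMap h hx hxc)

theorem returnMap_eq (h : Params a b lam) {x : ℝ} (hx : x ∈ Ioc (0 : ℝ) 1) :
    returnMap a b x = inducedMap a lam x := by
  by_cases hxc : x = cut a lam ∨ x = 1
  · rw [returnMap, if_neg (not_isReturnValue h hx hxc)]
    refine Tendsto.limUnder_eq ((inducedMap_tendsto_left h x).congr' ?_)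
    -- A left neighbourhood inside one branch and away from the cut, where the first return is
    -- defined.
    have : ∀ᶠ y in 𝓝[<] x, y ∈ Ioo (max 0 (if x ≤ cut a lam then 0 else cut a lam)) x := by
      refine Ioo_mem_nhdsLT (max_lt hx.1 ?_)
      split_ifs with hx'
      · exact hx.1
      · exact not_le.1 hx'
    filter_upwards [this] with y hy
    have hy0 := (max_lt_iff.1 hy.1)
    refine (returnMapAux_eq h ⟨hy0.1, hy.2.trans_le hx.2⟩ ?_).symm
    split_ifs at hy0 with hx'
    · exact (hy.2.trans_le hx').ne
    · exact hy0.2.ne'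
  · push Not at hxc
    have hx' : x ∈ Ioo (0 : ℝ) 1 := ⟨hx.1, lt_of_le_of_ne hx.2 hxc.2⟩
    rw [returnMap, if_pos ⟨_, isReturnValue_inducedMap h hx' hxc.1⟩]
    exact returnMapAux_eq h hx' hxc.1

end ReturnValue

/-! ### The lift of the induced map and its rotation number -/

/-- The representative of `x` modulo `1` in `(0, 1]`. -/
noncomputable def unitPart (x : ℝ) : ℝ := x - ⌈x⌉ + 1

theorem unitPart_mem (x : ℝ) : unitPart x ∈ Ioc (0 : ℝ) 1 := by
  have h1 := Int.le_ceil x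
  have h2 := Int.ceil_lt_add_one x
  constructor <;> rw [unitPart] <;> linarith

theorem unitPart_add_int (x : ℝ) (m : ℤ) : unitPart (x + m) = unitPart x := by
  rw [unitPart, unitPart, Int.ceil_add_intCast]; push_cast; ring

theorem ceil_of_mem_Ioc {x : ℝ} (hx : x ∈ Ioc (0 : ℝ) 1) : ⌈x⌉ = 1 := by
  rw [Int.ceil_eq_iff]; norm_num; exact hx

theorem unitPart_of_mem {x : ℝ} (hx : x ∈ Ioc (0 : ℝ) 1) : unitPart x = x := by
  rw [unitPart, ceil_of_mem_Ioc hx]; norm_num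

/-- Two lifts of the same map differ by an integer. -/
theorem IsLift.exists_int {g F G : ℝ → ℝ} (hF : IsLift g F) (hG : IsLift g G) :
    ∃ m : ℤ, ∀ x, F x = G x + m := by
  have key : ∀ x ∈ Ioc (0 : ℝ) 1, ∃ m : ℤ, F x = G x + m := fun x hx => by
    obtain ⟨m, hm⟩ := hF.lifts x hx
    obtain ⟨n, hn⟩ := hG.lifts x hx
    exact ⟨m - n, by rw [hm, hn]; push_cast; ring⟩
  -- Both lifts rise by less than one on `(0, 1]`, so the integers by which they differ at `x` and
  -- at `1` are less than one apart, hence equal.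
  have inc : ∀ {H : ℝ → ℝ}, IsLift g H → ∀ {x}, x ∈ Ioc (0 : ℝ) 1 →
      0 ≤ H 1 - H x ∧ H 1 - H x < 1 := fun {H} hH x hx => by
    refine ⟨sub_nonneg.2 (hH.strictMono.monotone hx.2), ?_⟩
    have := hH.strictMono (show (1 : ℝ) < x + 1 by linarith [hx.1])
    rw [hH.degree_one] at this
    linarith
  obtain ⟨m, hm⟩ := key 1 ⟨zero_lt_one, le_rfl⟩
  have shift : ∀ {H : ℝ → ℝ}, IsLift g H → ∀ (x : ℝ) (k : ℤ), H (x + k) = H x + k :=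
    fun {H} hH x k => by
      let C : CircleDeg1Lift := ⟨⟨H, hH.strictMono.monotone⟩, hH.degree_one⟩
      exact C.map_add_int x k
  have main : ∀ x ∈ Ioc (0 : ℝ) 1, F x = G x + m := fun x hx => by
    obtain ⟨n, hn⟩ := key x hx
    have h1 := inc hF hx
    have h2 := inc hG hx
    have h3 : ((m - n : ℤ) : ℝ) = (F 1 - F x) - (G 1 - G x) := by
      rw [hm, hn]; push_cast; ring
    have h4 : ((m - n : ℤ) : ℝ) < 1 := by linarith
    have h5 : (-1 : ℝ) < ((m - n : ℤ) : ℝ) := by linarith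
    have h6 : m - n < 1 := by exact_mod_cast h4
    have h7 : -1 < m - n := by exact_mod_cast h5
    rw [hn, show n = m by omega]
  refine ⟨m, fun x => ?_⟩
  have e : x = unitPart x + (⌈x⌉ - 1 : ℤ) := by rw [unitPart]; push_cast; ring
  rw [e, shift hF, shift hG, main _ (unitPart_mem x)]
  ring

section Lift

variable {a b lam : ℝ}

/-- The induced map on `(0, 1]`, with its second branch raised by one. -/
noncomputable def raisedMap (a lam t : ℝ) : ℝ :=
  inducedMap a lam t + if t ≤ cut a lam then 0 else 1

theorem raisedMap_lt (h : Params a b lam) {s t : ℝ} (hs : s ∈ Ioc (0 : ℝ) 1)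
    (ht : t ∈ Ioc (0 : ℝ) 1) (hst : s < t) : raisedMap a lam s < raisedMap a lam t := by
  have l0 := h.lam_pos
  rw [raisedMap, raisedMap]
  rcases le_or_gt t (cut a lam) with htc | htc
  · have hsc := hst.le.trans htc
    rw [if_pos htc, if_pos hsc, inducedMap_of_le htc, inducedMap_of_le hsc]
    nlinarith [pow_pos l0 4]
  · rw [if_neg (not_le.2 htc)]
    rcases le_or_gt s (cut a lam) with hsc | hsc
    · rw [if_pos hsc]
      linarith [(inducedMap_mem h hs).2, (inducedMap_mem h ht).1]
    · rw [if_neg (not_le.2 hsc), inducedMap_of_lt h htc, inducedMap_of_lt h hsc]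
      nlinarith [pow_pos l0 6]

/-- This makes the lift increase across integers. The critical case, `s` above the cut and `t` below
it, is the separation of the images of the two branches. -/
theorem raisedMap_lt_add_one (h : Params a b lam) {s t : ℝ} (hs : s ∈ Ioc (0 : ℝ) 1)
    (ht : t ∈ Ioc (0 : ℝ) 1) : raisedMap a lam s < raisedMap a lam t + 1 := by
  have h1 := inducedMap_mem h hs
  have h2 := inducedMap_mem h ht
  rw [raisedMap, raisedMap]
  rcases le_or_gt t (cut a lam) with htc | htc <;> rcases le_or_gt s (cut a lam) with hsc | hsc
  · rw [if_pos htc, if_pos hsc]; linarith [h1.2, h2.1]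
  · rw [if_pos htc, if_neg (not_le.2 hsc)]
    linarith [inducedMap_high_lt_low h ht.1 htc hsc hs.2]
  · rw [if_neg (not_le.2 htc), if_pos hsc]; linarith [h1.2, h2.1]
  · rw [if_neg (not_le.2 htc), if_neg (not_le.2 hsc)]; linarith [h1.2, h2.1]

/-- The lift of the induced map. -/
noncomputable def liftFun (a lam x : ℝ) : ℝ := raisedMap a lam (unitPart x) + (⌈x⌉ - 1 : ℤ)

theorem liftFun_strictMono (h : Params a b lam) : StrictMono (liftFun a lam) := by
  intro x y hxy
  rw [liftFun, liftFun]
  rcases (Int.ceil_mono hxy.le).eq_or_lt with hc | hc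
  · rw [hc]
    refine add_lt_add_left (raisedMap_lt h (unitPart_mem x) (unitPart_mem y) ?_) _
    rw [unitPart, unitPart, hc]; linarith
  · have h1 := raisedMap_lt_add_one h (unitPart_mem x) (unitPart_mem y)
    have h2 : ((⌈x⌉ - 1 : ℤ) : ℝ) + 1 ≤ (⌈y⌉ - 1 : ℤ) := by exact_mod_cast by omega
    linarith

theorem liftFun_add_one (a lam x : ℝ) : liftFun a lam (x + 1) = liftFun a lam x + 1 := by
  have := unitPart_add_int x 1
  push_cast at this
  rw [liftFun, liftFun, this, Int.ceil_add_one]; push_cast; ring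

theorem isLift_liftFun (h : Params a b lam) : IsLift (returnMap a b) (liftFun a lam) := by
  refine ⟨liftFun_strictMono h, liftFun_add_one a lam, fun x hx => ?_⟩
  refine ⟨if x ≤ cut a lam then 0 else 1, ?_⟩
  rw [liftFun, unitPart_of_mem hx, ceil_of_mem_Ioc hx, returnMap_eq h hx, raisedMap]
  split_ifs <;> norm_num

/-- The lift of the induced map as a monotone map of degree one. -/
noncomputable def circleLift (h : Params a b lam) : CircleDeg1Lift :=
  ⟨⟨liftFun a lam, (liftFun_strictMono h).monotone⟩, liftFun_add_one a lam⟩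

theorem circleLift_apply (h : Params a b lam) (x : ℝ) : circleLift h x = liftFun a lam x := rfl

theorem circleLift_strictMono (h : Params a b lam) : StrictMono (circleLift h) :=
  liftFun_strictMono h

theorem hasRotationNumber (h : Params a b lam) :
    HasRotationNumber (returnMap a b) (circleLift h).translationNumber := by
  refine ⟨⟨_, isLift_liftFun h⟩, fun F hF => ?_⟩
  obtain ⟨m, hm⟩ := hF.exists_int (isLift_liftFun h)
  refine ⟨m, fun x => ?_⟩
  have key : ∀ n : ℕ, F^[n] x = (liftFun a lam)^[n] x + n * m := fun n => by
    induction n with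
    | zero => simp
    | succ n ih =>
      have := (circleLift h).map_add_int ((liftFun a lam)^[n] x) (n * m)
      rw [circleLift_apply, circleLift_apply] at this
      push_cast at this
      rw [Function.iterate_succ_apply', Function.iterate_succ_apply', ih, hm, this]
      push_cast; ring
  have h1 := ((circleLift h).tendsto_translationNumber x).add_const (m : ℝ)
  refine h1.congr' ?_
  filter_upwards [eventually_gt_atTop 0] with n hn
  have hn' : (n : ℝ) ≠ 0 := by positivity
  rw [key, CircleDeg1Lift.coe_pow]
  change ((liftFun a lam)^[n] x - x) / n + m = _
  field_simp; ring

/-- The fractional part follows the induced map while the ceiling counts passages through the second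
branch, that is, the long returns. -/
theorem unitPart_liftFun (h : Params a b lam) (x : ℝ) :
    unitPart (liftFun a lam x) = inducedMap a lam (unitPart x) ∧
    ⌈liftFun a lam x⌉ = ⌈x⌉ + if unitPart x ≤ cut a lam then 0 else 1 := by
  have hm := inducedMap_mem h (unitPart_mem x)
  have e : liftFun a lam x = inducedMap a lam (unitPart x) +
      ((⌈x⌉ - 1 + if unitPart x ≤ cut a lam then 0 else 1 : ℤ) : ℝ) := by
    rw [liftFun, raisedMap]; split_ifs <;> push_cast <;> ring
  rw [e, unitPart_add_int, Int.ceil_add_intCast, ceil_of_mem_Ioc hm, unitPart_of_mem hm]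
  exact ⟨rfl, by ring⟩

end Lift

/-! ### Orbits of monotone degree one maps with rational rotation number -/

section Rational

variable (f : CircleDeg1Lift)

theorem iterate_add_int (n : ℕ) (x : ℝ) (m : ℤ) : f^[n] (x + m) = f^[n] x + m := by
  have := (f ^ n).map_add_int x m
  rwa [CircleDeg1Lift.coe_pow] at this

theorem iterate_lt_add (n : ℕ) (x : ℝ) : f^[n] x < x + n * f.translationNumber + 1 := by
  have := (f ^ n).map_lt_add_translationNumber_add_one x
  rwa [CircleDeg1Lift.coe_pow, CircleDeg1Lift.translationNumber_pow] at this

theorem sub_lt_iterate (n : ℕ) (x : ℝ) : x + n * f.translationNumber - 1 < f^[n] x := by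
  -- The largest integer strictly below the translation number of the iterate; it is at least that
  -- number minus one.
  have h1 := (f ^ n).lt_map_of_int_lt_translationNumber (n := ⌈(f ^ n).translationNumber⌉ - 1)
    (by have := Int.ceil_lt_add_one (f ^ n).translationNumber; push_cast; linarith) x
  have h2 := Int.le_ceil (f ^ n).translationNumber
  rw [CircleDeg1Lift.coe_pow] at h1
  push_cast at h1
  rw [CircleDeg1Lift.translationNumber_pow] at h1 h2
  linarith

theorem exists_eq_of_le_succ_of_le {e : ℕ → ℤ} (he : ∀ n, e n ≤ e (n + 1)) {B : ℤ}
    (hB : ∀ n, e n ≤ B) : ∃ N, ∀ n, N ≤ n → e n = e N := by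
  obtain ⟨m, ⟨N, hN⟩, hm⟩ := Int.exists_greatest_of_bdd (P := fun z => ∃ n, e n = z)
    ⟨B, fun z ⟨n, hn⟩ => hn ▸ hB n⟩ ⟨e 0, 0, rfl⟩
  refine ⟨N, fun n hn => le_antisymm ?_ (monotone_nat_of_le_succ he hn)⟩
  rw [hN]; exact hm _ ⟨n, rfl⟩

/-- The sum of the integer parts along a segment of length `q` of an orbit. -/
noncomputable def ceilSum (q : ℕ) (x : ℝ) : ℤ := ∑ k ∈ Finset.range q, ⌈f^[k] x⌉

theorem ceilSum_add_int (q : ℕ) (x : ℝ) (m : ℤ) : ceilSum f q (x + m) = ceilSum f q x + q * m := by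
  simp [ceilSum, iterate_add_int, Finset.sum_add_distrib]

theorem ceilSum_map (q : ℕ) (x : ℝ) : ceilSum f q (f x) = ceilSum f q x + (⌈f^[q] x⌉ - ⌈x⌉) := by
  have h1 := Finset.sum_range_succ (fun k => ⌈f^[k] x⌉) q
  have h2 := Finset.sum_range_succ' (fun k => ⌈f^[k] x⌉) q
  simp only [Function.iterate_succ_apply, Function.iterate_zero, id] at h2
  simp only [ceilSum]
  linarith

variable {f} {p : ℤ} {q : ℕ}

/-- An orbit stays within one of uniform motion at speed `p / q`, and `q` terms that each grow like
`n * p / q` sum to `n * p` up to a bounded error. -/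
theorem ceilSum_bounds (hq : 0 < q) (hτ : f.translationNumber = p / q) (x : ℝ) :
    ∃ B : ℤ, ∀ n : ℕ, |ceilSum f q (f^[n] x) - n * p| ≤ B := by
  have hq' : (q : ℝ) ≠ 0 := by positivity
  obtain ⟨B, hB⟩ := exists_int_gt (∑ k ∈ Finset.range q, (|x| + |k * ((p : ℝ) / q)| + 2))
  refine ⟨B, fun n => ?_⟩
  have h1 : |((ceilSum f q (f^[n] x) - n * p : ℤ) : ℝ)| ≤
      ∑ k ∈ Finset.range q, (|x| + |k * ((p : ℝ) / q)| + 2) := by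
    have e : ((ceilSum f q (f^[n] x) - n * p : ℤ) : ℝ)
        = ∑ k ∈ Finset.range q, ((⌈f^[k] (f^[n] x)⌉ : ℝ) - n * ((p : ℝ) / q)) := by
      rw [Finset.sum_sub_distrib, Finset.sum_const, Finset.card_range, nsmul_eq_mul, ceilSum]
      push_cast
      field_simp
    rw [e]
    refine (Finset.abs_sum_le_sum_abs _ _).trans (Finset.sum_le_sum fun k _ => ?_)
    have h2 := iterate_lt_add f (k + n) x
    have h3 := sub_lt_iterate f (k + n) x
    rw [Function.iterate_add_apply, hτ] at h2 h3
    push_cast at h2 h3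
    have h4 := Int.le_ceil (f^[k] (f^[n] x))
    have h5 := Int.ceil_lt_add_one (f^[k] (f^[n] x))
    have h6 := neg_abs_le x
    have h7 := le_abs_self x
    have h8 := neg_abs_le (k * ((p : ℝ) / q))
    have h9 := le_abs_self (k * ((p : ℝ) / q))
    rw [abs_le]
    constructor <;> linarith
  have := h1.trans hB.le
  exact_mod_cast this

/-- Monotonicity propagates the comparison of `f^[q] x` with `x + p` along the orbit, so the
corrected ceiling sum is monotone in `n`. Being an integer and bounded, it stabilizes, and each
further increment vanishes. No continuity of `f` is needed. -/
theorem exists_ceil_iterate_add (hq : 0 < q) (hτ : f.translationNumber = p / q) (x : ℝ) :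
    ∃ N, ∀ n, N ≤ n → ⌈f^[n + q] x⌉ = ⌈f^[n] x⌉ + p := by
  obtain ⟨B, hB⟩ := ceilSum_bounds hq hτ x
  have step : ∀ n : ℕ, ceilSum f q (f^[n + 1] x) - (n + 1 : ℕ) * p
      = (ceilSum f q (f^[n] x) - n * p) + (⌈f^[n + q] x⌉ - (⌈f^[n] x⌉ + p)) := fun n => by
    rw [Function.iterate_succ_apply', ceilSum_map, ← Function.iterate_add_apply, add_comm q n]
    push_cast; ring
  have comm : ∀ n, f^[n + q] x = f^[n] (f^[q] x) := fun n => Function.iterate_add_apply _ _ _ _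
  rcases le_total (x + p) (f^[q] x) with hx | hx
  · have mono : ∀ n, ⌈f^[n] x⌉ + p ≤ ⌈f^[n + q] x⌉ := fun n => by
      have := Int.ceil_mono ((f.monotone.iterate n) hx)
      rwa [← comm, iterate_add_int, Int.ceil_add_intCast] at this
    obtain ⟨N, hN⟩ := exists_eq_of_le_succ_of_le
      (e := fun n : ℕ => ceilSum f q (f^[n] x) - n * p) (B := B)
      (fun n => by rw [step]; linarith [mono n]) (fun n => (abs_le.1 (hB n)).2)
    refine ⟨N, fun n hn => ?_⟩
    have h1 := hN n hn
    have h2 := hN (n + 1) (by omega)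
    rw [step] at h2
    linarith
  · have mono : ∀ n, ⌈f^[n + q] x⌉ ≤ ⌈f^[n] x⌉ + p := fun n => by
      have := Int.ceil_mono ((f.monotone.iterate n) hx)
      rwa [← comm, iterate_add_int, Int.ceil_add_intCast] at this
    obtain ⟨N, hN⟩ := exists_eq_of_le_succ_of_le
      (e := fun n : ℕ => -(ceilSum f q (f^[n] x) - n * p)) (B := B)
      (fun n => by rw [step]; linarith [mono n]) (fun n => by linarith [(abs_le.1 (hB n)).1])
    refine ⟨N, fun n hn => ?_⟩
    have h1 := hN n hn
    have h2 := hN (n + 1) (by omega)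
    rw [step] at h2
    linarith

/-- Two ordered orbits have termwise ordered ceilings, and equality of the sums then forces equality
of every term, in particular the first. -/
theorem ceil_iterate_eq_of_ceilSum_eq (hq : 0 < q) {x y : ℝ} (hxy : ceilSum f q x = ceilSum f q y) :
    ⌈x⌉ = ⌈y⌉ := by
  wlog hle : x ≤ y generalizing x y
  · exact (this hxy.symm (le_of_not_ge hle)).symm
  exact (Finset.sum_eq_sum_iff_of_le fun k _ => Int.ceil_mono ((f.monotone.iterate k) hle)).1 hxy 0
    (Finset.mem_range.2 hq)

/-- Any two orbits eventually cross the integers at the same times, up to a shift. -/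
theorem exists_ceil_increments_eq (hq : 0 < q) (hpq : IsCoprime p (q : ℤ))
    (hτ : f.translationNumber = p / q) (x y : ℝ) :
    ∃ N N' : ℕ, ∀ n, ⌈f^[N + n + 1] x⌉ - ⌈f^[N + n] x⌉ = ⌈f^[N' + n + 1] y⌉ - ⌈f^[N' + n] y⌉ := by
  obtain ⟨N₁, h₁⟩ := exists_ceil_iterate_add hq hτ x
  obtain ⟨N₂, h₂⟩ := exists_ceil_iterate_add hq hτ y
  set N := max N₁ N₂
  have shift : ∀ {z : ℝ}, (∀ n, N ≤ n → ⌈f^[n + q] z⌉ = ⌈f^[n] z⌉ + p) →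
      ∀ k : ℕ, ceilSum f q (f^[N + k] z) = ceilSum f q (f^[N] z) + k * p := fun {z} hz k => by
    induction k with
    | zero => simp
    | succ k ih =>
      have := hz (N + k) (by omega)
      rw [← add_assoc, Function.iterate_succ_apply', ceilSum_map, ih, ← Function.iterate_add_apply,
        add_comm q, this]
      push_cast; ring
  have hx := shift fun n hn => h₁ n ((le_max_left _ _).trans hn)
  have hy := shift fun n hn => h₂ n ((le_max_right _ _).trans hn)
  obtain ⟨u, v, huv⟩ := hpq
  set d := ceilSum f q (f^[N] x) - ceilSum f q (f^[N] y) with hd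
  have hq0 : (q : ℤ) ≠ 0 := by exact_mod_cast hq.ne'
  obtain ⟨i, hi⟩ := Int.eq_ofNat_of_zero_le (Int.emod_nonneg (u * d) hq0)
  -- A time shift by `i` changes the ceiling sum by `i * p`, and an integer translation by `j`
  -- changes it by `q * j`. By Bézout they compensate any difference `d`; reducing `u * d` modulo
  -- `q` makes the time shift nonnegative.
  obtain ⟨j, hij⟩ : ∃ j : ℤ, (i : ℤ) * p + q * j = d := by
    refine ⟨u * d / q * p + v * d, ?_⟩
    have h3 : (i : ℤ) + q * (u * d / q) = u * d := by
      have h4 := Int.emod_add_mul_ediv (u * d) q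
      rw [hi] at h4
      exact h4
    calc (i : ℤ) * p + q * (u * d / q * p + v * d)
        = (i + q * (u * d / q)) * p + q * v * d := by ring
      _ = (u * p + v * q) * d := by rw [h3]; ring
      _ = d := by rw [huv, one_mul]
  have key : ∀ n : ℕ, ⌈f^[N + n] x⌉ = ⌈f^[N + i + n] y⌉ + j := fun n => by
    rw [← Int.ceil_add_intCast (f^[N + i + n] y) j]
    refine ceil_iterate_eq_of_ceilSum_eq (f := f) hq ?_
    rw [ceilSum_add_int, hx, add_assoc, hy]
    push_cast
    linarith
  refine ⟨N, N + i, fun n => ?_⟩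
  have h1 := key n
  have h2 := key (n + 1)
  rw [← add_assoc, ← add_assoc] at h2
  rw [h1, h2]
  ring

end Rational

/-! ### Itineraries and periodic orbits -/

section General

variable {V : Fin 4 → ℝ × ℝ} {lam : ℝ} {p p' : ℝ × ℝ}

theorem reflect_sub_reflect (lam : ℝ) (v p q : ℝ × ℝ) :
    reflect lam v p - reflect lam v q = (-lam) • (p - q) := by
  simp only [reflect]; module

theorem continuous_reflect (lam : ℝ) (v : ℝ × ℝ) : Continuous (reflect lam v) := by
  unfold reflect; fun_prop

theorem iterate_sub_iterate {n : ℕ}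
    (h : ∀ j < n, ∃ i, (billiard V lam)^[j] p ∈ tangentRegion V i ∧
      (billiard V lam)^[j] p' ∈ tangentRegion V i) :
    (billiard V lam)^[n] p - (billiard V lam)^[n] p' = (-lam) ^ n • (p - p') := by
  induction n with
  | zero => simp
  | succ n ih =>
    obtain ⟨i, h1, h2⟩ := h n (Nat.lt_succ_self n)
    rw [Function.iterate_succ_apply', Function.iterate_succ_apply', billiard_of_mem lam h1,
      billiard_of_mem lam h2, reflect_sub_reflect, ih fun j hj => h j (hj.trans (Nat.lt_succ_self n)),
      smul_smul, pow_succ']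

theorem dist_iterate_iterate (hl : 0 ≤ lam) {n : ℕ}
    (h : ∀ j < n, ∃ i, (billiard V lam)^[j] p ∈ tangentRegion V i ∧
      (billiard V lam)^[j] p' ∈ tangentRegion V i) :
    dist ((billiard V lam)^[n] p) ((billiard V lam)^[n] p') = lam ^ n * dist p p' := by
  rw [dist_eq_norm, iterate_sub_iterate h, norm_smul, dist_eq_norm, norm_pow, norm_neg,
    Real.norm_of_nonneg hl]

theorem polygon_subset_of_mem_tangentRegion {i : Fin 4} (hp : p ∈ tangentRegion V i)
    {q : ℝ × ℝ} (hq : q ∈ polygon V) : q = V i ∨ 0 < cross (V i - p) (q - p) := by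
  have key : polygon V ⊆ {q | q = V i ∨ 0 < cross (V i - p) (q - p)} := by
    refine convexHull_min ?_ ?_
    · rintro _ ⟨j, rfl⟩
      by_cases hj : j = i
      · exact Or.inl (by rw [hj])
      · exact Or.inr (hp j hj)
    · intro x hx y hy s t hs ht hst
      have e : cross (V i - p) (s • x + t • y - p)
          = s * cross (V i - p) (x - p) + t * cross (V i - p) (y - p) := by
        obtain rfl : t = 1 - s := by linarith
        simp only [cross, Prod.fst_sub, Prod.snd_sub, Prod.fst_add, Prod.snd_add, Prod.smul_fst,
          Prod.smul_snd, smul_eq_mul]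
        ring
      have e0 : cross (V i - p) (V i - p) = 0 := by simp only [cross]; ring
      rcases hs.eq_or_lt with rfl | hs
      · obtain rfl : t = 1 := by linarith
        simpa using hy
      rcases ht.eq_or_lt with rfl | ht
      · obtain rfl : s = 1 := by linarith
        simpa using hx
      rcases hx with rfl | hx <;> rcases hy with hy | hy
      · left; rw [hy, ← add_smul, hst, one_smul]
      · right; rw [e, e0]; nlinarith
      · right; rw [e, hy, e0]; nlinarith
      · right; rw [e]; nlinarith
  exact key hq

/-- The image is on the line through `p` and `V i`, which meets the polygon only in `V i`. -/
theorem reflect_not_mem_polygon (hl : lam ≠ 0) {i : Fin 4} (hp : p ∈ tangentRegion V i) :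
    reflect lam (V i) p ∉ polygon V := by
  intro hq
  rcases polygon_subset_of_mem_tangentRegion hp hq with h | h
  · have h1 : lam • (V i - p) = 0 := by simpa [reflect] using h
    have h2 : V i - p = 0 := (smul_eq_zero.1 h1).resolve_left hl
    have h3 := hp (i + 1) (by simp)
    rw [h2] at h3
    simp [cross] at h3
  · have e : cross (V i - p) (reflect lam (V i) p - p) = 0 := by
      simp only [reflect, cross, Prod.fst_sub, Prod.snd_sub, Prod.fst_add, Prod.snd_add,
        Prod.smul_fst, Prod.smul_snd, smul_eq_mul]
      ring
    exact h.ne' e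

theorem billiard_mem_regularSet (hl : lam ≠ 0) (hp : p ∈ regularSet V lam) :
    billiard V lam p ∈ regularSet V lam := by
  refine ⟨?_, fun n => ?_⟩
  · by_cases h : ∃ i, p ∈ tangentRegion V i
    · obtain ⟨i, hi⟩ := h
      rw [billiard_of_mem lam hi]
      exact reflect_not_mem_polygon hl hi
    · rw [billiard, dif_neg h]
      exact hp.1
  · rw [← Function.iterate_succ_apply]
    exact hp.2 (n + 1)

theorem iterate_mem_regularSet (hl : lam ≠ 0) (hp : p ∈ regularSet V lam) (n : ℕ) :
    (billiard V lam)^[n] p ∈ regularSet V lam := by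
  induction n with
  | zero => exact hp
  | succ n ih => rw [Function.iterate_succ_apply']; exact billiard_mem_regularSet hl ih

theorem IsPeriodicOrbit.shift (hl : lam ≠ 0) {w : ℕ → ℝ × ℝ} (hw : IsPeriodicOrbit V lam w)
    (m : ℕ) : IsPeriodicOrbit V lam fun n => w (n + m) := by
  obtain ⟨⟨n, hn, hper⟩, hnat, q, hq, hlim⟩ := hw
  refine ⟨⟨n, hn, fun i => ?_⟩, fun i => ?_, fun k => (billiard V lam)^[m] (q k),
    fun k => iterate_mem_regularSet hl (hq k) m, fun i => ?_⟩
  · rw [add_right_comm]; exact hper _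
  · rw [add_right_comm]; exact hnat _
  · simp only [← Function.iterate_add_apply]; exact hlim _

theorem add_mul_period {α : Type*} {w : ℕ → α} {n : ℕ} (hper : ∀ i, w (i + n) = w i) (i k : ℕ) :
    w (i + k * n) = w i := by
  induction k with
  | zero => simp
  | succ k ih => rw [Nat.succ_mul, ← add_assoc, hper, ih]

theorem range_shift_of_periodic {α : Type*} {w : ℕ → α} {n : ℕ} (hn : 0 < n)
    (hper : ∀ i, w (i + n) = w i) (m : ℕ) : range (fun i => w (i + m)) = range w := by
  refine subset_antisymm (by rintro _ ⟨i, rfl⟩; exact ⟨_, rfl⟩) ?_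
  rintro _ ⟨i, rfl⟩
  have hm : m ≤ i + m * n := (Nat.le_mul_of_pos_right m hn).trans (Nat.le_add_left _ _)
  exact ⟨i + m * n - m, by simp only [Nat.sub_add_cancel hm]; exact add_mul_period hper i m⟩

theorem finite_range_of_periodic {α : Type*} {w : ℕ → α} {n : ℕ} (hn : 0 < n)
    (hper : ∀ i, w (i + n) = w i) : (range w).Finite := by
  refine ((Finset.range n).finite_toSet.image w).subset ?_
  rintro _ ⟨i, rfl⟩
  refine ⟨i % n, by simpa using Nat.mod_lt i hn, ?_⟩
  conv_rhs => rw [← Nat.mod_add_div i n, mul_comm]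
  exact (add_mul_period hper _ _).symm

/-- An orbit with an eventually periodic itinerary is asymptotic to a periodic orbit. -/
theorem exists_periodicOrbit (hl0 : 0 < lam) (hl1 : lam < 1) (hp : p ∈ regularSet V lam)
    {σ : ℕ → Fin 4} (hσ : ∀ n, (billiard V lam)^[n] p ∈ tangentRegion V (σ n)) {N M : ℕ}
    (hM : 0 < M) (hper : ∀ n, N ≤ n → σ (n + M) = σ n) :
    ∃ w, IsPeriodicOrbit V lam w ∧
      Tendsto (fun n => dist ((billiard V lam)^[n] p) (w n)) atTop (𝓝 0) := by
  set q := (billiard V lam)^[N] p with hq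
  have hqn : ∀ n, (billiard V lam)^[n] q = (billiard V lam)^[n + N] p := fun n =>
    (Function.iterate_add_apply _ _ _ _).symm
  set D := dist q ((billiard V lam)^[M] q)
  have hD : ∀ n, dist ((billiard V lam)^[n] q) ((billiard V lam)^[n + M] q) = lam ^ n * D := by
    intro n
    rw [Function.iterate_add_apply]
    refine dist_iterate_iterate hl0.le fun j _ => ⟨σ (j + N), ?_, ?_⟩
    · rw [hqn]; exact hσ _
    · rw [← Function.iterate_add_apply, hqn, ← hper (j + N) (Nat.le_add_left _ _),
        add_right_comm j N M]
      exact hσ _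
  -- One period of the itinerary contracts by `lam ^ M`, so along each residue class modulo `M` the
  -- orbit is a Cauchy sequence.
  have hr : lam ^ M < 1 := pow_lt_one₀ hl0.le hl1 hM.ne'
  have hgeo : ∀ i k, dist ((billiard V lam)^[i + k * M] q) ((billiard V lam)^[i + (k + 1) * M] q)
      ≤ (lam ^ i * D) * (lam ^ M) ^ k := fun i k => by
    have := hD (i + k * M)
    rw [add_assoc, ← Nat.succ_mul] at this
    rw [this, ← pow_mul, pow_add, mul_comm k M]
    exact le_of_eq (by ring)
  have hlim : ∀ i, ∃ z, Tendsto (fun k => (billiard V lam)^[i + k * M] q) atTop (𝓝 z) := fun i =>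
    cauchySeq_tendsto_of_complete (cauchySeq_of_le_geometric _ _ hr (hgeo i))
  choose w hw using hlim
  have hwper : ∀ i, w (i + M) = w i := fun i => by
    refine tendsto_nhds_unique (hw (i + M)) ?_
    have := (hw i).comp (tendsto_add_atTop_nat 1)
    refine this.congr fun k => ?_
    simp only [Function.comp]
    congr 1
    ring
  have hσw : ∀ i k, (billiard V lam)^[i + k * M] q ∈ tangentRegion V (σ (i + N)) := fun i k => by
    have : σ (i + N) = σ (i + k * M + N) := by
      rw [add_right_comm]
      induction k with
      | zero => simp
      | succ k ih => rw [Nat.succ_mul, ← add_assoc, hper _ (by omega), ih]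
    rw [hqn, this]
    exact hσ _
  have hwnat : ∀ i, IsNaturalImage V lam (w i) (w (i + 1)) := fun i => by
    refine ⟨σ (i + N), mem_closure_of_tendsto (hw i) (Eventually.of_forall (hσw i)), ?_⟩
    refine tendsto_nhds_unique (hw (i + 1))
      ((((continuous_reflect lam (V (σ (i + N)))).tendsto _).comp (hw i)).congr fun k => ?_)
    simp only [Function.comp]
    rw [add_right_comm i 1, Function.iterate_succ_apply', billiard_of_mem lam (hσw i k)]
  have hD0 : 0 ≤ D := dist_nonneg
  have hwlim : Tendsto (fun n => dist ((billiard V lam)^[n] q) (w n)) atTop (𝓝 0) := by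
    refine squeeze_zero (fun _ => dist_nonneg) (g := fun n => lam ^ n * (D / (1 - lam ^ M)))
      (fun n => ?_) ?_
    · have := dist_le_of_le_geometric_of_tendsto₀ _ _ hr (hgeo n) (hw n)
      simp only [zero_mul, add_zero] at this
      rwa [mul_div_assoc] at this
    · simpa using (tendsto_pow_atTop_nhds_zero_of_lt_one hl0.le hl1).mul_const (D / (1 - lam ^ M))
  -- The limits `w` are indexed from time `N`. The shift by `N * (M - 1)`, congruent to `-N` modulo
  -- `M`, realigns them with the orbit of `p`.
  refine ⟨fun n => w (n + N * (M - 1)), ⟨⟨M, hM, fun i => ?_⟩, fun i => ?_,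
    fun k => (billiard V lam)^[N * (M - 1) + k * M] q, fun k => ?_, fun i => ?_⟩, ?_⟩
  · rw [add_right_comm]; exact hwper _
  · rw [add_right_comm]; exact hwnat _
  · simp only [hqn]; exact iterate_mem_regularSet hl0.ne' hp _
  · simp only [← Function.iterate_add_apply, ← add_assoc]
    exact hw _
  · rw [← tendsto_add_atTop_iff_nat N]
    refine hwlim.congr fun n => ?_
    have e : n + N + N * (M - 1) = n + N * M := by
      obtain ⟨m, rfl⟩ : ∃ m, M = m + 1 := ⟨M - 1, by omega⟩
      simp only [Nat.add_sub_cancel]; ring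
    simp only
    rw [e, add_mul_period hwper, hqn]

/-! ### Degenerate periodic orbits attract regular points -/

theorem frequently_exists_of_finite {α ι : Type*} [Finite ι] {l : Filter α} {P : ι → α → Prop}
    (h : ∃ᶠ x in l, ∃ i, P i x) : ∃ i, ∃ᶠ x in l, P i x := by
  by_contra! hc
  exact h ((eventually_all.2 hc).mono fun x hx ⟨i, hi⟩ => hx i hi)

/-- The cross product seen from a moving base point is affine in that point, because the quadratic
terms cancel. -/
theorem cross_sub_combo (u v w p : ℝ × ℝ) (s : ℝ) :
    cross (u - (w + s • (p - w))) (v - (w + s • (p - w)))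
      = (1 - s) * cross (u - w) (v - w) + s * cross (u - p) (v - p) := by
  simp only [cross, Prod.fst_sub, Prod.snd_sub, Prod.fst_add, Prod.snd_add, Prod.smul_fst,
    Prod.smul_snd, smul_eq_mul]
  ring

/-- A periodic orbit attracts some of the regular points that converge to it. -/
theorem IsPeriodicOrbit.exists_attracted (hl0 : 0 < lam) (hl1 : lam < 1) {w : ℕ → ℝ × ℝ} {n : ℕ}
    (hn : 0 < n) (hper : ∀ i, w (i + n) = w i) {q : ℕ → ℝ × ℝ}
    (hlim : ∀ i, Tendsto (fun k => (billiard V lam)^[i] (q k)) atTop (𝓝 (w i)))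
    {P : ℝ × ℝ → Prop} (hP : ∀ p, P p → ∀ n, ∃ i, (billiard V lam)^[n] p ∈ tangentRegion V i)
    (hq : ∃ᶠ k in atTop, P (q k)) :
    ∃ p, P p ∧ Tendsto (fun n => dist ((billiard V lam)^[n] p) (w n)) atTop (𝓝 0) := by
  -- The period is doubled so that `(-lam) ^ M` is positive: after `M` steps the segment towards `w
  -- 0` is mapped into itself.
  set M := 2 * n
  have hperM : w M = w 0 := by simpa using add_mul_period hper 0 2
  have h1 : ∃ᶠ k in atTop, ∃ σ : Fin M → Fin 4, P (q k) ∧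
      ∀ j : Fin M, (billiard V lam)^[j] (q k) ∈ tangentRegion V (σ j) := by
    refine hq.mono fun k hk => ?_
    choose σ hσ using hP _ hk
    exact ⟨fun j => σ j, hk, fun j => hσ j⟩
  -- By the pigeonhole principle one word of length `M` is used by infinitely many approximating
  -- orbits, so `w` satisfies its conditions in the limit with weak inequalities.
  obtain ⟨σ, hσ⟩ := frequently_exists_of_finite h1
  have hw1 : ∀ j : Fin M, ∀ i, i ≠ σ j → 0 ≤ cross (V (σ j) - w j) (V i - w j) := fun j i hi => by
    have hc : IsClosed {z : ℝ × ℝ | 0 ≤ cross (V (σ j) - z) (V i - z)} := by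
      refine isClosed_le continuous_const ?_
      unfold cross
      fun_prop
    exact hc.mem_of_frequently_of_tendsto (hσ.mono fun k hk => (hk.2 j i hi).le) (hlim j)
  have hw2 : ∀ j : Fin M, w (j + 1) = reflect lam (V (σ j)) (w j) := fun j => by
    have hc : IsClosed {z : (ℝ × ℝ) × (ℝ × ℝ) | z.2 = reflect lam (V (σ j)) z.1} :=
      isClosed_eq continuous_snd ((continuous_reflect _ _).comp continuous_fst)
    refine hc.mem_of_frequently_of_tendsto (hσ.mono fun k hk => ?_)
      ((hlim j).prodMk_nhds (hlim (j + 1)))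
    change _ = _
    simp only
    rw [Function.iterate_succ_apply', billiard_of_mem lam (hk.2 j)]
  obtain ⟨k, hPk, hk⟩ := hσ.exists
  set p := q k
  -- Weak inequalities at `w j` and strict ones at the iterate of `p` are strict at every point of
  -- the segment other than `w j`. Hence the whole half-open segment follows the same word.
  have hiter : ∀ j ≤ M, ∀ s ∈ Ioc (0 : ℝ) 1, (billiard V lam)^[j] (w 0 + s • (p - w 0))
      = w j + s • ((billiard V lam)^[j] p - w j) := by
    intro j
    induction j with
    | zero => intro _ s _; rfl
    | succ j ih =>
      intro hj s hs
      have hmem : w j + s • ((billiard V lam)^[j] p - w j) ∈ tangentRegion V (σ ⟨j, hj⟩) := by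
        intro i hi
        rw [cross_sub_combo]
        have h2 := hw1 ⟨j, hj⟩ i hi
        have h3 := hk ⟨j, hj⟩ i hi
        simp only at h2 h3
        have := mul_nonneg (sub_nonneg.2 hs.2) h2
        have := mul_pos hs.1 h3
        linarith
      rw [Function.iterate_succ_apply', ih (by omega) s hs, billiard_of_mem lam hmem,
        Function.iterate_succ_apply', billiard_of_mem lam (hk ⟨j, hj⟩), hw2 ⟨j, hj⟩]
      simp only [reflect]
      module
  have hdiff : ∀ j ≤ M, (billiard V lam)^[j] p - w j = (-lam) ^ j • (p - w 0) := by
    intro j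
    induction j with
    | zero => intro _; simp
    | succ j ih =>
      intro hj
      rw [Function.iterate_succ_apply', billiard_of_mem lam (hk ⟨j, hj⟩), hw2 ⟨j, hj⟩,
        reflect_sub_reflect]
      simp only
      rw [ih (by omega), smul_smul, pow_succ']
  have hdist : ∀ m, ∀ s ∈ Ioc (0 : ℝ) 1,
      dist ((billiard V lam)^[m] (w 0 + s • (p - w 0))) (w m) = lam ^ m * (s * ‖p - w 0‖) := by
    intro m
    induction m using Nat.strong_induction_on with
    | _ m ih =>
      intro s hs
      rcases le_or_gt m M with hm | hm
      · rw [hiter m hm s hs, hdiff m hm, dist_eq_norm, add_sub_cancel_left, norm_smul, norm_smul,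
          norm_pow, norm_neg, Real.norm_of_nonneg hl0.le, Real.norm_of_nonneg hs.1.le]
        ring
      · obtain ⟨r, rfl⟩ := Nat.exists_eq_add_of_lt hm
        have hs' : s * lam ^ M ∈ Ioc (0 : ℝ) 1 :=
          ⟨mul_pos hs.1 (pow_pos hl0 M), mul_le_one₀ hs.2 (pow_nonneg hl0.le M)
            (pow_le_one₀ hl0.le hl1.le)⟩
        have e1 : (billiard V lam)^[M] (w 0 + s • (p - w 0))
            = w 0 + (s * lam ^ M) • (p - w 0) := by
          rw [hiter M le_rfl s hs, hdiff M le_rfl, hperM, smul_smul, Even.neg_pow (even_two_mul n)]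
        have e2 : w (M + r + 1) = w (r + 1) := by
          rw [add_assoc, add_comm]; exact add_mul_period hper _ 2
        have hM0 : 0 < M := by positivity
        rw [e2, add_assoc, add_comm, Function.iterate_add_apply, e1,
          ih (r + 1) (by omega) _ hs', pow_add]
        ring
  refine ⟨p, hPk, ?_⟩
  have := (tendsto_pow_atTop_nhds_zero_of_lt_one hl0.le hl1).mul_const (1 * ‖p - w 0‖)
  rw [zero_mul] at this
  refine this.congr fun m => ?_
  have h4 := hdist m 1 ⟨zero_lt_one, le_rfl⟩
  rw [one_smul, add_sub_cancel] at h4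
  exact h4.symm

end General

/-! ### Regular orbits in the strip -/

section Core

variable {a b lam : ℝ} {p p' : ℝ × ℝ}

/-- The regular points of the strip. -/
def core (a b lam : ℝ) : Set (ℝ × ℝ) := strip a lam ∩ regularSet (quad a b) lam

/-- Whether the next return to the strip takes four steps. -/
noncomputable def isShort (a lam : ℝ) (p : ℝ × ℝ) : Bool := decide (param a lam p < cut a lam)

/-- The time of the `n`-th return to the strip. -/
noncomputable def visitTime (a b lam : ℝ) (p : ℝ × ℝ) : ℕ → ℕ
  | 0 => 0
  | n + 1 => visitTime a b lam p n +
      returnTime (isShort a lam ((billiard (quad a b) lam)^[visitTime a b lam p n] p))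

/-- The `n`-th return to the strip. -/
noncomputable def visit (a b lam : ℝ) (p : ℝ × ℝ) (n : ℕ) : ℝ × ℝ :=
  (billiard (quad a b) lam)^[visitTime a b lam p n] p

theorem visit_zero : visit a b lam p 0 = p := rfl

theorem visitTime_succ (n : ℕ) : visitTime a b lam p (n + 1)
    = visitTime a b lam p n + returnTime (isShort a lam (visit a b lam p n)) := rfl

theorem visit_succ (n : ℕ) : visit a b lam p (n + 1) = (billiard (quad a b) lam)^[returnTime
    (isShort a lam (visit a b lam p n))] (visit a b lam p n) := by
  rw [visit, visitTime_succ, add_comm, Function.iterate_add_apply]; rfl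

theorem four_le_returnTime (s : Bool) : 4 ≤ returnTime s := by cases s <;> simp [returnTime]

theorem returnTime_le_six (s : Bool) : returnTime s ≤ 6 := by cases s <;> simp [returnTime]

theorem visitTime_strictMono : StrictMono (visitTime a b lam p) :=
  strictMono_nat_of_lt_succ fun n => by
    rw [visitTime_succ]; linarith [four_le_returnTime (isShort a lam (visit a b lam p n))]

theorem four_mul_le_visitTime (n : ℕ) : 4 * n ≤ visitTime a b lam p n := by
  induction n with
  | zero => simp
  | succ n ih =>
    rw [visitTime_succ]; linarith [four_le_returnTime (isShort a lam (visit a b lam p n))]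

theorem visitTime_add_visit_add (m n : ℕ) :
    visitTime a b lam p (m + n)
      = visitTime a b lam p m + visitTime a b lam (visit a b lam p m) n ∧
    visit a b lam p (m + n) = visit a b lam (visit a b lam p m) n := by
  induction n with
  | zero => exact ⟨rfl, rfl⟩
  | succ n ih =>
    refine ⟨?_, ?_⟩
    · rw [← add_assoc, visitTime_succ, visitTime_succ, ih.1, ih.2, add_assoc]
    · rw [← add_assoc, visit_succ, visit_succ, ih.2]

/-- Below the cut the third image is singular, which regularity forbids. -/
theorem param_ne_cut (h : Params a b lam) (hp : p ∈ core a b lam) :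
    param a lam p ≠ cut a lam := fun hc =>
  hp.2.2 3 (iterate_three_mem_singularSet h hp.1 hc).1

theorem visit_mem_core (h : Params a b lam) (hp : p ∈ core a b lam) (n : ℕ) :
    visit a b lam p n ∈ core a b lam := by
  induction n with
  | zero => exact hp
  | succ n ih =>
    rw [visit_succ]
    exact ⟨(strip_return h ih.1 (param_ne_cut h ih) rfl).2.2.1,
      iterate_mem_regularSet h.lam_pos.ne' ih.2 _⟩

theorem param_visit (h : Params a b lam) (hp : p ∈ core a b lam) (n : ℕ) :
    param a lam (visit a b lam p n) = unitPart ((circleLift h)^[n] (param a lam p)) := by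
  induction n with
  | zero => exact (unitPart_of_mem (Ioo_subset_Ioc_self (param_mem_Ioo h hp.1))).symm
  | succ n ih =>
    have hn := visit_mem_core h hp n
    rw [visit_succ, isShort, (strip_return h hn.1 (param_ne_cut h hn) rfl).2.2.2.1, ih,
      Function.iterate_succ_apply', circleLift_apply, (unitPart_liftFun h _).1]

theorem ceil_increment (h : Params a b lam) (hp : p ∈ core a b lam) (n : ℕ) :
    ⌈(circleLift h)^[n + 1] (param a lam p)⌉ - ⌈(circleLift h)^[n] (param a lam p)⌉
      = if isShort a lam (visit a b lam p n) then 0 else 1 := by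
  have hn := param_ne_cut h (visit_mem_core h hp n)
  rw [Function.iterate_succ_apply', circleLift_apply, (unitPart_liftFun h _).2, add_sub_cancel_left,
    ← param_visit h hp, isShort]
  by_cases hlt : param a lam (visit a b lam p n) < cut a lam
  · rw [if_pos hlt.le, if_pos (by simpa using hlt)]
  · rw [if_neg fun hle => hlt (lt_of_le_of_ne hle hn), if_neg (by simpa using hlt)]

theorem isShort_eq_of_increment (h : Params a b lam) (hp : p ∈ core a b lam)
    (hp' : p' ∈ core a b lam) {n n' : ℕ}
    (he : ⌈(circleLift h)^[n + 1] (param a lam p)⌉ - ⌈(circleLift h)^[n] (param a lam p)⌉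
      = ⌈(circleLift h)^[n' + 1] (param a lam p')⌉ - ⌈(circleLift h)^[n'] (param a lam p')⌉) :
    isShort a lam (visit a b lam p n) = isShort a lam (visit a b lam p' n') := by
  rw [ceil_increment h hp, ceil_increment h hp'] at he
  cases h1 : isShort a lam (visit a b lam p n) <;> cases h2 : isShort a lam (visit a b lam p' n')
    <;> simp_all

theorem snd_visit (h : Params a b lam) (hp : p ∈ core a b lam) (n : ℕ) :
    1 - (visit a b lam p n).2 ≤ (lam ^ 4) ^ n := by
  induction n with
  | zero => rw [visit_zero]; simpa using hp.1.2.1.le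
  | succ n ih =>
    have hn := visit_mem_core h hp n
    rw [visit_succ, isShort, pow_succ']
    exact (strip_return h hn.1 (param_ne_cut h hn) rfl).2.2.2.2.trans
      (mul_le_mul_of_nonneg_left ih (pow_nonneg h.lam_pos.le 4))

theorem tendsto_snd_visit (h : Params a b lam) (hp : p ∈ core a b lam) :
    Tendsto (fun n => (visit a b lam p n).2) atTop (𝓝 1) := by
  have h1 : Tendsto (fun n : ℕ => (lam ^ 4) ^ n) atTop (𝓝 0) :=
    tendsto_pow_atTop_nhds_zero_of_lt_one (pow_nonneg h.lam_pos.le 4)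
      (pow_lt_one₀ h.lam_pos.le h.lam_lt_one (by norm_num))
  have h2 : Tendsto (fun n : ℕ => 1 - (lam ^ 4) ^ n) atTop (𝓝 1) := by
    simpa using h1.const_sub 1
  exact tendsto_of_tendsto_of_tendsto_of_le_of_le h2 tendsto_const_nhds
    (fun n => by have := snd_visit h hp n; simp only; linarith)
    (fun n => (visit_mem_core h hp n).1.2.2.1.le)

theorem visitTime_congr {R : ℕ}
    (hs : ∀ n < R, isShort a lam (visit a b lam p n) = isShort a lam (visit a b lam p' n)) :
    visitTime a b lam p R = visitTime a b lam p' R := by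
  induction R with
  | zero => rfl
  | succ R ih =>
    rw [visitTime_succ, visitTime_succ, ih fun n hn => hs n (by omega), hs R (by omega)]

/-- Points of the strip with the same sequence of return types use the same branches. -/
theorem exists_common_branch (h : Params a b lam) (hp : p ∈ core a b lam) (hp' : p' ∈ core a b lam)
    {R : ℕ} (hs : ∀ n < R, isShort a lam (visit a b lam p n) = isShort a lam (visit a b lam p' n))
    {m : ℕ} (hm : m < visitTime a b lam p R) :
    ∃ i, (billiard (quad a b) lam)^[m] p ∈ branchDomain a b i ∧
      (billiard (quad a b) lam)^[m] p' ∈ branchDomain a b i := by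
  induction R with
  | zero => exact absurd hm (Nat.not_lt_zero _)
  | succ R ih =>
    have hs' := fun n (hn : n < R) => hs n (by omega)
    rcases lt_or_ge m (visitTime a b lam p R) with hlt | hge
    · exact ih hs' hlt
    · obtain ⟨j, rfl⟩ := Nat.exists_eq_add_of_le hge
      rw [visitTime_succ] at hm
      have hj : j < returnTime (isShort a lam (visit a b lam p R)) := by omega
      have hn := visit_mem_core h hp R
      have hn' := visit_mem_core h hp' R
      refine ⟨returnWord (isShort a lam (visit a b lam p R)) j, ?_, ?_⟩
      · rw [add_comm, Function.iterate_add_apply]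
        exact (strip_return h hn.1 (param_ne_cut h hn) rfl).1 j hj
      · rw [visitTime_congr hs', add_comm, Function.iterate_add_apply, hs R (by omega)]
        rw [hs R (by omega)] at hj
        exact (strip_return h hn'.1 (param_ne_cut h hn') rfl).1 j hj

theorem exists_branch (h : Params a b lam) (hp : p ∈ core a b lam) (m : ℕ) :
    ∃ i, (billiard (quad a b) lam)^[m] p ∈ branchDomain a b i := by
  obtain ⟨i, hi, -⟩ := exists_common_branch h hp hp (R := m + 1) (fun _ _ => rfl) (m := m)
    (by have := four_mul_le_visitTime (a := a) (b := b) (lam := lam) (p := p) (m + 1); omega)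
  exact ⟨i, hi⟩

theorem exists_common_branch_of_forall (h : Params a b lam) (hp : p ∈ core a b lam)
    (hp' : p' ∈ core a b lam)
    (hs : ∀ n, isShort a lam (visit a b lam p n) = isShort a lam (visit a b lam p' n)) (m : ℕ) :
    ∃ i, (billiard (quad a b) lam)^[m] p ∈ branchDomain a b i ∧
      (billiard (quad a b) lam)^[m] p' ∈ branchDomain a b i :=
  exists_common_branch h hp hp' (R := m + 1) (fun n _ => hs n)
    (by have := four_mul_le_visitTime (a := a) (b := b) (lam := lam) (p := p) (m + 1); omega)

theorem exists_le_inducedMap (h : Params a b lam) :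
    ∃ η > 0, ∀ x ∈ Ioc (0 : ℝ) 1, η ≤ inducedMap a lam x := by
  have l0 := h.lam_pos
  have p4 : lam ^ 4 < 1 := pow_lt_one₀ l0.le h.lam_lt_one (by norm_num)
  have h1 : lam * (1 + lam) / lenL a lam < 1 :=
    (div_lt_one (lenL_pos h)).2 (mul_one_add_lt_lenL h)
  refine ⟨min (1 - lam ^ 4) (1 - lam * (1 + lam) / lenL a lam),
    lt_min (by linarith) (by linarith), fun x hx => ?_⟩
  rcases le_or_gt x (cut a lam) with hxc | hxc
  · refine (min_le_left _ _).trans ?_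
    rw [inducedMap_of_le hxc]
    nlinarith [cut_le_one h, hx.1, pow_pos l0 4]
  · refine (min_le_right _ _).trans ?_
    rw [inducedMap_of_lt h hxc]
    nlinarith [pow_pos l0 6]

/-- For small `ε`, all late returns to the strip are in the lower rectangle. -/
theorem eventually_visit_mem_rectTwo (h : Params a b lam) : ∀ᶠ ε in 𝓝[>] (0 : ℝ),
    ∀ p ∈ core a b lam, ∀ᶠ n in atTop, visit a b lam p n ∈ rectTwo a lam ε := by
  obtain ⟨η, hη, hle⟩ := exists_le_inducedMap h
  have hl := lenL_pos h
  filter_upwards [eventually_pos, eventually_lt_const (mul_pos hη hl)] with ε h0 h1 p hp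
  have h2 : ∀ᶠ n in atTop, 1 - ε ^ 2 < (visit a b lam p n).2 :=
    (tendsto_snd_visit h hp).eventually (lt_mem_nhds (by nlinarith))
  filter_upwards [h2, eventually_gt_atTop 0] with n hn hn0
  -- From the first return on, the parameter is a value of the induced map, so it is at least `η`
  -- and the point keeps a fixed distance from E.
  obtain ⟨m, rfl⟩ := Nat.exists_eq_succ_of_ne_zero hn0.ne'
  have hm := visit_mem_core h hp m
  have hm' := visit_mem_core h hp (m + 1)
  refine ⟨⟨?_, hm'.1.1.le⟩, hn.le, hm'.1.2.2.1.le⟩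
  have h3 := hle _ (Ioo_subset_Ioc_self (param_mem_Ioo h hm.1))
  rw [← (strip_return h hm.1 (param_ne_cut h hm) rfl).2.2.2.1] at h3
  rw [fst_eq_of_param h (visit a b lam p (m + 1)), visit_succ, isShort]
  nlinarith

/-- The regular orbits that enter the strip and use only genuine branches. -/
def absorbed (a b lam : ℝ) : Set (ℝ × ℝ) :=
  {p | p ∈ regularSet (quad a b) lam ∧
    (∀ n, ∃ i, (billiard (quad a b) lam)^[n] p ∈ tangentRegion (quad a b) i) ∧
    ∃ m, (billiard (quad a b) lam)^[m] p ∈ core a b lam}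

theorem absorbed_of_core (h : Params a b lam) (hp : p ∈ core a b lam) : p ∈ absorbed a b lam :=
  ⟨hp.2, fun n => (exists_branch h hp n).imp fun _ hi => hi.1, 0, hp⟩

theorem absorbed_of_billiard (hp : p ∈ regularSet (quad a b) lam) {i : Fin 4}
    (hi : p ∈ tangentRegion (quad a b) i) (hp' : billiard (quad a b) lam p ∈ absorbed a b lam) :
    p ∈ absorbed a b lam := by
  refine ⟨hp, fun n => ?_, ?_⟩
  · cases n with
    | zero => exact ⟨i, hi⟩
    | succ n => exact hp'.2.1 n
  · obtain ⟨m, hm⟩ := hp'.2.2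
    exact ⟨m + 1, hm⟩

/-- After the reflections in D and C a point of the open segment EA is on the line `y = 1` to the
right of B, hence on the ray AB. -/
theorem segment_not_regular (h : Params a b lam) {x : ℝ} (hx : x < 0) (hx' : -x < lenL a lam) :
    ((x, 1) : ℝ × ℝ) ∉ regularSet (quad a b) lam := by
  intro hp
  have l0 := h.lam_pos
  have e := h.b_eq
  have hl : lam ^ 2 * -x < lam + 1 - a := by
    rw [← lam_sq_mul_lenL h]; exact mul_lt_mul_of_pos_left hx' (pow_pos l0 2)
  have r1 : ((x, 1) : ℝ × ℝ) ∈ branchDomain a b 3 :=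
    branchDomain_three h hx (by simp only; nlinarith [h.b_pos])
  have r2 : (-lam * x, -lam * 1) ∈ branchDomain a b 2 := by
    refine branchDomain_two h ?_ ?_
    · simp only
      nlinarith [mul_pos h.b_pos (mul_pos l0 (neg_pos.2 hx))]
    · simp only [e]; linarith
  have e1 : billiard (quad a b) lam (x, 1) = (-lam * x, -lam * 1) := by
    rw [billiard_of_branchDomain r1, reflect_quad_three]
  have e2 : billiard (quad a b) lam (-lam * x, -lam * 1) = (1 + lam + lam ^ 2 * x, 1) := by
    rw [billiard_of_branchDomain r2, reflect_quad_two h]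
    ext <;> simp only <;> ring
  refine hp.2 2 ?_
  rw [iterate_succ_eq (n := 1) (show (billiard (quad a b) lam)^[1] (x, 1) = _ from e1) e2]
  refine mem_iUnion.2 ⟨0, (1 + lam + lam ^ 2 * x) / a, ?_, ?_⟩
  · exact div_nonneg (by linarith [h.a_pos]) h.a_pos.le
  · have := h.a_pos.ne'
    ext <;> simp [quad]
    field_simp

/-- For small `ε`, all regular points close to one of the two rectangles are absorbed. -/
theorem eventually_absorbed (h : Params a b lam) : ∀ᶠ ε in 𝓝[>] (0 : ℝ),
    ∀ z ∈ rectOne a lam ε ∪ rectTwo a lam ε, ∀ᶠ p in 𝓝 z,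
      p ∈ regularSet (quad a b) lam → p ∈ absorbed a b lam := by
  have l0 := h.lam_pos
  have l1 := h.lam_lt_one
  have a0 := h.a_pos
  have hl := lenL_pos h
  have el := lam_sq_mul_lenL h
  have c1 : 0 < (1 - a) * lam := mul_pos (by linarith [h.a_lt_one]) l0
  have c2 : 0 < lam + 1 - a := by linarith [h.a_lt_one]
  filter_upwards [eventually_pos, eventually_lt_const (show (0 : ℝ) < 1 / 4 by norm_num),
    eventually_lt_const (half_pos h.a_pos),
    eventually_lt_const (div_pos (sub_pos.2 h.range) c1),
    eventually_lt_const (div_pos (pow_pos l0 2) (mul_pos four_pos c1)),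
    eventually_lt_const (div_pos c2 (show (0 : ℝ) < 2 by norm_num))]
    with ε h0 h1 h2 h3 h4 h5 z hz
  rw [lt_div_iff₀ c1] at h3
  rw [lt_div_iff₀ (mul_pos four_pos c1)] at h4
  have hε2 : 4 * ε ^ 2 ≤ ε := by nlinarith
  have hz' : -lenL a lam + ε ≤ z.1 ∧ z.1 ≤ 0 ∧ 1 - ε ^ 2 ≤ z.2 ∧ z.2 ≤ 1 + ε ^ 2 := by
    have := sq_nonneg ε
    rcases hz with hz | hz
    · exact ⟨hz.1.1, hz.1.2, by linarith [hz.2.1], hz.2.2⟩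
    · exact ⟨hz.1.1, hz.1.2, hz.2.1, by linarith [hz.2.2]⟩
  have hε20 : 0 < ε ^ 2 := by positivity
  have n1 : ∀ᶠ p : ℝ × ℝ in 𝓝 z, -lenL a lam + ε / 2 < p.1 :=
    continuous_fst.continuousAt.eventually (lt_mem_nhds (by linarith [hz'.1]))
  have n2 : ∀ᶠ p : ℝ × ℝ in 𝓝 z, p.1 < ε :=
    continuous_fst.continuousAt.eventually (gt_mem_nhds (by linarith [hz'.2.1]))
  have n3 : ∀ᶠ p : ℝ × ℝ in 𝓝 z, 1 - 2 * ε ^ 2 < p.2 :=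
    continuous_snd.continuousAt.eventually (lt_mem_nhds (by linarith [hz'.2.2.1]))
  have n4 : ∀ᶠ p : ℝ × ℝ in 𝓝 z, p.2 < 1 + 2 * ε ^ 2 :=
    continuous_snd.continuousAt.eventually (gt_mem_nhds (by linarith [hz'.2.2.2]))
  filter_upwards [n1, n2, n3, n4] with p n1 n2 n3 n4 hp
  obtain ⟨x, y⟩ := p
  simp only at n1 n2 n3 n4
  have hT : ∀ {q}, q ∈ regularSet (quad a b) lam → billiard (quad a b) lam q ∈
    regularSet (quad a b) lam := fun hq => billiard_mem_regularSet l0.ne' hq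
  -- A neighbourhood of a rectangle may cross the edge DA and its extension. Left of it a regular
  -- point is in the strip, or above EA and three steps away; right of it, it is above A and one
  -- step away, every other point being singular, in the polygon or on EA.
  rcases lt_trichotomy x 0 with hx | rfl | hx
  · rcases lt_trichotomy y 1 with hy | rfl | hy
    · refine absorbed_of_core h ⟨⟨hx, ?_, hy, ?_, ?_⟩, hp⟩
      · simp only; linarith
      · have e1 : (1 - y) * ((1 - a) * lam) ≤ ε / 2 * ε * ((1 - a) * lam) * 4 := by
          nlinarith
        have e2 : ε * (ε * (4 * ((1 - a) * lam))) ≤ ε * lam ^ 2 :=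
          mul_le_mul_of_nonneg_left h4.le h0.le
        have e3 : lam ^ 2 * -x < lam ^ 2 * (lenL a lam - ε / 2) :=
          mul_lt_mul_of_pos_left (by linarith) (pow_pos l0 2)
        simp only
        linarith
      · simp only
        nlinarith
    · exact absurd hp (segment_not_regular h hx (by linarith))
    · obtain ⟨d1, d2, d3, d4, d5, d6⟩ := upper_start h hx (by linarith) hy
      have s1 := hT hp
      have s2 := hT s1
      have s3 := hT s2
      refine absorbed_of_billiard hp d1.1 ?_
      refine absorbed_of_billiard s1 (i := 2) (by rw [d2]; exact d3.1) ?_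
      refine absorbed_of_billiard s2 (i := 0) (by rw [d2, d4]; exact d5.1) ?_
      refine absorbed_of_core h ⟨?_, s3⟩
      rw [d2, d4, d6]
      refine upper_end_mem_strip h hx (by linarith) hy (by linarith) ?_
      nlinarith
  · rcases le_or_gt y 1 with hy | hy
    · exact absurd (left_edge_subset_polygon (by linarith) hy) hp.1
    · have hS : ((0, y) : ℝ × ℝ) ∈ singularSet (quad a b) :=
        mem_iUnion.2 ⟨3, y, by linarith, by ext <;> simp [quad]⟩
      exact absurd hS (hp.2 0)
  · rcases le_or_gt y 1 with hy | hy
    · refine absurd ?_ hp.1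
      have hA : ((0, 1) : ℝ × ℝ) ∈ polygon (quad a b) := subset_convexHull ℝ _ ⟨0, rfl⟩
      have hB : ((a, 1) : ℝ × ℝ) ∈ polygon (quad a b) := subset_convexHull ℝ _ ⟨1, rfl⟩
      have hy0 : 0 < y := by linarith
      have hxa : x / (a * y) ≤ 1 := by
        rw [div_le_one (mul_pos a0 hy0)]; nlinarith
      -- The ray from D through the point meets the edge AB here, and the point is between the two.
      have hQ : ((x / y, 1) : ℝ × ℝ) ∈ polygon (quad a b) := by
        have := convex_convexHull ℝ (range (quad a b)) hA hB (sub_nonneg.2 hxa)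
          (div_nonneg hx.le (mul_pos a0 hy0).le) (by ring)
        have e : (1 - x / (a * y)) • ((0, 1) : ℝ × ℝ) + (x / (a * y)) • ((a, 1) : ℝ × ℝ)
            = (x / y, 1) := by
          ext
          · simp; field_simp
          · simp
        rwa [e] at this
      have hD : ((0, 0) : ℝ × ℝ) ∈ polygon (quad a b) := subset_convexHull ℝ _ ⟨3, rfl⟩
      have := convex_convexHull ℝ (range (quad a b)) hQ hD hy0.le (sub_nonneg.2 hy) (by ring)
      have e : y • ((x / y, 1) : ℝ × ℝ) + (1 - y) • ((0, 0) : ℝ × ℝ) = (x, y) := by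
        ext
        · simp; field_simp
        · simp
      rwa [e] at this
    · have r := branchDomain_zero (p := (x, y)) h hx hy
      refine absorbed_of_billiard hp r.1 (absorbed_of_core h ⟨?_, hT hp⟩)
      rw [billiard_of_branchDomain r, reflect_quad_zero]
      have e1 : (y - 1) * ((1 - a) * lam) ≤ ε * ((1 - a) * lam) := by nlinarith
      have e2 : lam * ((y - 1) * ((1 - a) * lam)) ≤ 1 * ((y - 1) * ((1 - a) * lam)) :=
        mul_le_mul_of_nonneg_right l1.le (mul_nonneg (by linarith) c1.le)
      refine ⟨?_, ?_, ?_, ?_, ?_⟩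
      · simp only; nlinarith
      · simp only; nlinarith
      · simp only; nlinarith
      · simp only
        have p3 : lam ^ 3 ≤ 1 := pow_le_one₀ l0.le l1.le
        have e4 : lam ^ 3 * x ≤ 1 * x := mul_le_mul_of_nonneg_right p3 hx.le
        have e5 : (1 - a) * lam ≤ 1 := by nlinarith
        have e6 : ε * ((1 - a) * lam) ≤ ε * 1 := mul_le_mul_of_nonneg_left e5 h0.le
        linarith
      · simp only
        linarith

end Core

/-! ### Rational rotation number -/

section RationalCase

variable {a b lam : ℝ} {p p' : ℝ × ℝ}

/-- The visits numbered `N` and `N + q` have the same sequence of future return types, so the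
elapsed time between them is a period of the branch sequence. -/
theorem core_exists_periodic_branches (h : Params a b lam) {r : ℤ} {q : ℕ} (hq : 0 < q)
    (hτ : (circleLift h).translationNumber = r / q) (hp : p ∈ core a b lam) :
    ∃ N M : ℕ, 0 < M ∧ ∀ m, ∃ i, (billiard (quad a b) lam)^[m + N] p ∈ tangentRegion (quad a b) i ∧
      (billiard (quad a b) lam)^[m + N + M] p ∈ tangentRegion (quad a b) i := by
  obtain ⟨N, hN⟩ := exists_ceil_iterate_add hq hτ (param a lam p)
  have hlt : visitTime a b lam p N < visitTime a b lam p (N + q) := visitTime_strictMono (by omega)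
  obtain ⟨M, hM⟩ := Nat.exists_eq_add_of_lt hlt
  have hs : ∀ n, isShort a lam (visit a b lam (visit a b lam p N) n)
      = isShort a lam (visit a b lam (visit a b lam p (N + q)) n) := fun n => by
    rw [← (visitTime_add_visit_add N n).2, ← (visitTime_add_visit_add (N + q) n).2]
    refine isShort_eq_of_increment h hp hp ?_
    have h1 := hN (N + n) (by omega)
    have h2 := hN (N + n + 1) (by omega)
    rw [show N + q + n = N + n + q by omega, show N + n + q + 1 = N + n + 1 + q by omega, h1, h2]
    ring
  refine ⟨visitTime a b lam p N, M + 1, Nat.succ_pos M, fun m => ?_⟩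
  obtain ⟨i, hi, hi'⟩ := exists_common_branch_of_forall h (visit_mem_core h hp N)
    (visit_mem_core h hp (N + q)) hs m
  refine ⟨i, ?_, ?_⟩
  · rw [Function.iterate_add_apply]; exact hi.1
  · have e : m + visitTime a b lam p N + (M + 1) = m + visitTime a b lam p (N + q) := by omega
    rw [e, Function.iterate_add_apply]; exact hi'.1

theorem absorbed_exists_periodicOrbit (h : Params a b lam) {r : ℤ} {q : ℕ} (hq : 0 < q)
    (hτ : (circleLift h).translationNumber = r / q) (hp : p ∈ absorbed a b lam) :
    ∃ w, IsPeriodicOrbit (quad a b) lam w ∧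
      Tendsto (fun n => dist ((billiard (quad a b) lam)^[n] p) (w n)) atTop (𝓝 0) := by
  obtain ⟨hreg, hbr, m, hm⟩ := hp
  choose σ hσ using hbr
  obtain ⟨N, M, hM, hNM⟩ := core_exists_periodic_branches h hq hτ hm
  refine exists_periodicOrbit h.lam_pos h.lam_lt_one hreg hσ (N := N + m) hM fun n hn => ?_
  obtain ⟨k, rfl⟩ := Nat.exists_eq_add_of_le hn
  obtain ⟨i, hi, hi'⟩ := hNM k
  rw [← Function.iterate_add_apply] at hi hi'
  have e1 : σ (N + m + k) = i := tangentRegion_unique (hσ _) (by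
    rw [show N + m + k = k + N + m by omega]; exact hi)
  have e2 : σ (N + m + k + M) = i := tangentRegion_unique (hσ _) (by
    rw [show N + m + k + M = k + N + M + m by omega]; exact hi')
  rw [e1, e2]

/-- After suitable shifts the two orbits have equal return types, hence use the same branches, and
every step multiplies their distance by `lam`. -/
theorem absorbed_synchronize (h : Params a b lam) {r : ℤ} {q : ℕ} (hq : 0 < q)
    (hrq : IsCoprime r (q : ℤ)) (hτ : (circleLift h).translationNumber = r / q)
    (hp : p ∈ absorbed a b lam) (hp' : p' ∈ absorbed a b lam) :
    ∃ N N' : ℕ, Tendsto (fun n => dist ((billiard (quad a b) lam)^[n + N] p)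
      ((billiard (quad a b) lam)^[n + N'] p')) atTop (𝓝 0) := by
  obtain ⟨-, -, m, hm⟩ := hp
  obtain ⟨-, -, m', hm'⟩ := hp'
  obtain ⟨N, N', hN⟩ := exists_ceil_increments_eq hq hrq hτ
    (param a lam ((billiard (quad a b) lam)^[m] p))
    (param a lam ((billiard (quad a b) lam)^[m'] p'))
  set c := (billiard (quad a b) lam)^[m] p
  set c' := (billiard (quad a b) lam)^[m'] p'
  have key := exists_common_branch_of_forall h (visit_mem_core h hm N) (visit_mem_core h hm' N')
    fun n => by
      rw [← (visitTime_add_visit_add N n).2, ← (visitTime_add_visit_add N' n).2]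
      exact isShort_eq_of_increment h hm hm' (hN n)
  refine ⟨visitTime a b lam c N + m, visitTime a b lam c' N' + m', ?_⟩
  have := (tendsto_pow_atTop_nhds_zero_of_lt_one h.lam_pos.le h.lam_lt_one).mul_const
    (dist (visit a b lam c N) (visit a b lam c' N'))
  rw [zero_mul] at this
  refine this.congr fun n => ?_
  rw [← dist_iterate_iterate h.lam_pos.le fun j _ => (key j).imp fun _ hi => ⟨hi.1.1, hi.2.1⟩]
  simp only [visit, c, c', ← Function.iterate_add_apply]

/-- Along multiples of the common period `n * n'` the distance is constant, so it equals its limit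
zero. -/
theorem eq_of_periodic_of_tendsto_dist {w w' : ℕ → ℝ × ℝ} {n n' : ℕ} (hn : 0 < n)
    (hper : ∀ i, w (i + n) = w i) (hn' : 0 < n') (hper' : ∀ i, w' (i + n') = w' i)
    (hlim : Tendsto (fun i => dist (w i) (w' i)) atTop (𝓝 0)) : w = w' := by
  funext i
  have h1 : Tendsto (fun k : ℕ => i + k * (n * n')) atTop atTop :=
    tendsto_atTop_mono (fun k => (Nat.le_mul_of_pos_right k (Nat.mul_pos hn hn')).trans
      (Nat.le_add_left _ _)) tendsto_id
  have h2 := hlim.comp h1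
  have h3 : (fun k : ℕ => dist (w (i + k * (n * n'))) (w' (i + k * (n * n'))))
      = fun _ => dist (w i) (w' i) := by
    funext k
    rw [show k * (n * n') = (k * n') * n by ring, add_mul_period hper,
      show (k * n') * n = (k * n) * n' by ring, add_mul_period hper']
  exact dist_eq_zero.1 (tendsto_nhds_unique tendsto_const_nhds (h2.congr (congrFun h3)))

theorem rational_case (h : Params a b lam)
    (hρ : ¬ Irrational (circleLift h).translationNumber) :
    ∀ᶠ ε in 𝓝[>] (0 : ℝ),
      {O : Set (ℝ × ℝ) | ∃ w, IsPeriodicOrbit (quad a b) lam w ∧ O = range w ∧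
          (O ∩ (rectOne a lam ε ∪ rectTwo a lam ε)).Nonempty}.encard ≤ 2 ∧
      ∀ p ∈ regularSet (quad a b) lam ∩ (rectOne a lam ε ∪ rectTwo a lam ε),
        ∃ w, IsPeriodicOrbit (quad a b) lam w ∧
          (range w ∩ (rectOne a lam ε ∪ rectTwo a lam ε)).Nonempty ∧
          Tendsto (fun n : ℕ => dist ((billiard (quad a b) lam)^[n] p) (w n)) atTop (𝓝 0) := by
  rw [Irrational, not_not] at hρ
  obtain ⟨r, hr⟩ := hρ
  have hq := r.den_pos
  have hrq : IsCoprime r.num (r.den : ℤ) := by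
    rw [Int.isCoprime_iff_gcd_eq_one]; exact r.reduced
  have hτ : (circleLift h).translationNumber = r.num / r.den := by
    rw [← hr]; exact (Rat.cast_def r)
  filter_upwards [eventually_absorbed h, eventually_visit_mem_rectTwo h] with ε hab hvis
  have habs : ∀ p ∈ regularSet (quad a b) lam ∩ (rectOne a lam ε ∪ rectTwo a lam ε),
      p ∈ absorbed a b lam := fun p hp => (hab p hp.2).self_of_nhds hp.1
  refine ⟨?_, fun p hp => ?_⟩
  · refine le_trans (encard_le_one_iff.2 ?_) one_le_two
    have attracted : ∀ w, IsPeriodicOrbit (quad a b) lam w →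
        (range w ∩ (rectOne a lam ε ∪ rectTwo a lam ε)).Nonempty →
        ∃ m, ∃ p ∈ absorbed a b lam,
          Tendsto (fun n => dist ((billiard (quad a b) lam)^[n] p) (w (n + m))) atTop (𝓝 0) := by
      rintro w hw ⟨_, ⟨m, rfl⟩, hm⟩
      obtain ⟨⟨n, hn, hper⟩, -, q, hqreg, hqlim⟩ := hw.shift h.lam_pos.ne' m
      refine ⟨m, IsPeriodicOrbit.exists_attracted h.lam_pos h.lam_lt_one hn hper hqlim
        (P := fun p => p ∈ absorbed a b lam) (fun p hp => hp.2.1) ?_⟩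
      have h0 := hqlim 0
      simp only [Function.iterate_zero, id, zero_add] at h0
      exact ((h0.eventually (hab _ hm)).mono fun k hk => hk (hqreg k)).frequently
    rintro _ _ ⟨w, hw, rfl, hne⟩ ⟨w', hw', rfl, hne'⟩
    obtain ⟨m, p, hp, hlim⟩ := attracted w hw hne
    obtain ⟨m', p', hp', hlim'⟩ := attracted w' hw' hne'
    obtain ⟨N, N', hN⟩ := absorbed_synchronize h hq hrq hτ hp hp'
    obtain ⟨n, hn, hper⟩ := hw.periodic
    obtain ⟨n', hn', hper'⟩ := hw'.periodic
    have e1 := range_shift_of_periodic hn hper (N + m)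
    have e2 := range_shift_of_periodic hn' hper' (N' + m')
    rw [← e1, ← e2]
    congr 1
    refine eq_of_periodic_of_tendsto_dist hn (fun i => by rw [add_right_comm]; exact hper _) hn'
      (fun i => by rw [add_right_comm]; exact hper' _) ?_
    have l1 := hlim.comp (tendsto_add_atTop_nat N)
    have l2 := hlim'.comp (tendsto_add_atTop_nat N')
    have l3 := (l1.add hN).add l2
    simp only [add_zero] at l3
    refine squeeze_zero (fun _ => dist_nonneg) (fun i => ?_) l3
    simp only [Function.comp]
    rw [← add_assoc, ← add_assoc, dist_comm ((billiard (quad a b) lam)^[i + N] p) (w _)]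
    exact dist_triangle4 _ _ _ _
  · have hpa := habs p hp
    obtain ⟨w, hw, hlim⟩ := absorbed_exists_periodicOrbit h hq hτ hpa
    refine ⟨w, hw, ?_, hlim⟩
    obtain ⟨m, hm⟩ := hpa.2.2
    obtain ⟨n, hn, hper⟩ := hw.periodic
    have hcomp := (finite_range_of_periodic hn hper).isCompact
    set c := (billiard (quad a b) lam)^[m] p
    have ht : Tendsto (fun k => visitTime a b lam c k + m) atTop atTop :=
      tendsto_atTop_mono (fun k => Nat.le_add_right _ _) visitTime_strictMono.tendsto_atTop
    -- The periodic orbit is a finite set, so along the return times a subsequence of it converges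
    -- within it. The returns have the same limit and eventually lie in the closed rectangle R₂.
    obtain ⟨z, hz, φ, hφ, hφlim⟩ := hcomp.tendsto_subseq
      (x := fun k => w (visitTime a b lam c k + m)) fun k => mem_range_self _
    refine ⟨z, hz, Or.inr ?_⟩
    have hclosed : IsClosed (rectTwo a lam ε) := isClosed_Icc.prod isClosed_Icc
    have h1 : Tendsto (fun k => visit a b lam c (φ k)) atTop (𝓝 z) := by
      have h2 := (hlim.comp ht).comp hφ.tendsto_atTop
      refine (tendsto_iff_of_dist ?_).2 hφlim
      refine h2.congr fun k => ?_
      simp only [Function.comp, visit, c, ← Function.iterate_add_apply]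
    exact hclosed.mem_of_tendsto h1 (hφ.tendsto_atTop.eventually (hvis c hm))

end RationalCase

/-! ### Brouwer's characterization of the Cantor set -/

section Brouwer

variable {X : Type*} [TopologicalSpace X] [CompactSpace X] [T2Space X] [TotallyDisconnectedSpace X]

/-- If `B` cuts `U` properly it is used. Otherwise `U` has two points, as it is open and no
singleton is, and any clopen set separating them will do. -/
theorem exists_clopen_split (hperf : ∀ x : X, ¬IsOpen {x}) {U : Set X} (hU : IsClopen U)
    (hne : U.Nonempty) {B : Set X} (hB : IsClopen B) :
    ∃ V : Set X, IsClopen V ∧ (U ∩ V).Nonempty ∧ (U \ V).Nonempty ∧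
      ((U ∩ B).Nonempty → (U \ B).Nonempty → V = B) := by
  by_cases h : (U ∩ B).Nonempty ∧ (U \ B).Nonempty
  · exact ⟨B, hB, h.1, h.2, fun _ _ => rfl⟩
  · obtain ⟨x, hx⟩ := hne
    have : ∃ y ∈ U, y ≠ x := by
      by_contra! hc
      exact hperf x ((eq_singleton_iff_unique_mem.2 ⟨hx, hc⟩) ▸ hU.isOpen)
    obtain ⟨y, hy, hyx⟩ := this
    obtain ⟨V, hV, hxV, hyV⟩ := exists_isClopen_of_totally_separated hyx.symm
    exact ⟨V, hV, ⟨x, hx, hxV⟩, ⟨y, hy, hyV⟩, fun h1 h2 => absurd ⟨h1, h2⟩ h⟩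

/-- A binary tree of nonempty clopen cells, where level `n` is cut by the `n`-th clopen set whenever
that set cuts the cell. Each clopen set gets its turn, so the coding is injective; nested cells meet
by compactness, so it is surjective; cells are open, so it is continuous. -/
theorem nonempty_homeomorph_nat_bool [SecondCountableTopology X] [Nonempty X]
    (hperf : ∀ x : X, ¬IsOpen {x}) : Nonempty (X ≃ₜ (ℕ → Bool)) := by
  classical
  have : Countable (TopologicalSpace.Clopens X) :=
    TopologicalSpace.Clopens.countable_iff_secondCountable.2 inferInstance
  obtain ⟨B, hB⟩ := exists_surjective_nat (TopologicalSpace.Clopens X)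
  let S := {U : Set X // IsClopen U ∧ U.Nonempty}
  choose V hV1 hV2 hV3 hV4 using fun (U : S) (n : ℕ) =>
    exists_clopen_split hperf U.2.1 U.2.2 (B n).isClopen
  let part : S → ℕ → Bool → S := fun U n t =>
    if t then ⟨U.1 ∩ V U n, U.2.1.inter (hV1 U n), hV2 U n⟩
    else ⟨U.1 \ V U n, U.2.1.diff (hV1 U n), hV3 U n⟩
  have mem_part : ∀ (U : S) n t x, x ∈ (part U n t).1 ↔ x ∈ U.1 ∧ decide (x ∈ V U n) = t := by
    intro U n t x
    cases t <;> simp [part]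
  let cell : (ℕ → Bool) → ℕ → S := fun s n =>
    Nat.rec ⟨univ, isClopen_univ, univ_nonempty⟩ (fun n U => part U n (s n)) n
  have cell_succ : ∀ s n, cell s (n + 1) = part (cell s n) n (s n) := fun _ _ => rfl
  -- `cell` descends the tree along a given code, `pcell` along a given point, and the code records
  -- the turns that the point takes.
  let pcell : X → ℕ → S := fun x n =>
    Nat.rec ⟨univ, isClopen_univ, univ_nonempty⟩ (fun n U => part U n (decide (x ∈ V U n))) n
  have pcell_succ : ∀ x n, pcell x (n + 1)
    = part (pcell x n) n (decide (x ∈ V (pcell x n) n)) := fun _ _ => rfl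
  let code : X → ℕ → Bool := fun x n => decide (x ∈ V (pcell x n) n)
  have pcell_eq : ∀ x n, pcell x n = cell (code x) n := fun x n => by
    induction n with
    | zero => rfl
    | succ n ih => rw [pcell_succ, cell_succ, ← ih]
  have mem_cell : ∀ x n, x ∈ (cell (code x) n).1 := fun x n => by
    induction n with
    | zero => exact mem_univ x
    | succ n ih =>
      rw [cell_succ, mem_part]
      refine ⟨ih, ?_⟩
      change _ = decide (x ∈ V (pcell x n) n)
      rw [pcell_eq]
  have code_eq : ∀ s n x, x ∈ (cell s n).1 → pcell x n = cell s n ∧ ∀ k < n, code x k = s k := by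
    intro s n x
    induction n with
    | zero => exact fun _ => ⟨rfl, fun k hk => absurd hk (Nat.not_lt_zero k)⟩
    | succ n ih =>
      intro hx
      rw [cell_succ, mem_part] at hx
      obtain ⟨h1, h2⟩ := ih hx.1
      have h3 : code x n = s n := by simp only [code]; rw [h1]; exact hx.2
      refine ⟨?_, fun k hk => ?_⟩
      · rw [pcell_succ, cell_succ, ← h3, h1]
        simp only [code]
        rw [h1]
      · rcases Nat.lt_succ_iff_lt_or_eq.1 hk with hk | rfl
        · exact h2 k hk
        · exact h3
  have hcont : Continuous code := by
    refine continuous_pi fun n => continuous_iff_continuousAt.2 fun x => ?_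
    refine (continuousAt_const (y := code x n)).congr ?_
    filter_upwards [(cell (code x) (n + 1)).2.1.isOpen.mem_nhds (mem_cell x (n + 1))] with y hy
    exact ((code_eq _ _ y hy).2 n (Nat.lt_succ_self n)).symm
  have hinj : Function.Injective code := by
    intro x y hxy
    by_contra hne
    obtain ⟨W, hW, hxW, hyW⟩ := exists_isClopen_of_totally_separated hne
    obtain ⟨n, hn⟩ := hB ⟨W, hW⟩
    have hBn : (B n : Set X) = W := by rw [hn]; rfl
    have hx := mem_cell x n
    have hy := mem_cell y n
    rw [← hxy] at hy
    have hVB := hV4 (cell (code x) n) n ⟨x, hx, hBn ▸ hxW⟩ ⟨y, hy, hBn ▸ hyW⟩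
    have h1 : code x n = true := by
      change decide (x ∈ V (pcell x n) n) = true
      rw [pcell_eq, hVB]
      exact decide_eq_true (hBn ▸ hxW)
    have h2 : code y n = false := by
      change decide (y ∈ V (pcell y n) n) = false
      rw [pcell_eq, ← hxy, hVB]
      exact decide_eq_false (hBn ▸ hyW)
    rw [← hxy, h1] at h2
    exact Bool.noConfusion h2
  have hsurj : Function.Surjective code := by
    intro s
    obtain ⟨x, hx⟩ := IsCompact.nonempty_iInter_of_sequence_nonempty_isCompact_isClosed
      (fun n => (cell s n).1)
      (fun n x hx => by rw [cell_succ, mem_part] at hx; exact hx.1) (fun n => (cell s n).2.2)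
      (cell s 0).2.1.isClosed.isCompact fun n => (cell s n).2.1.isClosed
    refine ⟨x, funext fun n => ?_⟩
    exact (code_eq s (n + 1) x (mem_iInter.1 hx (n + 1))).2 n (Nat.lt_succ_self n)
  exact ⟨hcont.homeoOfEquivCompactToT2 (f := Equiv.ofBijective code ⟨hinj, hsurj⟩)⟩

end Brouwer

theorem isCantor_of_compact {K : Set (ℝ × ℝ)} (hK : IsCompact K) (hne : K.Nonempty)
    (hdis : IsTotallyDisconnected K) (hperf : ∀ z ∈ K, ∀ r > 0, ∃ z' ∈ K, z' ≠ z ∧ dist z' z < r) :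
    IsCantor K := by
  have : CompactSpace K := isCompact_iff_compactSpace.1 hK
  have : Nonempty K := hne.to_subtype
  have : TotallyDisconnectedSpace K := (totallyDisconnectedSpace_subtype_iff).2 hdis
  obtain ⟨e⟩ := nonempty_homeomorph_nat_bool (X := K) fun z hz => by
    obtain ⟨r, hr, hball⟩ := Metric.isOpen_iff.1 hz z rfl
    obtain ⟨z', hz', hne', hd⟩ := hperf z z.2 r hr
    exact hne' (congrArg Subtype.val (hball (show (⟨z', hz'⟩ : K) ∈ Metric.ball z r from hd)))
  exact ⟨e.trans cantorSetHomeomorphNatToBool.symm⟩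

/-! ### Orbits of monotone degree one maps with irrational rotation number -/

section Irrational

variable (f : CircleDeg1Lift)

/-- The monotone map that semiconjugates `f` to the translation by its translation number. -/
noncomputable def semiconj (y : ℝ) : ℝ :=
  limsup (fun n : ℕ => f^[n] y - n * f.translationNumber) atTop

theorem isBounded_semiconj (y : ℝ) :
    IsBoundedUnder (· ≤ ·) atTop (fun n : ℕ => f^[n] y - n * f.translationNumber) ∧
    IsBoundedUnder (· ≥ ·) atTop (fun n : ℕ => f^[n] y - n * f.translationNumber) :=
  ⟨isBoundedUnder_of ⟨y + 1, fun n => by linarith [iterate_lt_add f n y]⟩,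
    isBoundedUnder_of ⟨y - 1, fun n => by
      have := sub_lt_iterate f n y
      simp only [ge_iff_le]
      linarith⟩⟩

theorem semiconj_monotone : Monotone (semiconj f) := fun x y hxy => by
  refine limsup_le_limsup (Eventually.of_forall fun n => ?_)
    (isBounded_semiconj f x).2.isCoboundedUnder_le (isBounded_semiconj f y).1
  exact sub_le_sub_right ((f.monotone.iterate n) hxy) _

theorem limsup_add_real {u : ℕ → ℝ} (c : ℝ) (h1 : IsBoundedUnder (· ≤ ·) atTop u)
    (h2 : IsBoundedUnder (· ≥ ·) atTop u) :
    limsup (fun n => u n + c) atTop = limsup u atTop + c :=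
  limsup_add_const atTop u c h1 h2.isCoboundedUnder_le

theorem semiconj_add_int (y : ℝ) (m : ℤ) : semiconj f (y + m) = semiconj f y + m := by
  rw [semiconj, semiconj, ← limsup_add_real _ (isBounded_semiconj f y).1 (isBounded_semiconj f y).2]
  congr 1
  funext n
  rw [iterate_add_int]; ring

/-- Passing from `y` to `f y` shifts the sequence by one index, which the limsup ignores, and adds
one translation number. -/
theorem semiconj_map (y : ℝ) : semiconj f (f y) = semiconj f y + f.translationNumber := by
  rw [semiconj, semiconj, ← limsup_add_real _ (isBounded_semiconj f y).1 (isBounded_semiconj f y).2,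
    ← limsup_nat_add (fun n : ℕ => f^[n] y - n * f.translationNumber + f.translationNumber) 1]
  congr 1
  funext n
  rw [← Function.iterate_succ_apply]; push_cast; ring

theorem semiconj_iterate (n : ℕ) (y : ℝ) :
    semiconj f (f^[n] y) = semiconj f y + n * f.translationNumber := by
  induction n with
  | zero => simp
  | succ n ih => rw [Function.iterate_succ_apply', semiconj_map, ih]; push_cast; ring

/-- In a compact group such as the circle the submonoid generated by an element is dense as soon as
the subgroup is, so forward multiples suffice. Translating the target by `c + N * ρ` forces `n ≥ N`.
-/
theorem exists_nat_mul_add_int_mem_Ioo {ρ : ℝ} (hρ : Irrational ρ) (c : ℝ) (N : ℕ) {u v : ℝ}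
    (huv : u < v) : ∃ n ≥ N, ∃ m : ℤ, c + n * ρ + m ∈ Ioo u v := by
  have : Fact ((0 : ℝ) < 1) := ⟨zero_lt_one⟩
  have hd : Dense (AddSubmonoid.closure {(ρ : AddCircle (1 : ℝ))} : Set (AddCircle (1 : ℝ))) := by
    rw [dense_addSubmonoidClosure_iff_addSubgroupClosure, ← AddSubgroup.zmultiples_eq_closure,
      AddSubgroup.coe_zmultiples]
    exact AddCircle.denseRange_zsmul_coe_iff.2 (by simpa using hρ)
  obtain ⟨_, hx, t, ht, rfl⟩ := hd.exists_mem_open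
    (U := ((↑) : ℝ → AddCircle (1 : ℝ)) '' Ioo (u - c - N * ρ) (v - c - N * ρ))
    (QuotientAddGroup.isOpenMap_coe _ isOpen_Ioo) ((nonempty_Ioo.2 (by linarith)).image _)
  obtain ⟨n, hn⟩ := AddSubmonoid.mem_closure_singleton.1 hx
  obtain ⟨m, hm⟩ := AddCircle.coe_eq_zero_iff (1 : ℝ) (x := t - n * ρ) |>.1 (by
    rw [AddCircle.coe_sub, ← hn, sub_eq_zero, ← nsmul_eq_mul, AddCircle.coe_nsmul])
  refine ⟨N + n, Nat.le_add_right _ _, m, ?_⟩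
  rw [zsmul_eq_mul, mul_one] at hm
  rw [hm]
  push_cast
  constructor <;> linarith [ht.1, ht.2]

variable {f}

/-- Every orbit visits infinitely often an interval whose ends are separated by the
semiconjugacy. -/
theorem exists_iterate_add_int_mem_Ioo (hf : Irrational f.translationNumber) {u v : ℝ}
    (huv : semiconj f u < semiconj f v) (y : ℝ) (N : ℕ) :
    ∃ n ≥ N, ∃ m : ℤ, f^[n] y + m ∈ Ioo u v ∧
      semiconj f (f^[n] y + m) ∈ Ioo (semiconj f u) (semiconj f v) := by
  obtain ⟨n, hn, m, hm⟩ := exists_nat_mul_add_int_mem_Ioo hf (semiconj f y) N huv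
  rw [← semiconj_iterate, ← semiconj_add_int] at hm
  exact ⟨n, hn, m, ⟨(semiconj_monotone f).reflect_lt hm.1, (semiconj_monotone f).reflect_lt hm.2⟩,
    hm⟩

theorem semiconj_iterate_add_int_ne (hf : Irrational f.translationNumber) {n n' : ℕ}
    (hn : n ≠ n') (y : ℝ) (m m' : ℤ) :
    semiconj f (f^[n] y + m) ≠ semiconj f (f^[n'] y + m') := by
  rw [semiconj_add_int, semiconj_add_int, semiconj_iterate, semiconj_iterate]
  intro he
  have hd : ((n : ℤ) - n' : ℤ) ≠ 0 := by omega
  have h2 := hf.intCast_mul hd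
  apply h2.ne_int (m' - m)
  push_cast
  linarith

end Irrational

/-! ### Cluster points of the returns to the strip -/

section ReturnLimit

variable {a b lam : ℝ} {p p' z : ℝ × ℝ} {s : Bool}

theorem exists_visit_between (h : Params a b lam)
    (hρ : Irrational (circleLift h).translationNumber) (hp : p ∈ core a b lam) {u v : ℝ}
    (hu : 0 ≤ u) (hv : v ≤ 1) (huv : semiconj (circleLift h) u < semiconj (circleLift h) v)
    (N : ℕ) : ∃ n ≥ N, param a lam (visit a b lam p n) ∈ Ioo u v ∧
      semiconj (circleLift h) (param a lam (visit a b lam p n)) ∈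
        Ioo (semiconj (circleLift h) u) (semiconj (circleLift h) v) := by
  obtain ⟨n, hn, m, h1, h2⟩ := exists_iterate_add_int_mem_Ioo hρ huv (param a lam p) N
  have e : param a lam (visit a b lam p n) = (circleLift h)^[n] (param a lam p) + m := by
    rw [param_visit h hp, ← unitPart_add_int _ m]
    exact unitPart_of_mem ⟨hu.trans_lt h1.1, (h1.2.trans_le hv).le⟩
  exact ⟨n, hn, e ▸ h1, e ▸ h2⟩

theorem semiconj_param_visit_ne (h : Params a b lam)
    (hρ : Irrational (circleLift h).translationNumber) (hp : p ∈ core a b lam) {i j : ℕ}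
    (hij : i ≠ j) : semiconj (circleLift h) (param a lam (visit a b lam p i)) ≠
      semiconj (circleLift h) (param a lam (visit a b lam p j)) := by
  have e : ∀ x, unitPart x = x + ((1 - ⌈x⌉ : ℤ) : ℝ) := fun x => by
    rw [unitPart]; push_cast; ring
  rw [param_visit h hp, param_visit h hp, e, e]
  exact semiconj_iterate_add_int_ne hρ hij _ _ _

/-- The cluster points of the returns to the strip that are followed by a return of type `s`. -/
def returnLimit (a b lam : ℝ) (p : ℝ × ℝ) (s : Bool) : Set (ℝ × ℝ) :=
  {z | ∀ U ∈ 𝓝 z, ∃ᶠ n in atTop, isShort a lam (visit a b lam p n) = s ∧ visit a b lam p n ∈ U}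

theorem isClosed_returnLimit : IsClosed (returnLimit a b lam p s) := by
  refine isClosed_iff_frequently.2 fun z hz U hU => ?_
  obtain ⟨z', hz', hU'⟩ := (hz.and_eventually (eventually_eventually_nhds.2 hU)).exists
  exact hz' U hU'

theorem mem_of_mem_returnLimit {C : Set (ℝ × ℝ)} (hC : IsClosed C)
    (h : ∀ᶠ n in atTop, isShort a lam (visit a b lam p n) = s → visit a b lam p n ∈ C)
    (hz : z ∈ returnLimit a b lam p s) : z ∈ C := by
  by_contra hn
  obtain ⟨n, ⟨h1, h2⟩, h3⟩ := ((hz _ (hC.isOpen_compl.mem_nhds hn)).and_eventually h).exists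
  exact h2 (h3 h1)

theorem snd_eq_one_of_mem_returnLimit (h : Params a b lam) (hp : p ∈ core a b lam)
    (hz : z ∈ returnLimit a b lam p s) : z.2 = 1 := by
  by_contra hn
  have h1 : {w : ℝ | dist w 1 < dist z.2 1 / 2} ∈ 𝓝 (1 : ℝ) :=
    Metric.ball_mem_nhds _ (half_pos (dist_pos.2 hn))
  have hC : IsClosed {w : ℝ × ℝ | dist w.2 1 ≤ dist z.2 1 / 2} :=
    isClosed_le (by fun_prop) continuous_const
  have h2 : dist z.2 1 ≤ dist z.2 1 / 2 := mem_of_mem_returnLimit hC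
    (((tendsto_snd_visit h hp).eventually h1).mono fun n hn _ => le_of_lt hn) hz
  linarith [dist_pos.2 hn]

theorem continuous_param (a lam : ℝ) : Continuous (param a lam) := by
  unfold param; fun_prop

theorem param_le_cut_of_mem_returnLimit (hz : z ∈ returnLimit a b lam p true) :
    param a lam z ≤ cut a lam :=
  mem_of_mem_returnLimit (isClosed_le (continuous_param a lam) continuous_const)
    (Eventually.of_forall fun _ hn => (of_decide_eq_true hn).le) hz

theorem cut_le_param_of_mem_returnLimit (hz : z ∈ returnLimit a b lam p false) :
    cut a lam ≤ param a lam z :=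
  mem_of_mem_returnLimit (isClosed_le continuous_const (continuous_param a lam))
    (Eventually.of_forall fun _ hn => not_lt.1 (of_decide_eq_false hn)) hz

/-- Each return type occupies an interval of parameters. -/
theorem isShort_eq_of_param_mem_Ioo {u v w : ℝ × ℝ} (hu : isShort a lam u = s)
    (hv : isShort a lam v = s) (hw : param a lam w ∈ Ioo (param a lam u) (param a lam v)) :
    isShort a lam w = s := by
  cases s
  · exact decide_eq_false (not_lt.2 ((not_lt.1 (of_decide_eq_false hu)).trans hw.1.le))
  · exact decide_eq_true (hw.2.trans (of_decide_eq_true hv))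

theorem eventually_dist_lt_of_between (h : Params a b lam) (hp : p ∈ core a b lam)
    (hz : z.2 = 1) {r : ℝ} {u v : ℝ × ℝ} (hu : dist u z < r) (hv : dist v z < r) :
    ∀ᶠ n in atTop, param a lam (visit a b lam p n) ∈ Ioo (param a lam u) (param a lam v) →
      dist (visit a b lam p n) z < r := by
  have hr : 0 < r := dist_nonneg.trans_lt hu
  filter_upwards [(tendsto_snd_visit h hp).eventually (Metric.ball_mem_nhds _ hr)] with n hn hb
  have hl := lenL_pos h
  have f := fst_eq_of_param h
  have hu1 := abs_lt.1 ((le_max_left _ _).trans_lt hu : |u.1 - z.1| < r)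
  have hv1 := abs_lt.1 ((le_max_left _ _).trans_lt hv : |v.1 - z.1| < r)
  refine max_lt (abs_lt.2 ⟨?_, ?_⟩) (by rw [hz]; exact hn)
  · rw [f u] at hu1
    rw [f (visit a b lam p n)]
    nlinarith [hb.1]
  · rw [f v] at hv1
    rw [f (visit a b lam p n)]
    nlinarith [hb.2]

theorem exists_two_visits (h : Params a b lam)
    (hρ : Irrational (circleLift h).translationNumber) (hp : p ∈ core a b lam)
    (hz : z ∈ returnLimit a b lam p s) {r : ℝ} (hr : 0 < r) :
    ∃ i j, (isShort a lam (visit a b lam p i) = s ∧ dist (visit a b lam p i) z < r) ∧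
      (isShort a lam (visit a b lam p j) = s ∧ dist (visit a b lam p j) z < r) ∧
      semiconj (circleLift h) (param a lam (visit a b lam p i)) <
        semiconj (circleLift h) (param a lam (visit a b lam p j)) := by
  have h1 := hz _ (Metric.ball_mem_nhds z hr)
  obtain ⟨i, -, hi⟩ := frequently_atTop.1 h1 0
  obtain ⟨j, hij, hj⟩ := frequently_atTop.1 h1 (i + 1)
  rcases (semiconj_param_visit_ne h hρ hp (show i ≠ j by omega)).lt_or_gt with hlt | hlt
  · exact ⟨i, j, hi, hj, hlt⟩
  · exact ⟨j, i, hj, hi, hlt⟩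

/-- Near a cluster point there are two visits of type `s` with different values of the
semiconjugacy. The other orbit enters the interval between them infinitely often, there has type
`s`, and is close to the cluster point because its height tends to `1`. -/
theorem returnLimit_subset (h : Params a b lam)
    (hρ : Irrational (circleLift h).translationNumber) (hp : p ∈ core a b lam)
    (hp' : p' ∈ core a b lam) : returnLimit a b lam p s ⊆ returnLimit a b lam p' s := by
  intro z hz U hU
  obtain ⟨r, hr, hrU⟩ := Metric.mem_nhds_iff.1 hU
  obtain ⟨i, j, hi, hj, hij⟩ := exists_two_visits h hρ hp hz hr
  have hev := eventually_dist_lt_of_between h hp' (snd_eq_one_of_mem_returnLimit h hp hz) hi.2 hj.2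
  have hfr : ∃ᶠ n in atTop, param a lam (visit a b lam p' n) ∈
      Ioo (param a lam (visit a b lam p i)) (param a lam (visit a b lam p j)) := by
    refine frequently_atTop.2 fun N => ?_
    obtain ⟨n, hn, hn', -⟩ := exists_visit_between h hρ hp'
      (param_mem_Ioo h (visit_mem_core h hp i).1).1.le
      (param_mem_Ioo h (visit_mem_core h hp j).1).2.le hij N
    exact ⟨n, hn, hn'⟩
  refine (hfr.and_eventually hev).mono fun n hn => ?_
  exact ⟨isShort_eq_of_param_mem_Ioo hi.1 hj.1 hn.1, hrU (hn.2 hn.1)⟩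

theorem isBounded_core (h : Params a b lam) : Bornology.IsBounded (core a b lam) := by
  refine (Metric.isBounded_Icc ((-lenL a lam, 0) : ℝ × ℝ) (0, 1)).subset fun q hq => ?_
  have hx := param_mem_Ioo h hq.1
  have hl := lenL_pos h
  refine ⟨⟨?_, hq.1.2.1.le⟩, hq.1.1.le, hq.1.2.2.1.le⟩
  simp only
  rw [fst_eq_of_param h q]
  nlinarith [hx.1]

/-- Between two returns of type `s` there is a cluster point of such returns. -/
theorem exists_mem_returnLimit_between (h : Params a b lam)
    (hρ : Irrational (circleLift h).translationNumber) (hp : p ∈ core a b lam) {u v : ℝ × ℝ}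
    (hu : u ∈ core a b lam) (hv : v ∈ core a b lam) (hus : isShort a lam u = s)
    (hvs : isShort a lam v = s)
    (huv : semiconj (circleLift h) (param a lam u) < semiconj (circleLift h) (param a lam v)) :
    ∃ z ∈ returnLimit a b lam p s, param a lam z ∈ Icc (param a lam u) (param a lam v) := by
  have hfr : ∃ᶠ n in atTop, param a lam (visit a b lam p n) ∈
      Ioo (param a lam u) (param a lam v) := by
    refine frequently_atTop.2 fun N => ?_
    obtain ⟨n, hn, hn', -⟩ := exists_visit_between h hρ hp (param_mem_Ioo h hu.1).1.le
      (param_mem_Ioo h hv.1).2.le huv N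
    exact ⟨n, hn, hn'⟩
  have hne : (atTop ⊓ 𝓟 {n | param a lam (visit a b lam p n) ∈
      Ioo (param a lam u) (param a lam v)}).NeBot := frequently_mem_iff_neBot.1 hfr
  obtain ⟨z, -, hz⟩ := (isBounded_core h).isCompact_closure.exists_mapClusterPt
    (f := atTop ⊓ 𝓟 {n | param a lam (visit a b lam p n) ∈
      Ioo (param a lam u) (param a lam v)}) (u := visit a b lam p)
    (le_principal_iff.2 (mem_map.2 (univ_mem' fun n => subset_closure (visit_mem_core h hp n))))
  have hz' : ∀ U ∈ 𝓝 z, ∃ᶠ n in atTop, visit a b lam p n ∈ U ∧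
      param a lam (visit a b lam p n) ∈ Ioo (param a lam u) (param a lam v) := fun U hU =>
    (frequently_inf_principal.1 (mapClusterPt_iff_frequently.1 hz U hU)).mono fun n hn => 
      ⟨hn.2, hn.1⟩
  refine ⟨z, fun U hU => (hz' U hU).mono fun n hn =>
    ⟨isShort_eq_of_param_mem_Ioo hus hvs hn.2, hn.1⟩, ?_⟩
  by_contra hn
  have hC : IsClosed (param a lam ⁻¹' Icc (param a lam u) (param a lam v)) :=
    isClosed_Icc.preimage (continuous_param a lam)
  obtain ⟨n, h1, h2⟩ := (hz' _ (hC.isOpen_compl.mem_nhds hn)).exists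
  exact h1 (Ioo_subset_Icc_self h2)

theorem returnLimit_perfect (h : Params a b lam)
    (hρ : Irrational (circleLift h).translationNumber) (hp : p ∈ core a b lam)
    (hz : z ∈ returnLimit a b lam p s) {r : ℝ} (hr : 0 < r) :
    ∃ z' ∈ returnLimit a b lam p s, z' ≠ z ∧ dist z' z < r := by
  have hz2 := snd_eq_one_of_mem_returnLimit h hp hz
  have hcore := visit_mem_core h hp
  obtain ⟨i, j, hi, hj, hij⟩ := exists_two_visits h hρ hp hz (half_pos hr)
  have hI := (param_mem_Ioo h (hcore i).1).1.le
  have hJ := (param_mem_Ioo h (hcore j).1).2.le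
  -- The four visits have parameters in the order `i`, `m`, `n`, `j`. The intervals from `i` to `m`
  -- and from `n` to `j` are disjoint and each carries a cluster point, so one of them yields a
  -- cluster point other than `z`.
  obtain ⟨m, -, hm, hHm⟩ := exists_visit_between h hρ hp hI hJ hij 0
  obtain ⟨n, -, hn, hHn⟩ := exists_visit_between h hρ hp (hI.trans hm.1.le) hJ hHm.2 0
  have hms := isShort_eq_of_param_mem_Ioo hi.1 hj.1 hm
  have hns := isShort_eq_of_param_mem_Ioo hi.1 hj.1 ⟨hm.1.trans hn.1, hn.2⟩
  have key : ∀ z' ∈ returnLimit a b lam p s, param a lam z' ∈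
      Icc (param a lam (visit a b lam p i)) (param a lam (visit a b lam p j)) →
      dist z' z < r := fun z' hz' hb => by
    have hl := lenL_pos h
    have f := fst_eq_of_param h
    have hu1 := abs_lt.1 ((le_max_left _ _).trans_lt hi.2 :
      |(visit a b lam p i).1 - z.1| < r / 2)
    have hv1 := abs_lt.1 ((le_max_left _ _).trans_lt hj.2 :
      |(visit a b lam p j).1 - z.1| < r / 2)
    rw [f (visit a b lam p i)] at hu1
    rw [f (visit a b lam p j)] at hv1
    refine max_lt (abs_lt.2 ⟨?_, ?_⟩) ?_
    · rw [f z']; nlinarith [hb.1]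
    · rw [f z']; nlinarith [hb.2]
    · rw [hz2, snd_eq_one_of_mem_returnLimit h hp hz', dist_self]; exact hr
  rcases lt_or_ge (param a lam z) (param a lam (visit a b lam p n)) with hlt | hge
  · obtain ⟨z', hz', hb⟩ := exists_mem_returnLimit_between h hρ hp (hcore n) (hcore j) hns hj.1 hHn.2
    exact ⟨z', hz', fun e => absurd hb.1 (not_le.2 (e ▸ hlt)),
      key z' hz' ⟨(hm.1.trans hn.1).le.trans hb.1, hb.2⟩⟩
  · obtain ⟨z', hz', hb⟩ := exists_mem_returnLimit_between h hρ hp (hcore i) (hcore m) hi.1 hms hHm.1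
    exact ⟨z', hz', fun e => absurd hb.2 (not_le.2 (e ▸ hn.1.trans_le hge)),
      key z' hz' ⟨hb.1, hb.2.trans hm.2.le⟩⟩

end ReturnLimit

/-! ### Limit sets for irrational rotation number -/

section OmegaSet

variable {a b lam : ℝ} {p p' z : ℝ × ℝ} {s : Bool}

theorem mem_omegaSet {V : Fin 4 → ℝ × ℝ} :
    z ∈ omegaSet V lam p ↔ ∀ U ∈ 𝓝 z, ∃ᶠ n in atTop, (billiard V lam)^[n] p ∈ U := by
  rw [omegaSet, mem_omegaLimit_singleton_iff_mapClusterPt]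
  exact mapClusterPt_iff_frequently

theorem omegaSet_iterate {V : Fin 4 → ℝ × ℝ} (m : ℕ) :
    omegaSet V lam ((billiard V lam)^[m] p) = omegaSet V lam p := by
  ext z
  rw [mem_omegaSet, mem_omegaSet]
  refine forall₂_congr fun U _ => ?_
  conv_rhs => rw [← map_add_atTop_eq_nat m, frequently_map]
  simp only [Function.iterate_add_apply]

/-- The constant term of the `j`-th iterate of the billiard along a return of type `s`. -/
noncomputable def legOffset (a b lam : ℝ) (s : Bool) : ℕ → ℝ × ℝ
  | 0 => 0
  | j + 1 => (1 + lam) • quad a b (returnWord s j) - lam • legOffset a b lam s j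

/-- The `j`-th iterate of the billiard along a return of type `s`. -/
noncomputable def leg (a b lam : ℝ) (s : Bool) (j : ℕ) (z : ℝ × ℝ) : ℝ × ℝ :=
  legOffset a b lam s j + (-lam) ^ j • z

theorem leg_succ (j : ℕ) : leg a b lam s (j + 1) z
    = reflect lam (quad a b (returnWord s j)) (leg a b lam s j z) := by
  simp only [leg, legOffset, reflect, pow_succ']
  module

theorem continuous_leg (s : Bool) (j : ℕ) : Continuous (leg a b lam s j) := by
  unfold leg; fun_prop

theorem leg_injective (hl : lam ≠ 0) (s : Bool) (j : ℕ) : Function.Injective (leg a b lam s j) :=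
  fun _ _ he => smul_right_injective _ (pow_ne_zero j (neg_ne_zero.2 hl)) (add_left_cancel he)

theorem exists_leg_eq (hl : lam ≠ 0) (s : Bool) (j : ℕ) (z : ℝ × ℝ) :
    ∃ z', leg a b lam s j z' = z :=
  ⟨((-lam) ^ j)⁻¹ • (z - legOffset a b lam s j), by
    rw [leg, smul_inv_smul₀ (pow_ne_zero j (neg_ne_zero.2 hl)), add_sub_cancel]⟩

theorem leg_mem_nhds (hl : lam ≠ 0) {j : ℕ} {U : Set (ℝ × ℝ)} (hU : U ∈ 𝓝 z) :
    leg a b lam s j '' U ∈ 𝓝 (leg a b lam s j z) := by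
  have hinv : Continuous fun w : ℝ × ℝ => ((-lam) ^ j)⁻¹ • (w - legOffset a b lam s j) := by
    fun_prop
  have hc := pow_ne_zero j (neg_ne_zero.2 hl)
  have e : ((-lam) ^ j)⁻¹ • (leg a b lam s j z - legOffset a b lam s j) = z := by
    rw [leg, add_sub_cancel_left, inv_smul_smul₀ hc]
  refine mem_of_superset (hinv.continuousAt.preimage_mem_nhds (e.symm ▸ hU)) fun w hw => ⟨_, hw, ?_⟩
  rw [leg, smul_inv_smul₀ hc, add_sub_cancel]

theorem iterate_eq_leg (h : Params a b lam) (hp : p ∈ core a b lam) {j : ℕ}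
    (hj : j ≤ returnTime (isShort a lam p)) :
    (billiard (quad a b) lam)^[j] p = leg a b lam (isShort a lam p) j p := by
  induction j with
  | zero => simp [leg, legOffset]
  | succ j ih =>
    have hb := (strip_return h hp.1 (param_ne_cut h hp) rfl).1 j hj
    rw [leg_succ, ← ih (by omega), Function.iterate_succ_apply']
    exact billiard_of_branchDomain hb

theorem iterate_visitTime_add (h : Params a b lam) (hp : p ∈ core a b lam) {i j : ℕ}
    (hj : j ≤ returnTime (isShort a lam (visit a b lam p i))) :
    (billiard (quad a b) lam)^[visitTime a b lam p i + j] p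
      = leg a b lam (isShort a lam (visit a b lam p i)) j (visit a b lam p i) := by
  rw [add_comm, Function.iterate_add_apply]
  exact iterate_eq_leg h (visit_mem_core h hp i) hj

theorem exists_eq_visitTime_add (n : ℕ) : ∃ i j, n = visitTime a b lam p i + j ∧
    j < returnTime (isShort a lam (visit a b lam p i)) := by
  induction n with
  | zero => exact ⟨0, 0, rfl, by linarith [four_le_returnTime (isShort a lam (visit a b lam p 0))]⟩
  | succ n ih =>
    obtain ⟨i, j, rfl, hj⟩ := ih
    rcases Nat.lt_or_ge (j + 1) (returnTime (isShort a lam (visit a b lam p i))) with hlt | hge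
    · exact ⟨i, j + 1, rfl, hlt⟩
    · refine ⟨i + 1, 0, ?_, by
        linarith [four_le_returnTime (isShort a lam (visit a b lam p (i + 1)))]⟩
      rw [visitTime_succ]; omega

theorem leg_mem_omegaSet (h : Params a b lam) (hp : p ∈ core a b lam)
    (hz : z ∈ returnLimit a b lam p s) {j : ℕ} (hj : j ≤ returnTime s) :
    leg a b lam s j z ∈ omegaSet (quad a b) lam p := by
  refine mem_omegaSet.2 fun U hU => ?_
  have ht : Tendsto (fun i => visitTime a b lam p i + j) atTop atTop :=
    tendsto_atTop_mono (fun i => Nat.le_add_right _ _) visitTime_strictMono.tendsto_atTop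
  refine ht.frequently ((hz _ ((continuous_leg s j).continuousAt.preimage_mem_nhds hU)).mono ?_)
  rintro i ⟨rfl, hi⟩
  rw [iterate_visitTime_add h hp hj]
  exact hi

theorem exists_nhds_of_not_mem_returnLimit {f : Bool → ℝ × ℝ}
    (hf : ∀ s, f s ∉ returnLimit a b lam p s) : ∀ s, ∃ U ∈ 𝓝 (f s), ∀ᶠ n in atTop,
      isShort a lam (visit a b lam p n) = s → visit a b lam p n ∉ U := fun s => by
  have := hf s
  simp only [returnLimit, mem_ofPred_eq, not_forall, not_frequently, not_and] at this
  obtain ⟨U, hU, hn⟩ := this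
  exact ⟨U, hU, hn⟩

/-- There are finitely many legs, all affine homeomorphisms. If no preimage of `z` were a cluster
point, each would have a neighbourhood avoided by late visits, and the images of these would
intersect in a neighbourhood of `z` avoided by the orbit. The affine legs replace the billiard
because cluster points may be singular. -/
theorem exists_leg_of_mem_omegaSet (h : Params a b lam) (hp : p ∈ core a b lam)
    (hz : z ∈ omegaSet (quad a b) lam p) :
    ∃ s, ∃ j < returnTime s, ∃ z' ∈ returnLimit a b lam p s, leg a b lam s j z' = z := by
  by_contra! hc
  have l0 := h.lam_pos.ne'
  choose f hf using fun (j : ℕ) (s : Bool) => exists_leg_eq (a := a) (b := b) l0 s j z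
  have hev : ∀ j : Fin 6, ∀ s, ∃ U ∈ 𝓝 (f j s), j < returnTime s → ∀ᶠ n in atTop,
      isShort a lam (visit a b lam p n) = s → visit a b lam p n ∉ U := fun j s => by
    by_cases hj : j < returnTime s
    · have hn : f j s ∉ returnLimit a b lam p s := fun hm => hc s j hj _ hm (hf j s)
      simp only [returnLimit, mem_ofPred_eq, not_forall, not_frequently, not_and] at hn
      obtain ⟨U, hU, hn⟩ := hn
      exact ⟨U, hU, fun _ => hn⟩
    · exact ⟨univ, univ_mem, fun hj' => absurd hj' hj⟩
  choose U hU hUev using hev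
  have hN : (⋂ (j : Fin 6) (s : Bool), leg a b lam s j '' U j s) ∈ 𝓝 z :=
    iInter_mem.2 fun j => iInter_mem.2 fun s => by
      have := leg_mem_nhds (a := a) (b := b) (s := s) (j := j) l0 (hU j s)
      rwa [hf j s] at this
  have hall : ∀ᶠ n in atTop, ∀ (j : Fin 6) (s : Bool), j < returnTime s →
      isShort a lam (visit a b lam p n) = s → visit a b lam p n ∉ U j s :=
    eventually_all.2 fun j => eventually_all.2 fun s => by
      by_cases hj : j < returnTime s
      · exact (hUev j s hj).mono fun n hn _ => hn
      · exact Eventually.of_forall fun n hj' => absurd hj' hj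
  obtain ⟨I, hI⟩ := eventually_atTop.1 hall
  -- A return takes at most six steps, so the visit preceding time `n` has index at least `I`.
  obtain ⟨n, hn, hmem⟩ := frequently_atTop.1 (mem_omegaSet.1 hz _ hN) (visitTime a b lam p I + 6)
  obtain ⟨i, j, rfl, hj⟩ := exists_eq_visitTime_add (a := a) (b := b) (lam := lam) (p := p) n
  have hj6 := hj.trans_le (returnTime_le_six _)
  have hi : I ≤ i := visitTime_strictMono.le_iff_le.1
    (show visitTime a b lam p I ≤ visitTime a b lam p i by omega)
  have hm := mem_iInter.1 (mem_iInter.1 hmem ⟨j, hj6⟩) (isShort a lam (visit a b lam p i))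
  rw [iterate_visitTime_add h hp hj.le] at hm
  obtain ⟨w, hw, e⟩ := hm
  rw [leg_injective l0 _ _ e] at hw
  exact hI i hi ⟨j, hj6⟩ _ hj rfl hw

theorem exists_leg_of_mem_returnLimit (h : Params a b lam) (hp : p ∈ core a b lam)
    (hz : z ∈ returnLimit a b lam p s) :
    ∃ s', ∃ z' ∈ returnLimit a b lam p s', leg a b lam s' (returnTime s') z' = z := by
  by_contra! hc
  have l0 := h.lam_pos.ne'
  choose f hf using fun (s : Bool) => exists_leg_eq (a := a) (b := b) l0 s (returnTime s) z
  choose U hU hUev using exists_nhds_of_not_mem_returnLimit fun s hm => hc s (f s) hm (hf s)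
  have hN : (⋂ s : Bool, leg a b lam s (returnTime s) '' U s) ∈ 𝓝 z :=
    iInter_mem.2 fun s => by
      have := leg_mem_nhds (a := a) (b := b) (s := s) (j := returnTime s) l0 (hU s)
      rwa [hf s] at this
  obtain ⟨I, hI⟩ := eventually_atTop.1 (eventually_all.2 hUev)
  obtain ⟨n, hn, -, hmem⟩ := frequently_atTop.1 (hz _ hN) (I + 1)
  obtain ⟨i, rfl⟩ := Nat.exists_eq_add_of_le' hn
  have hm := mem_iInter.1 hmem (isShort a lam (visit a b lam p (i + I)))
  rw [← add_assoc, visit_succ, iterate_eq_leg h (visit_mem_core h hp _) le_rfl] at hm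
  obtain ⟨w, hw, e⟩ := hm
  rw [leg_injective l0 _ _ e] at hw
  exact hI _ (Nat.le_add_left _ _) _ rfl hw

theorem omegaSet_subset (h : Params a b lam)
    (hρ : Irrational (circleLift h).translationNumber) (hp : p ∈ core a b lam)
    (hp' : p' ∈ core a b lam) : omegaSet (quad a b) lam p ⊆ omegaSet (quad a b) lam p' := by
  intro z hz
  obtain ⟨s, j, hj, z', hz', rfl⟩ := exists_leg_of_mem_omegaSet h hp hz
  exact leg_mem_omegaSet h hp' (returnLimit_subset h hρ hp hp' hz') hj.le

theorem omegaSet_perfect (h : Params a b lam)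
    (hρ : Irrational (circleLift h).translationNumber) (hp : p ∈ core a b lam)
    (hz : z ∈ omegaSet (quad a b) lam p) {r : ℝ} (hr : 0 < r) :
    ∃ z' ∈ omegaSet (quad a b) lam p, z' ≠ z ∧ dist z' z < r := by
  obtain ⟨s, j, hj, w, hw, rfl⟩ := exists_leg_of_mem_omegaSet h hp hz
  obtain ⟨δ, hδ, hd⟩ := Metric.continuous_iff.1 (continuous_leg (a := a) (b := b) (lam := lam) s j)
    w r hr
  obtain ⟨w', hw', hne, hlt⟩ := returnLimit_perfect h hρ hp hw hδ
  exact ⟨_, leg_mem_omegaSet h hp hw' hj.le, (leg_injective h.lam_pos.ne' s j).ne hne, hd _ hlt⟩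

/-! ### Boundedness of orbits and attraction to the limit set -/

theorem norm_iterate_le (h : Params a b lam)
    (hp : ∀ n, ∃ i, (billiard (quad a b) lam)^[n] p ∈ tangentRegion (quad a b) i) (n : ℕ) :
    ‖(billiard (quad a b) lam)^[n] p‖ ≤ max ‖p‖ (2 / (1 - lam)) := by
  have l0 := h.lam_pos
  have l1 : 0 < 1 - lam := sub_pos.2 h.lam_lt_one
  have hV : ∀ i, ‖quad a b i‖ ≤ 1 := fun i => by
    have := h.a_pos.le
    have := h.a_lt_one.le
    have := h.b_pos.le
    have := h.b_lt_one.le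
    fin_cases i <;> simp [quad, Prod.norm_def, abs_le] <;> constructor <;> linarith
  induction n with
  | zero => exact le_max_left _ _
  | succ n ih =>
    obtain ⟨i, hi⟩ := hp n
    rw [Function.iterate_succ_apply', billiard_of_mem lam hi]
    have e : reflect lam (quad a b i) ((billiard (quad a b) lam)^[n] p)
        = (1 + lam) • quad a b i - lam • (billiard (quad a b) lam)^[n] p := by
      simp only [reflect]; module
    rw [e]
    refine (norm_sub_le _ _).trans ?_
    rw [norm_smul, norm_smul, Real.norm_of_nonneg l0.le, Real.norm_of_nonneg (by linarith)]
    -- A step multiplies the norm by `lam` and adds at most `1 + lam`, which is less than `2`; this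
    -- preserves every ball of radius at least `2 / (1 - lam)`.
    have h1 : 2 ≤ (1 - lam) * max ‖p‖ (2 / (1 - lam)) := by
      rw [← div_le_iff₀' l1]; exact le_max_right _ _
    nlinarith [hV i, h.lam_lt_one]

theorem omegaSet_attracts (h : Params a b lam)
    (hp : ∀ n, ∃ i, (billiard (quad a b) lam)^[n] p ∈ tangentRegion (quad a b) i) :
    IsCompact (omegaSet (quad a b) lam p) ∧ (omegaSet (quad a b) lam p).Nonempty ∧
      Tendsto (fun n : ℕ => Metric.infDist ((billiard (quad a b) lam)^[n] p)
        (omegaSet (quad a b) lam p)) atTop (𝓝 0) := by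
  set C : Set (ℝ × ℝ) := Metric.closedBall 0 (max ‖p‖ (2 / (1 - lam)))
  have hC : IsCompact C := isCompact_closedBall _ _
  have hmem : ∀ n, (billiard (quad a b) lam)^[n] p ∈ C := fun n =>
    mem_closedBall_zero_iff.2 (norm_iterate_le h hp n)
  have hclosed : IsClosed (omegaSet (quad a b) lam p) := isClosed_omegaLimit _ _ _
  have hsub : omegaSet (quad a b) lam p ⊆ C := fun z hz => by
    by_contra hn
    obtain ⟨n, hn⟩ := (mem_omegaSet.1 hz _ (hC.isClosed.isOpen_compl.mem_nhds hn)).exists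
    exact hn (hmem n)
  have hacc : ∀ S : Set (ℝ × ℝ), IsClosed S →
      (∃ᶠ n in atTop, (billiard (quad a b) lam)^[n] p ∈ S) →
      ∃ z ∈ S, z ∈ omegaSet (quad a b) lam p := fun S hS hfr => by
    obtain ⟨z, hz, hcl⟩ := (hC.inter_right hS).exists_mapClusterPt_of_frequently
      (hfr.mono fun n hn => ⟨hmem n, hn⟩)
    exact ⟨z, hz.2, mem_omegaSet.2 (mapClusterPt_iff_frequently.1 hcl)⟩
  obtain ⟨z0, -, hz0⟩ := hacc univ isClosed_univ (Frequently.of_forall fun _ => mem_univ _)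
  refine ⟨hC.of_isClosed_subset hclosed hsub, ⟨z0, hz0⟩, ?_⟩
  refine tendsto_order.2 ⟨fun r hr => Eventually.of_forall fun n =>
    hr.trans_le Metric.infDist_nonneg, fun r hr => ?_⟩
  by_contra hn
  obtain ⟨z, hz, hz'⟩ := hacc {w | r ≤ Metric.infDist w (omegaSet (quad a b) lam p)}
    (isClosed_le continuous_const (Metric.continuous_infDist_pt _))
    ((not_eventually.1 hn).mono fun n hn => not_lt.1 hn)
  have : r ≤ 0 := (Metric.infDist_zero_of_mem hz') ▸ hz
  exact absurd hr (not_lt.2 this)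

end OmegaSet

/-! ### The limit set is a Cantor set -/

section CantorCase

open MeasureTheory

open Pointwise in
theorem volume_image_affine (c r : ℝ) (s : Set ℝ) :
    volume ((fun x => c + r * x) '' s) = ENNReal.ofReal |r| * volume s := by
  have e : (fun x => c + r * x) '' s = c +ᵥ r • s := by
    rw [← image_smul, ← image_vadd, image_image]; rfl
  rw [e, measure_vadd, Measure.addHaar_smul]
  simp

theorem subsingleton_of_isPreconnected_of_null {t : Set ℝ} (ht : IsPreconnected t)
    (h0 : volume t = 0) : t.Subsingleton := by
  by_contra hn
  rw [not_subsingleton_iff] at hn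
  obtain ⟨x, hx, y, hy, hxy⟩ := hn.exists_lt
  have h1 := measure_mono_null (ht.Icc_subset hx hy) h0
  rw [Real.volume_Icc, ENNReal.ofReal_eq_zero] at h1
  linarith

variable {a b lam : ℝ} {p p' z : ℝ × ℝ} {s : Bool}

theorem isCompact_returnLimit (h : Params a b lam) (hp : p ∈ core a b lam) :
    IsCompact (returnLimit a b lam p s) := by
  refine (isBounded_core h).isCompact_closure.of_isClosed_subset isClosed_returnLimit fun z hz =>
    mem_of_mem_returnLimit isClosed_closure (Eventually.of_forall fun n _ =>
      subset_closure (visit_mem_core h hp n)) hz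

/-- The projections of the two types meet in at most the cut point, so the measure of their union is
additive. The union is covered by their images under complete returns, which contract by at least
`lam ^ 4`. A finite measure `m` with `m ≤ lam ^ 4 * m` vanishes. -/
theorem volume_fst_returnLimit (h : Params a b lam) (hp : p ∈ core a b lam) (s : Bool) :
    volume (Prod.fst '' returnLimit a b lam p s) = 0 := by
  set Z : Bool → Set ℝ := fun s => Prod.fst '' returnLimit a b lam p s
  have l0 := h.lam_pos
  have hc : ∀ s, IsCompact (Z s) := fun s => (isCompact_returnLimit h hp).image continuous_fst
  have hcov : Z true ∪ Z false ⊆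
      ⋃ s : Bool, (fun x => (legOffset a b lam s (returnTime s)).1 + (-lam) ^ returnTime s * x) ''
        Z s := by
    rw [union_subset_iff]
    refine ⟨?_, ?_⟩ <;>
    · rintro _ ⟨z, hz, rfl⟩
      obtain ⟨s, z', hz', rfl⟩ := exists_leg_of_mem_returnLimit h hp hz
      exact mem_iUnion.2 ⟨s, z'.1, ⟨z', hz', rfl⟩, rfl⟩
  have hinter : Z true ∩ Z false ⊆ {-((1 - cut a lam) * lenL a lam)} := by
    rintro _ ⟨⟨z, hz, rfl⟩, z', hz', e⟩
    have e1 : param a lam z' = param a lam z := by rw [param, param, e]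
    have e2 := (param_le_cut_of_mem_returnLimit hz).antisymm
      (e1 ▸ cut_le_param_of_mem_returnLimit hz')
    rw [mem_singleton_iff, fst_eq_of_param h z, e2]
  have hadd : volume (Z true ∪ Z false) = volume (Z true) + volume (Z false) :=
    measure_union₀ (hc false).measurableSet.nullMeasurableSet
      (measure_mono_null hinter (by simp))
  have hle : volume (Z true ∪ Z false) ≤ ENNReal.ofReal (lam ^ 4) * volume (Z true ∪ Z false) := by
    refine (measure_mono hcov).trans ((measure_iUnion_le _).trans ?_)
    rw [tsum_fintype, hadd, mul_add, Fintype.sum_bool]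
    refine add_le_add ?_ ?_ <;>
    · rw [volume_image_affine]
      refine mul_le_mul_left (ENNReal.ofReal_le_ofReal ?_) _
      rw [abs_pow, abs_neg, abs_of_pos l0]
      exact pow_le_pow_of_le_one l0.le h.lam_lt_one.le (four_le_returnTime _)
  have hfin : volume (Z true ∪ Z false) ≠ ⊤ := ((hc true).union (hc false)).measure_lt_top.ne
  have h0 : volume (Z true ∪ Z false) = 0 := by
    by_contra hne
    have hlt : ENNReal.ofReal (lam ^ 4) < 1 :=
      ENNReal.ofReal_lt_one.2 (pow_lt_one₀ l0.le h.lam_lt_one (by norm_num))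
    have := (ENNReal.mul_lt_mul_iff_left hne hfin).2 hlt
    rw [one_mul] at this
    exact absurd hle (not_le.2 this)
  refine measure_mono_null ?_ h0
  cases s
  · exact subset_union_right
  · exact subset_union_left

/-- A connected subset has connected projections. The horizontal one lies in a null set and the
vertical one in a finite set, since cluster points of returns have height `1`, so both are at most
single points. -/
theorem isTotallyDisconnected_omegaSet (h : Params a b lam) (hp : p ∈ core a b lam) :
    IsTotallyDisconnected (omegaSet (quad a b) lam p) := by
  have hcov : ∀ z ∈ omegaSet (quad a b) lam p, ∃ (s : Bool) (j : Fin 6),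
      ∃ z' ∈ returnLimit a b lam p s, leg a b lam s j z' = z := fun z hz => by
    obtain ⟨s, j, hj, z', hz', e⟩ := exists_leg_of_mem_omegaSet h hp hz
    exact ⟨s, ⟨j, hj.trans_le (returnTime_le_six s)⟩, z', hz', e⟩
  have h1 : volume (Prod.fst '' omegaSet (quad a b) lam p) = 0 := by
    have hsub : Prod.fst '' omegaSet (quad a b) lam p ⊆ ⋃ (s : Bool) (j : Fin 6),
        (fun x => (legOffset a b lam s j).1 + (-lam) ^ (j : ℕ) * x) ''
          (Prod.fst '' returnLimit a b lam p s) := by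
      rintro _ ⟨z, hz, rfl⟩
      obtain ⟨s, j, z', hz', rfl⟩ := hcov z hz
      exact mem_iUnion₂.2 ⟨s, j, z'.1, ⟨z', hz', rfl⟩, rfl⟩
    refine measure_mono_null hsub (measure_iUnion_null fun s => measure_iUnion_null fun j => ?_)
    rw [volume_image_affine, volume_fst_returnLimit h hp, mul_zero]
  have h2 : volume (Prod.snd '' omegaSet (quad a b) lam p) = 0 := by
    refine (Set.Finite.subset (finite_range fun q : Bool × Fin 6 =>
      (legOffset a b lam q.1 q.2).2 + (-lam) ^ (q.2 : ℕ) * 1) ?_).measure_zero volume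
    rintro _ ⟨z, hz, rfl⟩
    obtain ⟨s, j, z', hz', rfl⟩ := hcov z hz
    exact ⟨(s, j), by rw [← snd_eq_one_of_mem_returnLimit h hp hz']; rfl⟩
  intro t ht hpre x hx y hy
  refine Prod.ext ?_ ?_
  · exact subsingleton_of_isPreconnected_of_null (hpre.image _ continuous_fst.continuousOn)
      (measure_mono_null (image_mono ht) h1) ⟨x, hx, rfl⟩ ⟨y, hy, rfl⟩
  · exact subsingleton_of_isPreconnected_of_null (hpre.image _ continuous_snd.continuousOn)
      (measure_mono_null (image_mono ht) h2) ⟨x, hx, rfl⟩ ⟨y, hy, rfl⟩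

/-- Points of the strip whose parameter is never mapped to the cut are regular. -/
theorem mem_core_of_param (h : Params a b lam) (hp : p ∈ strip a lam)
    (hc : ∀ n, unitPart ((circleLift h)^[n] (param a lam p)) ≠ cut a lam) :
    p ∈ core a b lam := by
  have key : ∀ n, ∀ q ∈ strip a lam,
      (∀ n, unitPart ((circleLift h)^[n] (param a lam q)) ≠ cut a lam) →
      (billiard (quad a b) lam)^[n] q ∉ polygon (quad a b) ∪ singularSet (quad a b) := by
    intro n
    induction n using Nat.strong_induction_on with
    | _ n ih =>
      intro q hq hqc
      have hq0 : unitPart (param a lam q) = param a lam q :=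
        unitPart_of_mem (Ioo_subset_Ioc_self (param_mem_Ioo h hq))
      have hne : param a lam q ≠ cut a lam := by
        have := hqc 0
        rwa [Function.iterate_zero_apply, hq0] at this
      obtain ⟨r1, -, r3, r4, -⟩ := strip_return h hq hne (s := isShort a lam q) rfl
      rcases Nat.lt_or_ge n (returnTime (isShort a lam q)) with hlt | hge
      · exact (r1 n hlt).2
      · obtain ⟨m, rfl⟩ := Nat.exists_eq_add_of_le' hge
        have h4 := four_le_returnTime (isShort a lam q)
        rw [Function.iterate_add_apply]
        refine ih m (by omega) _ r3 fun k => ?_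
        -- The iterates modulo one depend only on the starting point modulo one, so the hypothesis
        -- passes from `q` to its return.
        have hfe : ∀ k, ∀ x y, unitPart x = unitPart y →
            unitPart ((circleLift h)^[k] x) = unitPart ((circleLift h)^[k] y) := fun k => by
          induction k with
          | zero => exact fun _ _ e => e
          | succ k ihk =>
            intro x y e
            rw [Function.iterate_succ_apply, Function.iterate_succ_apply]
            refine ihk _ _ ?_
            rw [circleLift_apply, circleLift_apply, (unitPart_liftFun h x).1,
              (unitPart_liftFun h y).1, e]
        have hstep := hqc (k + 1)
        rw [Function.iterate_succ_apply] at hstep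
        rwa [hfe k _ (circleLift h (param a lam q))]
        rw [circleLift_apply, (unitPart_liftFun h _).1, hq0, r4]
        exact unitPart_of_mem (inducedMap_mem h (Ioo_subset_Ioc_self (param_mem_Ioo h hq)))
  exact ⟨hp, fun hm => key 0 p hp hc (Or.inl hm), fun n hn => key n p hp hc (Or.inr hn)⟩

/-- The iterates of the lift are injective, so only countably many parameters ever reach a translate
of the cut. -/
theorem exists_param_regular (h : Params a b lam) : ∃ x ∈ Ioo (0 : ℝ) 1,
    ∀ n, unitPart ((circleLift h)^[n] x) ≠ cut a lam := by
  have hcount : (⋃ (n : ℕ) (m : ℤ), (circleLift h)^[n] ⁻¹' {cut a lam + m}).Countable :=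
    countable_iUnion fun n => countable_iUnion fun m =>
      (countable_singleton _).preimage ((circleLift_strictMono h).injective.iterate n)
  obtain ⟨x, hx, hx'⟩ := (hcount.dense_compl ℝ).exists_mem_open isOpen_Ioo
    (nonempty_Ioo.2 (zero_lt_one (α := ℝ)))
  refine ⟨x, hx', fun n hn => hx (mem_iUnion₂.2 ⟨n, ⌈(circleLift h)^[n] x⌉ - 1, ?_⟩)⟩
  rw [mem_preimage, mem_singleton_iff, ← hn, unitPart]
  push_cast; ring

/-- Regular points exist in arbitrarily small rectangles; otherwise the condition on `K` could be
vacuous and uniqueness would fail. -/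
theorem eventually_exists_core_mem_rectTwo (h : Params a b lam) :
    ∀ᶠ ε in 𝓝[>] (0 : ℝ), ∃ p ∈ core a b lam, p ∈ rectTwo a lam ε := by
  obtain ⟨x, hx, hreg⟩ := exists_param_regular h
  have hl := lenL_pos h
  filter_upwards [eventually_mem_strip h hx, eventually_pos,
    eventually_lt_const (mul_pos hx.1 hl)] with ε hS h0 h1
  have hε : 0 < ε ^ 2 := by positivity
  refine ⟨_, mem_core_of_param h (hS _ ⟨hε, le_rfl⟩) (by rwa [param_mk h]), ⟨?_, ?_⟩,
    le_rfl, by simp only; linarith⟩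
  · simp only; linarith
  · simp only; nlinarith [hx.2]

theorem irrational_case (h : Params a b lam)
    (hρ : Irrational (circleLift h).translationNumber) :
    ∃! K : Set (ℝ × ℝ), IsCantor K ∧
      ∀ᶠ ε in 𝓝[>] (0 : ℝ),
        ∀ p ∈ regularSet (quad a b) lam ∩ (rectOne a lam ε ∪ rectTwo a lam ε),
          omegaSet (quad a b) lam p = K ∧
          Tendsto (fun n : ℕ => Metric.infDist ((billiard (quad a b) lam)^[n] p) K)
            atTop (𝓝 0) := by
  have hex := eventually_exists_core_mem_rectTwo h
  obtain ⟨-, p₀, hp₀, -⟩ := hex.exists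
  have hK : ∀ p ∈ absorbed a b lam, omegaSet (quad a b) lam p = omegaSet (quad a b) lam p₀ := by
    rintro p ⟨-, -, m, hm⟩
    rw [← omegaSet_iterate m]
    exact (omegaSet_subset h hρ hm hp₀).antisymm (omegaSet_subset h hρ hp₀ hm)
  obtain ⟨hcomp, hne, -⟩ := omegaSet_attracts h (absorbed_of_core h hp₀).2.1
  refine ⟨omegaSet (quad a b) lam p₀, ⟨isCantor_of_compact hcomp hne
    (isTotallyDisconnected_omegaSet h hp₀) fun z hz r hr => omegaSet_perfect h hρ hp₀ hz hr, ?_⟩, ?_⟩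
  · filter_upwards [eventually_absorbed h] with ε hε p hp
    have hpa := (hε p hp.2).self_of_nhds hp.1
    refine ⟨hK p hpa, ?_⟩
    rw [← hK p hpa]
    exact (omegaSet_attracts h hpa.2.1).2.2
  · rintro K' ⟨-, hK'⟩
    obtain ⟨ε, hε, p, hp, hp2⟩ := (hK'.and hex).exists
    rw [← (hε p ⟨hp.2, Or.inr hp2⟩).1]
    exact hK p (absorbed_of_core h hp)

end CantorCase

end ContractedBilliard

theorem mainTheorem6 (a b lam : ℝ) (ha0 : 0 < a) (ha1 : a < 1) (hb0 : 0 < b) (hb1 : b < 1)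
    (hab : a + b ≤ 1) (hlam : lam = 1 - b) (hrange : a < 1 + lam - lam ^ 3 - lam ^ 4) :
    -- `g` is well defined as the map induced by the first return
    (∀ x ∈ Ioo (0 : ℝ) 1, x ≠ 1 - ContractedBilliard.lenH a lam / ContractedBilliard.lenL a lam →
      ∃! z, ContractedBilliard.IsReturnValue a b x z) ∧
    MapsTo (ContractedBilliard.returnMap a b) (Ioc 0 1) (Ioc 0 1) ∧
    -- `g` is given by the formula
    (∀ x, 0 < x → x < 1 - ContractedBilliard.lenH a lam / ContractedBilliard.lenL a lam →
      ContractedBilliard.returnMap a b x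
        = lam ^ 4 * (x - 1 + ContractedBilliard.lenH a lam / ContractedBilliard.lenL a lam) + 1) ∧
    (∀ x, 1 - ContractedBilliard.lenH a lam / ContractedBilliard.lenL a lam < x → x ≤ 1 →
      ContractedBilliard.returnMap a b x
        = lam ^ 6 * (x - 1)
          + (1 - ContractedBilliard.lenY a lam / ContractedBilliard.lenL a lam)) ∧
    -- `g` is an injective piecewise contraction
    InjOn (ContractedBilliard.returnMap a b) (Ioc 0 1) ∧
    (∃ k : NNReal, k < 1 ∧
      LipschitzOnWith k (ContractedBilliard.returnMap a b)
        (Ioc 0 (1 - ContractedBilliard.lenH a lam / ContractedBilliard.lenL a lam)) ∧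
      LipschitzOnWith k (ContractedBilliard.returnMap a b)
        (Ioc (1 - ContractedBilliard.lenH a lam / ContractedBilliard.lenL a lam) 1)) ∧
    -- the rotation number is well defined, and the dichotomy holds
    ∃ ρ : ℝ, ContractedBilliard.HasRotationNumber (ContractedBilliard.returnMap a b) ρ ∧
      (¬ Irrational ρ →
        ∀ᶠ ε in 𝓝[>] (0 : ℝ),
          {O : Set (ℝ × ℝ) | ∃ w, ContractedBilliard.IsPeriodicOrbit
              (ContractedBilliard.quad a b) lam w ∧ O = range w ∧
              (O ∩ (ContractedBilliard.rectOne a lam ε ∪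
                ContractedBilliard.rectTwo a lam ε)).Nonempty}.encard ≤ 2 ∧
          ∀ p ∈ ContractedBilliard.regularSet (ContractedBilliard.quad a b) lam ∩
              (ContractedBilliard.rectOne a lam ε ∪ ContractedBilliard.rectTwo a lam ε),
            ∃ w, ContractedBilliard.IsPeriodicOrbit (ContractedBilliard.quad a b) lam w ∧
              (range w ∩ (ContractedBilliard.rectOne a lam ε ∪
                ContractedBilliard.rectTwo a lam ε)).Nonempty ∧
              Tendsto (fun n : ℕ => dist
                ((ContractedBilliard.billiard (ContractedBilliard.quad a b) lam)^[n] p) (w n))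
                atTop (𝓝 0)) ∧
      (Irrational ρ →
        ∃! K : Set (ℝ × ℝ), ContractedBilliard.IsCantor K ∧
          ∀ᶠ ε in 𝓝[>] (0 : ℝ),
            ∀ p ∈ ContractedBilliard.regularSet (ContractedBilliard.quad a b) lam ∩
                (ContractedBilliard.rectOne a lam ε ∪ ContractedBilliard.rectTwo a lam ε),
              ContractedBilliard.omegaSet (ContractedBilliard.quad a b) lam p = K ∧
              Tendsto (fun n : ℕ => Metric.infDist
                ((ContractedBilliard.billiard (ContractedBilliard.quad a b) lam)^[n] p) K)
                atTop (𝓝 0)) := by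
  have h : ContractedBilliard.Params a b lam := ⟨ha0, ha1, hb0, hb1, hab, hlam, hrange⟩
  have hgf : EqOn (ContractedBilliard.inducedMap a lam) (ContractedBilliard.returnMap a b)
      (Ioc 0 1) := fun x hx => (ContractedBilliard.returnMap_eq h hx).symm
  have hc1 := ContractedBilliard.cut_le_one h
  have hc0 := ContractedBilliard.cut_pos h
  refine ⟨fun x hx hxc => ?_, fun x hx => ?_, fun x hx hxc => ?_, fun x hxc hx => ?_,
    (ContractedBilliard.inducedMap_injOn h).congr hgf, ?_,
    _, ContractedBilliard.hasRotationNumber h, ContractedBilliard.rational_case h,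
    ContractedBilliard.irrational_case h⟩
  · exact ⟨_, ContractedBilliard.isReturnValue_inducedMap h hx hxc,
      fun z hz => hz.unique h (ContractedBilliard.isReturnValue_inducedMap h hx hxc)⟩
  · rw [ContractedBilliard.returnMap_eq h hx]
    exact ContractedBilliard.inducedMap_mem h hx
  · have hxc' : x < ContractedBilliard.cut a lam := hxc
    rw [ContractedBilliard.returnMap_eq h ⟨hx, hxc.le.trans hc1⟩,
      ContractedBilliard.inducedMap, if_pos hxc'.le]
  · have hxc' : ContractedBilliard.cut a lam < x := hxc
    rw [ContractedBilliard.returnMap_eq h ⟨hc0.trans hxc, hx⟩,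
      ContractedBilliard.inducedMap, if_neg (not_le.2 hxc')]
  · obtain ⟨k, hk, h1, h2⟩ := ContractedBilliard.inducedMap_lipschitz h
    refine ⟨k, hk, fun x hx y hy => ?_, fun x hx y hy => ?_⟩
    · rw [← hgf ⟨hx.1, hx.2.trans hc1⟩, ← hgf ⟨hy.1, hy.2.trans hc1⟩]
      exact h1 hx hy
    · rw [← hgf ⟨hc0.trans hx.1, hx.2⟩, ← hgf ⟨hc0.trans hy.1, hy.2⟩]
      exact h2 hx hy
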